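/- Notation: $(x)_0=1$, $(x)_k=x(x+1)\cdots(x+k-1)$ for $k\ge 1$, and $${}_{p+1}F_p\left[\begin{matrix}\alpha_0,\dots,\alpha_p\\ \beta_1,\dots,\beta_p\end{matrix};z\right]=\sum_{k\ge0}\frac{(\alpha_0)_k\cdots(\alpha_p)_k}{k!\,(\beta_1)_k\cdots(\beta_p)_k}z^k ,$$ where no $\beta_i$ is a non-positive integer. $1/\Gamma$ is read as an entire function, so that a quotient with a pole of $\Gamma$ in its denominator is $0$. Empty sums are $0$ and empty products are $1$. **(i)** Let $s\ge1$ be an integer and let $a,b_1,\dots,b_{s+1},c_1,\dots,c_{s+1}$ be complex numbers such that none of $\frac a2$, $1+a-b_j$, $1+a-c_j$ ($j=1,\dots,s+1$) is a non-positive integer. Assume that $$\operatorname{Re}\Big((2s+1)(a+1)-2\sum_{j=1}^{s+1}(b_j+c_j)\Big)>0$$ and $$\operatorname{Re}\Big((1+a-b_{s+1}-c_{s+1})+\sum_{j=r}^{s}A_j(1+a-b_j-c_j)\Big)>0$$ for all $r=2,3,\dots,s+1$ and all choices of $A_j\in\{1,2\}$, $2\le j\le s$. Then both series below converge absolutely and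 $${}_{2s+4}F_{2s+3}\left[\begin{matrix}a,\frac a2+1,b_1,c_1,\dots,b_{s+1},c_{s+1}\\ \frac a2,1+a-b_1,1+a-c_1,\dots,1+a-b_{s+1},1+a-c_{s+1}\end{matrix};-1\right]$$ $$=\frac{\Gamma(1+a-b_{s+1})\,\Gamma(1+a-c_{s+1})}{\Gamma(1+a)\,\Gamma(1+a-b_{s+1}-c_{s+1})}\sum_{k_1,\dots,k_s\ge0}\ \prod_{j=1}^{s}\frac{(1+a-b_j-c_j)_{k_j}\,(b_{j+1})_{k_1+\cdots+k_j}\,(c_{j+1})_{k_1+\cdots+k_j}}{k_j!\,(1+a-b_j)_{k_1+\cdots+k_j}\,(1+a-c_j)_{k_1+\cdots+k_j}} .$$ **(ii)** Let $s\ge1$ be an integer and let $a,c_0,b_1,\dots,b_s,c_1,\dots,c_s$ be complex numbers such that none of $\frac a2$, $1+a-c_0$, $1+a-b_j$, $1+a-c_j$ ($j=1,\dots,s$) is a non-positive integer. Assume that $$\operatorname{Re}\Big(2s(a+1)-2c_0-2\sum_{j=1}^{s}(b_j+c_j)\Big)>0,$$ $$\operatorname{Re}\Big((1+a-b_s-c_s)+\sum_{j=r}^{s-1}A_j(1+a-b_j-c_j)\Big)>0\qquad(r=2,3,\dots,s),$$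 $$\operatorname{Re}\Big((1+a-c_0-b_1-c_1)+\sum_{j=2}^{s-1}A_j(1+a-b_j-c_j)\Big)>0$$ for all choices of $A_j\in\{1,2\}$, $2\le j\le s-1$. Put $$T(k_1,\dots,k_s)=\frac{(b_1)_{k_1}(c_1)_{k_1}}{k_1!\,(1+a-c_0)_{k_1}}\prod_{j=2}^{s}\frac{(1+a-b_{j-1}-c_{j-1})_{k_j}\,(b_j)_{k_1+\cdots+k_j}\,(c_j)_{k_1+\cdots+k_j}}{k_j!\,(1+a-b_{j-1})_{k_1+\cdots+k_j}\,(1+a-c_{j-1})_{k_1+\cdots+k_j}} .$$ Then $${}_{2s+3}F_{2s+2}\left[\begin{matrix}a,\frac a2+1,c_0,b_1,c_1,\dots,b_s,c_s\\ \frac a2,1+a-c_0,1+a-b_1,1+a-c_1,\dots,1+a-b_s,1+a-c_s\end{matrix};1\right] =\frac{\Gamma(1+a-b_s)\,\Gamma(1+a-c_s)}{\Gamma(1+a)\,\Gamma(1+a-b_s-c_s)}\sum_{k_1\ge0}\ \sum_{k_2,\dots,k_s\ge0}T(k_1,\dots,k_s),$$ where the hypergeometric series, the inner sum for each $k_1$,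 and the outer sum over $k_1$ converge absolutely. If moreover $s=1$, or $$\operatorname{Re}\Big((1+a-c_0-b_1-c_1)+(1+a-b_1-c_1)+\sum_{j=2}^{s-1}A_j(1+a-b_j-c_j)+(1+a-b_s-c_s)\Big)>0$$ for all choices of $A_j\in\{1,2\}$, $2\le j\le s-1$, then the family $T(k_1,\dots,k_s)$, $k_1,\dots,k_s\ge0$, is absolutely summable, and the identity holds with the multiple sum taken in any order. -/

import Mathlib

/-- The `k`-th term of the generalized hypergeometric series with upper parameters `α`, lower
parameters `β` (the `1` belonging to the factor `k!` is not listed) and argument `z`. Here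
`(ascPochhammer ℂ k).eval x` is the rising factorial `x (x + 1) ⋯ (x + k - 1)`. -/
noncomputable def hypergeometricTerm (α β : List ℂ) (z : ℂ) (k : ℕ) : ℂ :=
  (α.map fun x => (ascPochhammer ℂ k).eval x).prod /
    ((k.factorial : ℂ) * (β.map fun x => (ascPochhammer ℂ k).eval x).prod) * z ^ k

/-- The sum of the generalized hypergeometric series. -/
noncomputable def hypergeometricSum (α β : List ℂ) (z : ℂ) : ℂ :=
  ∑' k : ℕ, hypergeometricTerm α β z k

/-- `a, a/2 + 1, b₁, c₁, …, b_{s+1}, c_{s+1}`. -/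
noncomputable def upperEven (s : ℕ) (a : ℂ) (b c : ℕ → ℂ) : List ℂ :=
  a :: (a / 2 + 1) :: (List.range (s + 1)).flatMap fun j => [b (j + 1), c (j + 1)]

/-- `a/2, 1 + a - b₁, 1 + a - c₁, …, 1 + a - b_{s+1}, 1 + a - c_{s+1}`. -/
noncomputable def lowerEven (s : ℕ) (a : ℂ) (b c : ℕ → ℂ) : List ℂ :=
  (a / 2) :: (List.range (s + 1)).flatMap fun j => [1 + a - b (j + 1), 1 + a - c (j + 1)]

/-- `a, a/2 + 1, c₀, b₁, c₁, …, b_s, c_s`. -/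
noncomputable def upperOdd (s : ℕ) (a : ℂ) (b c : ℕ → ℂ) : List ℂ :=
  a :: (a / 2 + 1) :: c 0 :: (List.range s).flatMap fun j => [b (j + 1), c (j + 1)]

/-- `a/2, 1 + a - c₀, 1 + a - b₁, 1 + a - c₁, …, 1 + a - b_s, 1 + a - c_s`. -/
noncomputable def lowerOdd (s : ℕ) (a : ℂ) (b c : ℕ → ℂ) : List ℂ :=
  (a / 2) :: (1 + a - c 0) ::
    (List.range s).flatMap fun j => [1 + a - b (j + 1), 1 + a - c (j + 1)]

/-- The factor
`(1+a-b_j-c_j)_k (b_{j+1})_K (c_{j+1})_K / (k! (1+a-b_j)_K (1+a-c_j)_K)`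
of the summands of the multiple sums. -/
noncomputable def multisumFactor (a : ℂ) (b c : ℕ → ℂ) (j k K : ℕ) : ℂ :=
  (ascPochhammer ℂ k).eval (1 + a - b j - c j) * (ascPochhammer ℂ K).eval (b (j + 1)) *
      (ascPochhammer ℂ K).eval (c (j + 1)) /
    ((k.factorial : ℂ) * (ascPochhammer ℂ K).eval (1 + a - b j) *
      (ascPochhammer ℂ K).eval (1 + a - c j))

/-- The summand of the multiple sum over `k₁, …, k_s` in the even case; `k_j` is `k (j - 1)`. -/
noncomputable def multisumTermEven (s : ℕ) (a : ℂ) (b c : ℕ → ℂ) (k : Fin s → ℕ) : ℂ :=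
  ∏ j : Fin s, multisumFactor a b c (j.val + 1) (k j) (∑ i ∈ Finset.Iic j, k i)

/-- The summand of the multiple sum over `k₁, …, k_s` in the odd case (`s ≥ 1`). The first index
`k₁` is a separate argument, and `k_j` is `k (j - 2)` for `2 ≤ j ≤ s`. -/
noncomputable def multisumTermOdd (s : ℕ) (a : ℂ) (b c : ℕ → ℂ) (k₁ : ℕ) (k : Fin (s - 1) → ℕ) :
    ℂ :=
  (ascPochhammer ℂ k₁).eval (b 1) * (ascPochhammer ℂ k₁).eval (c 1) /
      ((k₁.factorial : ℂ) * (ascPochhammer ℂ k₁).eval (1 + a - c 0)) *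
    ∏ j : Fin (s - 1),
      multisumFactor a b c (j.val + 1) (k j) (k₁ + ∑ i ∈ Finset.Iic j, k i)

/-- The quotient `Γ(1+a-b) Γ(1+a-c) / (Γ(1+a) Γ(1+a-b-c))`. At a pole of a Gamma function in the
denominator the quotient is `0`, in agreement with `1 / Γ` being entire. -/
noncomputable def gammaQuotient (a b c : ℂ) : ℂ :=
  Complex.Gamma (1 + a - b) * Complex.Gamma (1 + a - c) /
    (Complex.Gamma (1 + a) * Complex.Gamma (1 + a - b - c))

/-! The identities come from iterating Bailey's lemma in the limit `q → 1`. A Bailey pair relative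
to `a` expresses `β n` as the sum of `α r / ((n - r)! Γ(1 + a + n + r))` over `r ≤ n`. By the
Pfaff–Saalschütz sum, multiplying `α r` by `(b)_r (c)_r / ((1 + a - b)_r (1 + a - c)_r)` yields
another Bailey pair, whose `β` is a convolution of the old one (`IsBaileyPair.bailey_lemma`). Each
step thus puts one pair of parameters into the single series and one summation index into the
multiple sum (`IsBaileyPair.exists_hasSum_chain`). The last pair of parameters enters through the
limit `n → ∞`, where Saalschütz becomes Gauss's theorem and the Gamma quotient appears
(`IsBaileyPair.tsum_eq`). Part (i) starts from the unit pair, whose `β` is supported at `0`; part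
(ii) starts from the pair obtained from it by one limiting step with parameter `c₀`.

The analysis lies in the rearrangements. Summing norms one index at a time leads to discrete beta
sums. Write `U j = Re (1 + a - b j - c j)`. For `U j ≤ 0` norms do not see the cancellation in the
sum over the index with factor `(1 + a - b j - c j)_k / k!`, and the resulting loss is what the
choices `A j ∈ {1, 2}` encode (`exists_tsum_norm_chainTerm_le`, `le_decayExp`).

In (ii) the multiple sum need not be absolutely summable. The identity is first proved for `Re c₀`
very negative and then continued analytically in `c₀`, both sides being divided by `Γ(1 + a - c₀)`.
Convergence of the outer sum on the whole half-plane needs the true decay of the inner sum, not the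
decay of its norms. For this the inner sum is read as an iterated fractional sum, and summation by
parts recovers the cancellation (`IsSymbol.fracSum`, `isSymbol_chainSum`). For `s = 1` the two sides
are evaluated directly by Gauss's theorem when `Re c₀` is small. -/

open Filter Topology

/-! ### Rising factorials and the reciprocal Gamma function. -/

/-- The rising factorial `x (x + 1) ⋯ (x + k - 1)`. -/
noncomputable def rising (x : ℂ) (k : ℕ) : ℂ := (ascPochhammer ℂ k).eval x

/-- The reciprocal Gamma function, an entire function. -/
noncomputable def rGamma (x : ℂ) : ℂ := (Complex.Gamma x)⁻¹

@[simp] lemma rising_zero (x : ℂ) : rising x 0 = 1 := by simp [rising]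

lemma rising_succ (x : ℂ) (k : ℕ) : rising x (k + 1) = rising x k * (x + k) := by
  simp [rising, ascPochhammer_succ_eval]

lemma rising_add (x : ℂ) (m k : ℕ) : rising x (m + k) = rising x m * rising (x + m) k := by
  induction k with
  | zero => simp
  | succ k ih => rw [← add_assoc, rising_succ, ih, rising_succ]; push_cast; ring

lemma rising_succ_left (x : ℂ) (k : ℕ) : rising x (k + 1) = x * rising (x + 1) k := by
  rw [add_comm, rising_add]; simp [rising]

lemma rising_eq_prod (x : ℂ) (k : ℕ) : rising x k = ∏ j ∈ Finset.range k, (x + j) := by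
  induction k with
  | zero => simp
  | succ k ih => rw [rising_succ, ih, Finset.prod_range_succ]

lemma rising_one_eq_factorial (k : ℕ) : rising 1 k = k.factorial := by
  simp [rising]

lemma rising_mul_add (x : ℂ) (k : ℕ) : rising x k * (x + k) = x * rising (x + 1) k := by
  rw [← rising_succ, rising_succ_left]

lemma rising_ne_zero {x : ℂ} (hx : ∀ m : ℕ, x ≠ -(m : ℂ)) (k : ℕ) : rising x k ≠ 0 := by
  induction k with
  | zero => simp
  | succ k ih =>
    rw [rising_succ]
    exact mul_ne_zero ih fun h => hx k (eq_neg_of_add_eq_zero_left h)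

lemma rGamma_eq_mul (x : ℂ) : rGamma x = x * rGamma (x + 1) :=
  Complex.one_div_Gamma_eq_self_mul_one_div_Gamma_add_one x

lemma rGamma_eq_rising_mul (x : ℂ) (k : ℕ) : rGamma x = rising x k * rGamma (x + k) := by
  induction k with
  | zero => simp
  | succ k ih =>
    rw [ih, rising_succ, rGamma_eq_mul (x + k)]; push_cast; ring_nf

lemma rGamma_ne_zero {x : ℂ} (hx : ∀ m : ℕ, x ≠ -(m : ℂ)) : rGamma x ≠ 0 :=
  inv_ne_zero (Complex.Gamma_ne_zero hx)

lemma differentiable_rGamma : Differentiable ℂ rGamma := Complex.differentiable_one_div_Gamma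

lemma inv_rising_eq {x : ℂ} (hx : ∀ m : ℕ, x ≠ -(m : ℂ)) (k : ℕ) :
    (rising x k)⁻¹ = Complex.Gamma x * rGamma (x + k) := by
  have h := rGamma_eq_rising_mul x k
  have h1 := rising_ne_zero hx k
  have h2 : Complex.Gamma x ≠ 0 := Complex.Gamma_ne_zero hx
  rw [rGamma] at h
  field_simp at h ⊢
  linear_combination h

lemma ne_neg_nat_of_re_pos {x : ℂ} (hx : 0 < x.re) (m : ℕ) : x ≠ -(m : ℂ) := by
  rintro rfl
  simp only [Complex.neg_re, Complex.natCast_re] at hx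
  linarith [(Nat.cast_nonneg m : (0 : ℝ) ≤ m)]

/-! ### Power-law bounds for rising factorials and reciprocal Gamma values. -/

/-- `‖1 + w‖² = 1 + 2 Re w + ‖w‖²`, and `1 + x ≤ exp x`. The first-order term is exact, so products
of such factors keep the right power of `k`. -/
lemma norm_one_add_le_exp (w : ℂ) : ‖1 + w‖ ≤ Real.exp (w.re + ‖w‖ ^ 2 / 2) := by
  have h : ‖1 + w‖ ^ 2 ≤ Real.exp (w.re + ‖w‖ ^ 2 / 2) ^ 2 := by
    rw [← Real.exp_nat_mul, ← Complex.normSq_eq_norm_sq]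
    refine le_trans (le_of_eq ?_) (Real.add_one_le_exp _)
    rw [← Complex.normSq_eq_norm_sq, Complex.normSq_apply, Complex.normSq_apply]
    simp only [Complex.add_re, Complex.one_re, Complex.add_im, Complex.one_im]
    push_cast
    ring
  exact le_of_sq_le_sq h (Real.exp_pos _).le

/-- Apply the previous bound to `(1 + w)⁻¹ = 1 + (-w + w² / (1 + w))`, where `‖1 + w‖ ≥ 1` controls
the quadratic remainder. -/
lemma norm_inv_one_add_le_exp {w : ℂ} (hw : 0 ≤ w.re) :
    ‖(1 + w)⁻¹‖ ≤ Real.exp (-w.re + 3 / 2 * ‖w‖ ^ 2) := by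
  have h1 : 1 ≤ ‖1 + w‖ := by
    refine le_trans ?_ (Complex.re_le_norm _)
    simpa using hw
  have h0 : (1 + w) ≠ 0 := by
    intro h; rw [h] at h1; norm_num at h1
  have h2 : ‖w / (1 + w)‖ ≤ ‖w‖ := by
    rw [norm_div]; exact div_le_self (norm_nonneg _) h1
  have h3 : ‖w ^ 2 / (1 + w)‖ ≤ ‖w‖ ^ 2 := by
    rw [norm_div, norm_pow]; exact div_le_self (by positivity) h1
  have e1 : (1 + w)⁻¹ = 1 + (-(w / (1 + w))) := by field_simp; ring
  have e2 : -(w / (1 + w)) = -w + w ^ 2 / (1 + w) := by field_simp; ring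
  rw [e1]
  refine (norm_one_add_le_exp _).trans (Real.exp_le_exp.2 ?_)
  rw [norm_neg]
  have h4 : (-(w / (1 + w))).re ≤ -w.re + ‖w‖ ^ 2 := by
    rw [e2, Complex.add_re, Complex.neg_re]
    linarith [Complex.re_le_norm (w ^ 2 / (1 + w))]
  have h5 : ‖w / (1 + w)‖ ^ 2 ≤ ‖w‖ ^ 2 := by gcongr
  linarith

lemma abs_log_one_add_inv_sub_le (k : ℕ) :
    |Real.log (1 + 1 / ((k : ℝ) + 1)) - 1 / ((k : ℝ) + 1)| ≤ (1 / ((k : ℝ) + 1)) ^ 2 := by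
  set t : ℝ := 1 / ((k : ℝ) + 1) with ht
  have ht0 : 0 < t := by positivity
  have h1 : Real.log (1 + t) ≤ t := by linarith [Real.log_le_sub_one_of_pos (show 0 < 1 + t by linarith)]
  have h2 : 1 - (1 + t)⁻¹ ≤ Real.log (1 + t) := Real.one_sub_inv_le_log_of_pos (by linarith)
  have h3 : t - t ^ 2 ≤ 1 - (1 + t)⁻¹ := by
    have : 1 - (1 + t)⁻¹ - (t - t ^ 2) = t ^ 3 / (1 + t) := by field_simp; ring
    have h : 0 ≤ t ^ 3 / (1 + t) := by positivity
    linarith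
  rw [abs_le]; constructor <;> linarith

lemma sum_inv_sq_le (k : ℕ) : ∑ i ∈ Finset.range k, (1 / ((i : ℝ) + 1)) ^ 2 ≤ 2 - 2 / ((k : ℝ) + 1) := by
  induction k with
  | zero => norm_num
  | succ k ih =>
    rw [Finset.sum_range_succ]
    push_cast
    have h : 2 / ((k : ℝ) + 1) - 2 / ((k : ℝ) + 1 + 1) - (1 / ((k : ℝ) + 1)) ^ 2 =
        k / (((k : ℝ) + 1) ^ 2 * (k + 2)) := by field_simp; ring
    have h' : 0 ≤ (k : ℝ) / (((k : ℝ) + 1) ^ 2 * (k + 2)) := by positivity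
    linarith

/-- A sequence of non-negative reals whose consecutive quotients are at most
`exp (M / (k + 1)²) (1 + 1 / (k + 1)) ^ x` is `O((k + 1) ^ x)`, with an explicit constant. -/
lemma le_mul_rpow_of_ratio_le {f : ℕ → ℝ} {x M : ℝ} (hM : 0 ≤ M) (hf0 : 0 ≤ f 0)
    (hf : ∀ k : ℕ, f (k + 1) ≤
      f k * (Real.exp (M * (1 / ((k : ℝ) + 1)) ^ 2) * Real.exp (x * (1 / ((k : ℝ) + 1))))) (k : ℕ) :
    f k ≤ f 0 * Real.exp (2 * (M + |x|)) * ((k : ℝ) + 1) ^ x := by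
  -- Replacing `exp (x t)` by `(1 + t) ^ x` with `t = 1 / (k + 1)` costs a factor `exp (|x| t²)`;
  -- the powers `(1 + t) ^ x` telescope, and the squares sum to at most `2`.
  have key : ∀ k : ℕ, f k ≤ f 0 *
      Real.exp ((M + |x|) * ∑ i ∈ Finset.range k, (1 / ((i : ℝ) + 1)) ^ 2) * ((k : ℝ) + 1) ^ x := by
    intro k
    induction k with
    | zero => simp
    | succ k ih =>
      refine (hf k).trans ?_
      rw [Finset.sum_range_succ, mul_add, Real.exp_add]
      have hk : (0 : ℝ) < (k : ℝ) + 1 := by positivity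
      have h1 : (((k + 1 : ℕ) : ℝ) + 1) ^ x =
          ((k : ℝ) + 1) ^ x * Real.exp (Real.log (1 + 1 / ((k : ℝ) + 1)) * x) := by
        rw [← Real.rpow_def_of_pos (by positivity), ← Real.mul_rpow (by positivity) (by positivity)]
        congr 1
        push_cast
        field_simp
      have h2 : Real.exp (M * (1 / ((k : ℝ) + 1)) ^ 2) * Real.exp (x * (1 / ((k : ℝ) + 1))) ≤
          Real.exp ((M + |x|) * (1 / ((k : ℝ) + 1)) ^ 2) *
            Real.exp (Real.log (1 + 1 / ((k : ℝ) + 1)) * x) := by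
        rw [← Real.exp_add, ← Real.exp_add, Real.exp_le_exp]
        have h3 := abs_log_one_add_inv_sub_le k
        have h4 : |x * (Real.log (1 + 1 / ((k : ℝ) + 1)) - 1 / ((k : ℝ) + 1))| ≤
            |x| * (1 / ((k : ℝ) + 1)) ^ 2 := by
          rw [abs_mul]; gcongr
        have h5 := (abs_le.1 h4).1
        nlinarith
      rw [h1]
      calc _ ≤ f 0 * Real.exp ((M + |x|) * ∑ i ∈ Finset.range k, (1 / ((i : ℝ) + 1)) ^ 2) *
              ((k : ℝ) + 1) ^ x * (Real.exp ((M + |x|) * (1 / ((k : ℝ) + 1)) ^ 2) *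
            Real.exp (Real.log (1 + 1 / ((k : ℝ) + 1)) * x)) :=
            mul_le_mul ih h2 (by positivity) (by positivity)
        _ = _ := by ring
  refine (key k).trans ?_
  have h6 : ∑ i ∈ Finset.range k, (1 / ((i : ℝ) + 1)) ^ 2 ≤ 2 := by
    have h7 : 0 ≤ 2 / ((k : ℝ) + 1) := by positivity
    linarith [sum_inv_sq_le k]
  rw [mul_comm 2 (M + |x|)]
  gcongr

/-- `(z)_k = O(k! (k + 1) ^ (Re z - 1))`, uniformly on bounded sets. -/
lemma exists_norm_rising_le (ρ : ℝ) : ∃ C : ℝ, 0 < C ∧ ∀ z : ℂ, ‖z‖ ≤ ρ → ∀ k : ℕ,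
    ‖rising z k‖ ≤ C * (k.factorial * ((k : ℝ) + 1) ^ (z.re - 1)) := by
  refine ⟨Real.exp (2 * ((ρ + 1) ^ 2 / 2 + (ρ + 1))), Real.exp_pos _, fun z hz k => ?_⟩
  have hρ : 0 ≤ ρ := (norm_nonneg z).trans hz
  have hz1 : ‖z - 1‖ ≤ ρ + 1 := (norm_sub_le _ _).trans (by simpa using hz)
  have hre : |z.re - 1| ≤ ρ + 1 := by
    have h := (Complex.abs_re_le_norm (z - 1)).trans hz1
    simpa using h
  -- Consecutive quotients of `(z)_k / k!` are `(z + k) / (k + 1) = 1 + (z - 1) / (k + 1)`.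
  have h := le_mul_rpow_of_ratio_le (f := fun k => ‖rising z k‖ / k.factorial) (x := z.re - 1)
    (M := (ρ + 1) ^ 2 / 2) (by positivity) (by simp) (fun k => ?_) k
  · simp only [rising_zero, norm_one, Nat.factorial_zero, Nat.cast_one, div_one, one_mul] at h
    rw [div_le_iff₀ (by positivity)] at h
    refine h.trans ?_
    rw [mul_assoc, mul_comm (_ ^ _)]
    gcongr
  · have hk : ((k : ℂ) + 1) ≠ 0 := Nat.cast_add_one_ne_zero k
    have e : z + k = (k + 1) * (1 + (z - 1) / (k + 1)) := by field_simp; ring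
    have hn : ‖((k : ℂ) + 1)‖ = (k : ℝ) + 1 := by
      rw [← Nat.cast_succ, Complex.norm_natCast]; push_cast; rfl
    rw [rising_succ, Nat.factorial_succ, e, norm_mul, norm_mul, hn]
    push_cast
    have e2 : ‖rising z k‖ * (((k : ℝ) + 1) * ‖1 + (z - 1) / ((k : ℂ) + 1)‖) /
        (((k : ℝ) + 1) * k.factorial) = ‖rising z k‖ / k.factorial * ‖1 + (z - 1) / ((k : ℂ) + 1)‖ := by
      field_simp
    rw [e2]
    gcongr
    refine (norm_one_add_le_exp _).trans ?_
    rw [← Real.exp_add, Real.exp_le_exp, norm_div, hn]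
    have e3 : ((z - 1) / ((k : ℂ) + 1)).re = (z.re - 1) * (1 / ((k : ℝ) + 1)) := by
      have : (k : ℂ) + 1 = (((k : ℝ) + 1 : ℝ) : ℂ) := by push_cast; rfl
      rw [this, Complex.div_ofReal_re]; simp; ring
    rw [e3]
    have h8 : (‖z - 1‖ / ((k : ℝ) + 1)) ^ 2 ≤ (ρ + 1) ^ 2 * (1 / ((k : ℝ) + 1)) ^ 2 := by
      rw [div_pow, div_pow, one_pow, mul_one_div]
      gcongr
    linarith

lemma exists_norm_rGamma_le (ρ : ℝ) : ∃ C : ℝ, 0 < C ∧ ∀ z : ℂ, ‖z‖ ≤ ρ → ‖rGamma z‖ ≤ C := by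
  obtain ⟨C, hC⟩ := (isCompact_closedBall (0 : ℂ) ρ).exists_bound_of_continuousOn
    differentiable_rGamma.continuous.continuousOn
  exact ⟨max C 1, by positivity, fun z hz => (hC z (by simpa using hz)).trans (le_max_left _ _)⟩

/-- The quotients of `k! / Γ(z + k)` are `(1 + (z - 1) / (k + 1))⁻¹`; for `Re z ≥ 1` no denominator
comes near zero. -/
lemma exists_norm_rGamma_add_le_of_one_le (ρ : ℝ) : ∃ C : ℝ, 0 < C ∧ ∀ z : ℂ, ‖z‖ ≤ ρ → 1 ≤ z.re →
    ∀ k : ℕ, ‖rGamma (z + k)‖ ≤ C * (((k : ℝ) + 1) ^ (1 - z.re) / k.factorial) := by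
  obtain ⟨D, hD, hDz⟩ := exists_norm_rGamma_le ρ
  refine ⟨D * Real.exp (2 * (3 / 2 * (ρ + 1) ^ 2 + (ρ + 1))), by positivity, fun z hz hz0 k => ?_⟩
  have hρ : 0 ≤ ρ := (norm_nonneg z).trans hz
  have hz1 : ‖z - 1‖ ≤ ρ + 1 := (norm_sub_le _ _).trans (by simpa using hz)
  have hre : |1 - z.re| ≤ ρ + 1 := by
    have h := (Complex.abs_re_le_norm (z - 1)).trans hz1
    rw [abs_sub_comm]
    simpa using h
  have h := le_mul_rpow_of_ratio_le (f := fun k => ‖rGamma (z + k)‖ * k.factorial) (x := 1 - z.re)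
    (M := 3 / 2 * (ρ + 1) ^ 2) (by positivity) (by positivity) (fun k => ?_) k
  · simp only [Nat.cast_zero, add_zero, Nat.factorial_zero, Nat.cast_one, mul_one] at h
    rw [← le_div_iff₀ (by positivity)] at h
    refine h.trans ?_
    rw [mul_div_assoc]
    gcongr
    exact hDz z hz
  · have hk : ((k : ℂ) + 1) ≠ 0 := Nat.cast_add_one_ne_zero k
    have e : z + k = (k + 1) * (1 + (z - 1) / (k + 1)) := by field_simp; ring
    have hn : ‖((k : ℂ) + 1)‖ = (k : ℝ) + 1 := by
      rw [← Nat.cast_succ, Complex.norm_natCast]; push_cast; rfl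
    have e3 : ((z - 1) / ((k : ℂ) + 1)).re = (z.re - 1) * (1 / ((k : ℝ) + 1)) := by
      have : (k : ℂ) + 1 = (((k : ℝ) + 1 : ℝ) : ℂ) := by push_cast; rfl
      rw [this, Complex.div_ofReal_re]; simp; ring
    have hw : 0 ≤ ((z - 1) / ((k : ℂ) + 1)).re := by
      rw [e3]; exact mul_nonneg (by linarith) (by positivity)
    have hne : 1 + (z - 1) / ((k : ℂ) + 1) ≠ 0 := by
      intro h0
      have := congrArg Complex.re h0
      rw [Complex.add_re, Complex.one_re, Complex.zero_re] at this
      linarith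
    have e4 : rGamma (z + (k + 1 : ℕ)) =
        rGamma (z + k) * ((k : ℂ) + 1)⁻¹ * (1 + (z - 1) / ((k : ℂ) + 1))⁻¹ := by
      have h1 : rGamma (z + k) = _ := rGamma_eq_mul (z + k)
      rw [h1, mul_assoc, ← mul_inv, ← e]
      have h2 : z + k ≠ 0 := by rw [e]; exact mul_ne_zero hk hne
      push_cast
      field_simp
      ring_nf
    rw [e4, norm_mul, norm_mul, norm_inv, hn, Nat.factorial_succ]
    push_cast
    have e5 : ‖rGamma (z + k)‖ * ((k : ℝ) + 1)⁻¹ * ‖(1 + (z - 1) / ((k : ℂ) + 1))⁻¹‖ *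
        (((k : ℝ) + 1) * k.factorial) =
        ‖rGamma (z + k)‖ * k.factorial * ‖(1 + (z - 1) / ((k : ℂ) + 1))⁻¹‖ := by field_simp
    rw [e5]
    gcongr
    refine (norm_inv_one_add_le_exp hw).trans ?_
    rw [← Real.exp_add, Real.exp_le_exp, norm_div, hn, e3]
    have h8 : (‖z - 1‖ / ((k : ℝ) + 1)) ^ 2 ≤ (ρ + 1) ^ 2 * (1 / ((k : ℝ) + 1)) ^ 2 := by
      rw [div_pow, div_pow, one_pow, mul_one_div]
      gcongr
    linarith

lemma norm_rising_le_pow (x : ℂ) (k : ℕ) : ‖rising x k‖ ≤ (‖x‖ + k) ^ k := by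
  induction k with
  | zero => simp
  | succ k ih =>
    rw [rising_succ, norm_mul, pow_succ]
    push_cast
    gcongr
    · refine ih.trans ?_
      gcongr
      linarith
    · refine (norm_add_le _ _).trans ?_
      rw [Complex.norm_natCast]
      linarith

/-- `1 / Γ(z + k) = O((k + 1) ^ (1 - Re z) / k!)`, uniformly on bounded sets. -/
lemma exists_norm_rGamma_add_le (ρ : ℝ) : ∃ C : ℝ, 0 < C ∧ ∀ z : ℂ, ‖z‖ ≤ ρ →
    ∀ k : ℕ, ‖rGamma (z + k)‖ ≤ C * (((k : ℝ) + 1) ^ (1 - z.re) / k.factorial) := by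
  -- The shift by `N` moves the whole disc of radius `ρ` into `Re ≥ 1`; the factor `(z + k)_N` that
  -- appears is `O((k + 1) ^ N)`, which restores the exponent.
  obtain ⟨N, hN⟩ := exists_nat_ge (ρ + 1)
  obtain ⟨C, hC, hCz⟩ := exists_norm_rGamma_add_le_of_one_le (ρ + N)
  refine ⟨(|ρ| + 1 + N) ^ N * C, by positivity, fun z hz k => ?_⟩
  have hρ : 0 ≤ ρ := (norm_nonneg z).trans hz
  rw [abs_of_nonneg hρ]
  have h1 : ‖z + N‖ ≤ ρ + N := (norm_add_le _ _).trans (by rw [Complex.norm_natCast]; linarith)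
  have h2 : 1 ≤ (z + N).re := by
    rw [Complex.add_re, Complex.natCast_re]
    linarith [(abs_le.1 (Complex.abs_re_le_norm z)).1]
  have h3 := hCz (z + N) h1 h2 k
  have hk : (0 : ℝ) < (k : ℝ) + 1 := by positivity
  have h4 : ‖rising (z + k) N‖ ≤ (ρ + 1 + N) ^ N * ((k : ℝ) + 1) ^ (N : ℝ) := by
    refine (norm_rising_le_pow _ _).trans ?_
    rw [Real.rpow_natCast, ← mul_pow]
    have h5 : ‖z + k‖ ≤ ρ + k := (norm_add_le _ _).trans (by rw [Complex.norm_natCast]; linarith)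
    have h6 : (0 : ℝ) ≤ ρ * k := by positivity
    have h7 : (0 : ℝ) ≤ (N : ℝ) * k := by positivity
    gcongr
    nlinarith
  rw [rGamma_eq_rising_mul (z + k) N, norm_mul, show z + k + N = z + N + k by ring]
  refine (mul_le_mul h4 h3 (norm_nonneg _) (by positivity)).trans (le_of_eq ?_)
  have e : ((k : ℝ) + 1) ^ (1 - z.re) = ((k : ℝ) + 1) ^ (N : ℝ) * ((k : ℝ) + 1) ^ (1 - (z + N).re) := by
    rw [← Real.rpow_add hk]; congr 1; simp; ring
  rw [e]; ring

lemma exists_norm_rising_div_factorial_le (u : ℂ) : ∃ C : ℝ, 0 < C ∧ ∀ k : ℕ,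
    ‖rising u k / k.factorial‖ ≤ C * ((k : ℝ) + 1) ^ (u.re - 1) := by
  obtain ⟨C, hC, h⟩ := exists_norm_rising_le ‖u‖
  refine ⟨C, hC, fun k => ?_⟩
  rw [norm_div, Complex.norm_natCast, div_le_iff₀ (by positivity)]
  refine (h u le_rfl k).trans (le_of_eq (by ring))

lemma exists_norm_rising_div_rising_le (b : ℂ) {d : ℂ} (hd : ∀ m : ℕ, d ≠ -(m : ℂ)) :
    ∃ C : ℝ, 0 < C ∧ ∀ k : ℕ, ‖rising b k / rising d k‖ ≤ C * ((k : ℝ) + 1) ^ (b - d).re := by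
  obtain ⟨C, hC, h⟩ := exists_norm_rising_le ‖b‖
  obtain ⟨D, hD, h'⟩ := exists_norm_rGamma_add_le ‖d‖
  have hG : 0 < ‖Complex.Gamma d‖ := norm_pos_iff.2 (Complex.Gamma_ne_zero hd)
  refine ⟨C * (‖Complex.Gamma d‖ * D), by positivity, fun k => ?_⟩
  have hk : (0 : ℝ) < (k : ℝ) + 1 := by positivity
  rw [div_eq_mul_inv, inv_rising_eq hd, norm_mul, norm_mul]
  calc _ ≤ C * (k.factorial * ((k : ℝ) + 1) ^ (b.re - 1)) *
        (‖Complex.Gamma d‖ * (D * (((k : ℝ) + 1) ^ (1 - d.re) / k.factorial))) := by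
        gcongr
        exacts [h b le_rfl k, h' d le_rfl k]
    _ = C * (‖Complex.Gamma d‖ * D) * (((k : ℝ) + 1) ^ (b.re - 1) * ((k : ℝ) + 1) ^ (1 - d.re)) := by
        field_simp
    _ = _ := by
        rw [← Real.rpow_add hk, Complex.sub_re]
        congr 2
        ring

lemma summable_nat_add_one_rpow {x : ℝ} (hx : x < -1) :
    Summable fun k : ℕ => ((k : ℝ) + 1) ^ x := by
  have h := (summable_nat_add_iff 1).2 (Real.summable_nat_rpow.2 hx)
  simpa using h

lemma tendsto_nat_add_one_rpow_neg {x : ℝ} (hx : x < 0) :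
    Tendsto (fun k : ℕ => ((k : ℝ) + 1) ^ x) atTop (𝓝 0) := by
  have h := (tendsto_rpow_neg_atTop (y := -x) (by linarith)).comp
    (tendsto_natCast_atTop_atTop.comp (tendsto_add_atTop_nat 1))
  simpa [Function.comp_def] using h

/-! ### Gauss's summation theorem. -/

/-- The `n`-th term of the regularized Gauss series `₂F₁(b, c; d; 1) / Γ(d)`. -/
noncomputable def gaussTerm (b c d : ℂ) (n : ℕ) : ℂ :=
  rising b n * rising c n / n.factorial * rGamma (d + n)

lemma exists_norm_gaussTerm_le (b c d : ℂ) : ∃ C : ℝ, 0 < C ∧ ∀ n : ℕ,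
    ‖gaussTerm b c d n‖ ≤ C * ((n : ℝ) + 1) ^ (-1 - (d - b - c).re) := by
  obtain ⟨B, hB, h1⟩ := exists_norm_rising_le ‖b‖
  obtain ⟨C, hC, h2⟩ := exists_norm_rising_le ‖c‖
  obtain ⟨D, hD, h3⟩ := exists_norm_rGamma_add_le ‖d‖
  refine ⟨B * C * D, by positivity, fun n => ?_⟩
  have hk : (0 : ℝ) < (n : ℝ) + 1 := by positivity
  rw [gaussTerm, norm_mul, norm_div, norm_mul, Complex.norm_natCast]
  calc _ ≤ B * (n.factorial * ((n : ℝ) + 1) ^ (b.re - 1)) *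
        (C * (n.factorial * ((n : ℝ) + 1) ^ (c.re - 1))) / n.factorial *
        (D * (((n : ℝ) + 1) ^ (1 - d.re) / n.factorial)) := by
        gcongr
        exacts [h1 b le_rfl n, h2 c le_rfl n, h3 d le_rfl n]
    _ = B * C * D * (((n : ℝ) + 1) ^ (b.re - 1) * ((n : ℝ) + 1) ^ (c.re - 1) *
          ((n : ℝ) + 1) ^ (1 - d.re)) := by
        field_simp
    _ = _ := by
        rw [← Real.rpow_add hk, ← Real.rpow_add hk]
        congr 2
        simp only [Complex.sub_re]
        ring

lemma summable_gaussTerm {b c d : ℂ} (h : 0 < (d - b - c).re) : Summable (gaussTerm b c d) := by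
  obtain ⟨C, -, hC⟩ := exists_norm_gaussTerm_le b c d
  exact Summable.of_norm_bounded ((summable_nat_add_one_rpow (by linarith)).mul_left C) hC

/-- The right-hand side telescopes in `n`, so it yields the relation between the sums for `d` and `d
+ 1`. -/
lemma gaussTerm_contiguous (b c d : ℂ) (n : ℕ) :
    (d - b - c) * gaussTerm b c d n - (d - b) * (d - c) * gaussTerm b c (d + 1) n =
      (n : ℂ) * gaussTerm b c d n - ((n + 1 : ℕ) : ℂ) * gaussTerm b c d (n + 1) := by
  have h : rGamma (d + n) = (d + n) * rGamma (d + 1 + n) := by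
    rw [rGamma_eq_mul (d + n)]; ring_nf
  have h' : rGamma (d + (n + 1 : ℕ)) = rGamma (d + 1 + n) := by push_cast; ring_nf
  have hk : ((n : ℂ) + 1) ≠ 0 := Nat.cast_add_one_ne_zero n
  have hf : (n.factorial : ℂ) ≠ 0 := by exact_mod_cast n.factorial_ne_zero
  simp only [gaussTerm, h', h, rising_succ, Nat.factorial_succ]
  push_cast
  field_simp
  ring

lemma tsum_gaussTerm_contiguous {b c d : ℂ} (h : 0 < (d - b - c).re) :
    (d - b - c) * ∑' n, gaussTerm b c d n = (d - b) * (d - c) * ∑' n, gaussTerm b c (d + 1) n := by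
  have h1 := summable_gaussTerm h
  have h' : 0 < (d + 1 - b - c).re := by
    simp only [Complex.sub_re, Complex.add_re, Complex.one_re] at h ⊢; linarith
  have h2 := summable_gaussTerm h'
  obtain ⟨C, hC0, hC⟩ := exists_norm_gaussTerm_le b c d
  have hlim : Tendsto (fun n : ℕ => (n : ℂ) * gaussTerm b c d n) atTop (𝓝 0) := by
    refine squeeze_zero_norm (a := fun n : ℕ => C * ((n : ℝ) + 1) ^ (-(d - b - c).re)) (fun n => ?_) ?_
    · rw [norm_mul, Complex.norm_natCast]
      have hk : (0 : ℝ) < (n : ℝ) + 1 := by positivity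
      calc (n : ℝ) * ‖gaussTerm b c d n‖
          ≤ ((n : ℝ) + 1) * (C * ((n : ℝ) + 1) ^ (-1 - (d - b - c).re)) := by
            gcongr
            · linarith
            · exact hC n
        _ = C * (((n : ℝ) + 1) ^ (1 : ℝ) * ((n : ℝ) + 1) ^ (-1 - (d - b - c).re)) := by
            rw [Real.rpow_one]; ring
        _ = _ := by rw [← Real.rpow_add hk]; ring_nf
    · simpa using (tendsto_nat_add_one_rpow_neg (x := -(d - b - c).re) (by linarith)).const_mul C
  have h3 : HasSum (fun n => (d - b - c) * gaussTerm b c d n -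
      (d - b) * (d - c) * gaussTerm b c (d + 1) n) _ :=
    (h1.hasSum.mul_left (d - b - c)).sub (h2.hasSum.mul_left ((d - b) * (d - c)))
  have h4 := h3.tendsto_sum_nat
  have h5 : ∀ N : ℕ, ∑ n ∈ Finset.range N, ((d - b - c) * gaussTerm b c d n -
      (d - b) * (d - c) * gaussTerm b c (d + 1) n) = -((N : ℂ) * gaussTerm b c d N) := by
    intro N
    simp only [gaussTerm_contiguous]
    rw [Finset.sum_range_sub' (fun n : ℕ => (n : ℂ) * gaussTerm b c d n)]
    simp
  simp only [h5] at h4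
  have h6 := tendsto_nhds_unique h4 hlim.neg
  rw [neg_zero] at h6
  exact sub_eq_zero.1 h6

/-- This is Euler's limit for `Γ`, inverted. At a pole of `Γ` the rising factorials are eventually
zero, in agreement with `1 / Γ`. -/
lemma tendsto_rising_div_rGamma (x : ℂ) :
    Tendsto (fun n : ℕ => rising x (n + 1) / ((n : ℂ) ^ x * n.factorial)) atTop (𝓝 (rGamma x)) := by
  have hseq : ∀ n : ℕ, rising x (n + 1) / ((n : ℂ) ^ x * n.factorial) = (Complex.GammaSeq x n)⁻¹ := by
    intro n
    rw [Complex.GammaSeq, inv_div]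
    congr 1
    exact rising_eq_prod x (n + 1)
  simp only [hseq]
  by_cases hx : ∀ m : ℕ, x ≠ -(m : ℂ)
  · exact (Complex.GammaSeq_tendsto_Gamma x).inv₀ (Complex.Gamma_ne_zero hx)
  · push Not at hx
    obtain ⟨m, rfl⟩ := hx
    rw [rGamma, Complex.Gamma_neg_nat_eq_zero, inv_zero]
    refine tendsto_const_nhds.congr' ?_
    filter_upwards [eventually_ge_atTop m] with n hn
    rw [← hseq]
    have : rising (-(m : ℂ)) (n + 1) = 0 := by
      rw [rising]; exact ascPochhammer_eval_neg_coe_nat_of_lt (by omega)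
    simp [this]

/-- By `d + e = b + c` the powers of `n` in Euler's limit cancel between numerator and denominator.
-/
lemma tendsto_rising_mul_div {b c d e : ℂ} (h : d + e = b + c) (hd : 0 < d.re) (he : 0 < e.re) :
    Tendsto (fun n : ℕ => rising b n * rising c n / (rising d n * rising e n)) atTop
      (𝓝 (rGamma b * rGamma c / (rGamma d * rGamma e))) := by
  rw [← tendsto_add_atTop_iff_nat 1]
  have hd' := rGamma_ne_zero (ne_neg_nat_of_re_pos hd)
  have he' := rGamma_ne_zero (ne_neg_nat_of_re_pos he)
  refine (((tendsto_rising_div_rGamma b).mul (tendsto_rising_div_rGamma c)).div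
    ((tendsto_rising_div_rGamma d).mul (tendsto_rising_div_rGamma e))
    (mul_ne_zero hd' he')).congr' ?_
  filter_upwards [eventually_gt_atTop 0] with n hn
  have hn0 : (n : ℂ) ≠ 0 := by exact_mod_cast hn.ne'
  have hf : (n.factorial : ℂ) ≠ 0 := by exact_mod_cast n.factorial_ne_zero
  have key : (n : ℂ) ^ d * (n : ℂ) ^ e = (n : ℂ) ^ b * (n : ℂ) ^ c := by
    rw [← Complex.cpow_add _ _ hn0, ← Complex.cpow_add _ _ hn0, h]
  have h1 := rising_ne_zero (ne_neg_nat_of_re_pos hd) (n + 1)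
  have h2 := rising_ne_zero (ne_neg_nat_of_re_pos he) (n + 1)
  have p1 : (n : ℂ) ^ b ≠ 0 := by simp [Complex.cpow_eq_zero_iff, hn0]
  have p2 : (n : ℂ) ^ c ≠ 0 := by simp [Complex.cpow_eq_zero_iff, hn0]
  have p3 : (n : ℂ) ^ d ≠ 0 := by simp [Complex.cpow_eq_zero_iff, hn0]
  have p4 : (n : ℂ) ^ e ≠ 0 := by simp [Complex.cpow_eq_zero_iff, hn0]
  have e1 : ∀ x y : ℂ, rising x (n + 1) / ((n : ℂ) ^ x * n.factorial) *
      (rising y (n + 1) / ((n : ℂ) ^ y * n.factorial)) =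
      rising x (n + 1) * rising y (n + 1) / ((n : ℂ) ^ x * (n : ℂ) ^ y * n.factorial ^ 2) := by
    intro x y
    rw [div_mul_div_comm]; ring_nf
  simp only [Pi.div_apply]
  rw [e1, e1, key]
  field_simp

/-- Provides a majorant independent of `m` for the series with denominator parameter `d + m`. -/
lemma norm_rising_le_norm_rising_add {d : ℂ} (hd : 0 < d.re) (m n : ℕ) :
    ‖rising d n‖ ≤ ‖rising (d + m) n‖ := by
  induction n with
  | zero => simp
  | succ n ih =>
    rw [rising_succ, rising_succ, norm_mul, norm_mul]
    gcongr
    rw [← sq_le_sq₀ (norm_nonneg _) (norm_nonneg _), ← Complex.normSq_eq_norm_sq,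
      ← Complex.normSq_eq_norm_sq, Complex.normSq_apply, Complex.normSq_apply]
    simp only [Complex.add_re, Complex.natCast_re, Complex.add_im, Complex.natCast_im, add_zero]
    have : (0 : ℝ) ≤ m := by positivity
    have : (0 : ℝ) ≤ n := by positivity
    nlinarith

/-- `₂F₁(b, c; d + m; 1) → 1` as `m → ∞`. -/
lemma tendsto_tsum_gauss_add {b c d : ℂ} (hd : 0 < d.re) (h : 0 < (d - b - c).re) :
    Tendsto (fun m : ℕ => ∑' n : ℕ, rising b n * rising c n / (n.factorial * rising (d + m) n))
      atTop (𝓝 1) := by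
  have hdn := ne_neg_nat_of_re_pos hd
  have hs : Summable fun n : ℕ => ‖rising b n * rising c n / (n.factorial * rising d n)‖ := by
    refine ((summable_gaussTerm h).mul_left (Complex.Gamma d)).norm.congr fun n => ?_
    rw [gaussTerm, ← div_div, div_eq_mul_inv (_ / _), inv_rising_eq hdn]
    congr 1; ring
  have h1 : (1 : ℂ) = ∑' n : ℕ, if n = 0 then 1 else 0 := by rw [tsum_ite_eq]
  rw [h1]
  refine tendsto_tsum_of_dominated_convergence hs (fun n => ?_) (Eventually.of_forall fun m n => ?_)
  · rcases n with _ | n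
    · simp
    · simp only [Nat.add_eq_zero_iff, one_ne_zero, and_false, if_false]
      rw [tendsto_zero_iff_norm_tendsto_zero]
      have hpos : 0 < ‖rising (d + 1) n‖ := by
        rw [norm_pos_iff]; exact rising_ne_zero (ne_neg_nat_of_re_pos (by simp; linarith)) n
      refine squeeze_zero' (g := fun m : ℕ => ‖rising b (n + 1) * rising c (n + 1)‖ /
        ((n + 1).factorial * ‖rising (d + 1) n‖) * ((m : ℝ)⁻¹))
        (Eventually.of_forall fun m => norm_nonneg _) ?_ ?_
      · filter_upwards [eventually_gt_atTop 0] with m hm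
        have hm' : (0 : ℝ) < m := by exact_mod_cast hm
        rw [← div_eq_mul_inv, div_div, norm_div, norm_mul (((n + 1).factorial : ℕ) : ℂ),
          Complex.norm_natCast, rising_succ_left (d + m), norm_mul (d + m), mul_assoc,
          mul_comm _ (m : ℝ)]
        have h2 : (m : ℝ) ≤ ‖d + m‖ := by
          refine le_trans ?_ (Complex.re_le_norm _)
          simp [hd.le]
        have h3 := norm_rising_le_norm_rising_add (d := d + 1) (by simp; linarith) m n
        rw [show d + 1 + m = d + m + 1 by ring] at h3
        gcongr
      · simpa using tendsto_inv_atTop_nhds_zero_nat.const_mul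
          (‖rising b (n + 1) * rising c (n + 1)‖ / ((n + 1).factorial * ‖rising (d + 1) n‖) : ℝ)
  · rw [norm_div, norm_div, norm_mul (n.factorial : ℂ), norm_mul (n.factorial : ℂ)]
    have hpos : 0 < ‖rising d n‖ := norm_pos_iff.2 (rising_ne_zero hdn n)
    have hpos' : 0 < ‖(n.factorial : ℂ)‖ := by rw [Complex.norm_natCast]; positivity
    gcongr
    exact norm_rising_le_norm_rising_add hd m n

/-- Gauss's summation theorem, for a denominator parameter with positive real part. -/
lemma tsum_gaussTerm_of_re_pos {b c d : ℂ} (hd : 0 < d.re) (h : 0 < (d - b - c).re) :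
    ∑' n, gaussTerm b c d n = Complex.Gamma (d - b - c) * rGamma (d - b) * rGamma (d - c) := by
  have hdn := ne_neg_nat_of_re_pos hd
  have hen := ne_neg_nat_of_re_pos h
  have hre : ∀ m : ℕ, 0 < (d + m - b - c).re := by
    intro m
    rw [show d + m - b - c = d - b - c + m by ring, Complex.add_re, Complex.natCast_re]
    positivity
  have hstep : ∀ m : ℕ, rising (d - b - c) m * ∑' n, gaussTerm b c d n =
      rising (d - b) m * rising (d - c) m * ∑' n, gaussTerm b c (d + m) n := by
    intro m
    induction m with
    | zero => simp
    | succ m ih =>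
      have h2 := tsum_gaussTerm_contiguous (hre m)
      simp only [rising_succ]
      rw [show d + ((m + 1 : ℕ) : ℂ) = d + m + 1 by push_cast; ring]
      linear_combination (d - b - c + m) * ih + rising (d - b) m * rising (d - c) m * h2
  -- The contiguous relation iterated `m` times, written with a left-hand side that does not depend
  -- on `m` after all; its limit as `m → ∞` is the value sought.
  have hval : ∀ m : ℕ, rising (d - b) m * rising (d - c) m /
      (rising d m * rising (d - b - c) m) * (rGamma d *
        ∑' n : ℕ, rising b n * rising c n / (n.factorial * rising (d + m) n)) =
      ∑' n, gaussTerm b c d n := by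
    intro m
    have hdm : ∀ j : ℕ, d + m ≠ -(j : ℂ) :=
      ne_neg_nat_of_re_pos (by rw [Complex.add_re, Complex.natCast_re]; positivity)
    have e : ∑' n, gaussTerm b c (d + m) n = rGamma (d + m) *
        ∑' n : ℕ, rising b n * rising c n / (n.factorial * rising (d + m) n) := by
      rw [← tsum_mul_left]
      refine tsum_congr fun n => ?_
      have h1 := rising_ne_zero hdm n
      rw [gaussTerm, rGamma_eq_rising_mul (d + m) n]
      field_simp
    have h1 := hstep m
    rw [e] at h1
    have h2 := rising_ne_zero hdn m
    have h3 := rising_ne_zero hen m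
    rw [rGamma_eq_rising_mul d m]
    field_simp
    linear_combination -h1
  have hl := (tendsto_rising_mul_div (b := d - b) (c := d - c) (d := d) (e := d - b - c) (by ring) hd h).mul
    ((tendsto_tsum_gauss_add hd h).const_mul (rGamma d))
  simp only [hval] at hl
  rw [tendsto_nhds_unique tendsto_const_nhds hl]
  have h4 := rGamma_ne_zero hdn
  have h5 : Complex.Gamma (d - b - c) ≠ 0 := Complex.Gamma_ne_zero hen
  rw [show rGamma (d - b - c) = (Complex.Gamma (d - b - c))⁻¹ from rfl]
  field_simp

/-- Gauss's summation theorem. -/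
theorem tsum_gaussTerm {b c d : ℂ} (h : 0 < (d - b - c).re) :
    ∑' n, gaussTerm b c d n = Complex.Gamma (d - b - c) * rGamma (d - b) * rGamma (d - c) := by
  -- The contiguous relation reduces `d` to `d + 1`. The regularization by `1 / Γ(d)` makes this
  -- possible also when `d` is a non-positive integer.
  obtain ⟨N, hN⟩ := exists_nat_gt (-d.re)
  induction N generalizing d with
  | zero => exact tsum_gaussTerm_of_re_pos (by simpa using hN) h
  | succ N ih =>
    have h' : 0 < (d + 1 - b - c).re := by
      simp only [Complex.sub_re, Complex.add_re, Complex.one_re] at h ⊢; linarith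
    have h0 : d - b - c ≠ 0 := by intro h0; rw [h0] at h; simp at h
    have h1 := tsum_gaussTerm_contiguous h
    rw [ih h' (by push_cast at hN; simp only [Complex.add_re, Complex.one_re]; linarith)] at h1
    rw [rGamma_eq_mul (d - b), rGamma_eq_mul (d - c)]
    refine mul_left_cancel₀ h0 (h1.trans ?_)
    rw [show d + 1 - b - c = d - b - c + 1 by ring, Complex.Gamma_add_one _ h0]
    ring_nf

/-! ### Terminating summations. -/

/-- The Pfaff–Saalschütz summation in polynomial form. -/
lemma sum_choose_mul_rising_saalschutz (N : ℕ) (b c d : ℂ) :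
    ∑ i ∈ Finset.range (N + 1), (N.choose i : ℂ) * (rising b i * rising c i *
      rising (d - b - c) (N - i) * rising (d + i) (N - i)) = rising (d - b) N * rising (d - c) N := by
  induction N generalizing b d with
  | zero => simp
  | succ N ih =>
    -- After Pascal's rule the summands recombine into those for the parameters `(b, d + 1)` and `(b
    -- + 1, d + 1)`, to which the induction hypothesis applies.
    rw [Finset.sum_choose_succ_mul (fun i j => rising b i * rising c i *
      rising (d - b - c) j * rising (d + i) j), ← Finset.sum_add_distrib]
    have h1 := ih b (d + 1)
    have h2 := ih (b + 1) (d + 1)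
    rw [show d + 1 - (b + 1) = d - b by ring] at h2
    have key : ∀ i ∈ Finset.range (N + 1),
        (N.choose i : ℂ) * (rising b i * rising c i * rising (d - b - c) (N + 1 - i) *
          rising (d + i) (N + 1 - i)) +
        (N.choose i : ℂ) * (rising b (i + 1) * rising c (i + 1) * rising (d - b - c) (N - i) *
          rising (d + (i + 1 : ℕ)) (N - i)) =
        (d - b - c) * (d - b) * ((N.choose i : ℂ) * (rising b i * rising c i *
          rising (d + 1 - b - c) (N - i) * rising (d + 1 + i) (N - i))) +
        b * (d - b + N) * ((N.choose i : ℂ) * (rising (b + 1) i * rising c i *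
          rising (d - b - c) (N - i) * rising (d + 1 + i) (N - i))) := by
      intro i hi
      have hi' : i ≤ N := by simpa [Nat.lt_succ_iff] using hi
      obtain ⟨q, rfl⟩ := Nat.exists_eq_add_of_le hi'
      rw [show i + q + 1 - i = q + 1 by omega, show i + q - i = q by omega,
        rising_succ_left (d + i), rising_succ_left (d - b - c), rising_succ c, rising_succ b,
        show d + ((i + 1 : ℕ) : ℂ) = d + 1 + i by push_cast; ring,
        show d + i + 1 = d + 1 + i by ring, show d - b - c + 1 = d + 1 - b - c by ring]
      have e1 := rising_mul_add b i
      have e2 := rising_mul_add (d - b - c) q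
      rw [show d - b - c + 1 = d + 1 - b - c by ring] at e2
      push_cast
      linear_combination (((i + q).choose i : ℂ) * rising c i * rising (d + 1 + i) q) *
        ((d - b - c) * rising (d + 1 - b - c) q + rising (d - b - c) q * (c + i)) * e1 -
        (((i + q).choose i : ℂ) * rising c i * rising (d + 1 + i) q) * b * rising (b + 1) i * e2
    rw [Finset.sum_congr rfl key, Finset.sum_add_distrib, ← Finset.mul_sum, ← Finset.mul_sum, h1, h2,
      rising_succ_left (d - c), rising_succ (d - b), show d + 1 - b = d - b + 1 by ring,
      show d + 1 - c = d - c + 1 by ring]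
    have e3 := rising_mul_add (d - b) N
    linear_combination -(d - b - c) * rising (d - c + 1) N * e3

/-- The Chu–Vandermonde summation in polynomial form. -/
lemma sum_choose_mul_rising_vandermonde (N : ℕ) (b d : ℂ) :
    ∑ i ∈ Finset.range (N + 1), (N.choose i : ℂ) * ((-1) ^ i * rising b i * rising (d + i) (N - i)) =
      rising (d - b) N := by
  induction N generalizing d with
  | zero => simp
  | succ N ih =>
    rw [Finset.sum_choose_succ_mul (fun i j => (-1) ^ i * rising b i * rising (d + i) j),
      ← Finset.sum_add_distrib]
    have key : ∀ i ∈ Finset.range (N + 1),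
        (N.choose i : ℂ) * ((-1) ^ i * rising b i * rising (d + i) (N + 1 - i)) +
        (N.choose i : ℂ) * ((-1) ^ (i + 1) * rising b (i + 1) * rising (d + (i + 1 : ℕ)) (N - i)) =
        (d - b) * ((N.choose i : ℂ) * ((-1) ^ i * rising b i * rising (d + 1 + i) (N - i))) := by
      intro i hi
      have hi' : i ≤ N := by simpa [Nat.lt_succ_iff] using hi
      obtain ⟨q, rfl⟩ := Nat.exists_eq_add_of_le hi'
      rw [show i + q + 1 - i = q + 1 by omega, show i + q - i = q by omega,
        rising_succ_left (d + i), rising_succ b,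
        show d + ((i + 1 : ℕ) : ℂ) = d + 1 + i by push_cast; ring,
        show d + i + 1 = d + 1 + i by ring]
      ring
    rw [Finset.sum_congr rfl key, ← Finset.mul_sum, ih, rising_succ_left,
      show d + 1 - b = d - b + 1 by ring]

/-! ### Bailey pairs and Bailey's lemma. -/

/-- The kernel `1 / ((n - r)! Γ(1 + a + n + r))` relating the two members of a Bailey pair. -/
noncomputable def baileyKernel (a : ℂ) (n r : ℕ) : ℂ :=
  rGamma (1 + a + n + r) / (n - r).factorial

/-- `(α, β)` is a Bailey pair relative to `a` (in the limit `q → 1`). -/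
def IsBaileyPair (a : ℂ) (α β : ℕ → ℂ) : Prop :=
  ∀ n, β n = ∑ r ∈ Finset.range (n + 1), α r * baileyKernel a n r

/-- Interchanging the two summations reduces every transformation of a Bailey pair to a sum over the
kernel alone. -/
lemma IsBaileyPair.sum_mul {a : ℂ} {α β : ℕ → ℂ} (h : IsBaileyPair a α β) (n : ℕ) (κ : ℕ → ℂ) :
    ∑ j ∈ Finset.range (n + 1), κ j * β j = ∑ r ∈ Finset.range (n + 1),
      α r * ∑ i ∈ Finset.range (n - r + 1), κ (r + i) * baileyKernel a (r + i) r := by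
  simp only [h _, Finset.mul_sum]
  rw [Finset.sum_comm' (t' := Finset.range (n + 1)) (s' := fun r => Finset.Ico r (n + 1))
    (by intro x y; simp only [Finset.mem_range, Finset.mem_Ico]; omega)]
  refine Finset.sum_congr rfl fun r hr => ?_
  have hr' : r < n + 1 := by simpa using hr
  rw [Finset.sum_Ico_eq_sum_range, show n + 1 - r = n - r + 1 by omega]
  refine Finset.sum_congr rfl fun i _ => by ring

/-- Pfaff–Saalschütz with parameters `ρ₁ + r`, `ρ₂ + r` and `1 + a + 2r`. -/
lemma sum_rising_mul_baileyKernel (a ρ₁ ρ₂ : ℂ) (r N : ℕ) :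
    ∑ i ∈ Finset.range (N + 1), rising ρ₁ (r + i) * rising ρ₂ (r + i) *
      (rising (1 + a - ρ₁ - ρ₂) (N - i) / (N - i).factorial) * baileyKernel a (r + i) r =
    rising ρ₁ r * rising ρ₂ r * (rising (1 + a - ρ₁ + r) N * rising (1 + a - ρ₂ + r) N) *
      baileyKernel a (r + N) r := by
  have h := sum_choose_mul_rising_saalschutz N (ρ₁ + r) (ρ₂ + r) (1 + a + r + r)
  rw [show 1 + a + r + r - (ρ₁ + r) - (ρ₂ + r) = 1 + a - ρ₁ - ρ₂ by ring,
    show 1 + a + r + r - (ρ₁ + r) = 1 + a - ρ₁ + r by ring,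
    show 1 + a + r + r - (ρ₂ + r) = 1 + a - ρ₂ + r by ring] at h
  rw [← h, Finset.mul_sum, Finset.sum_mul]
  refine Finset.sum_congr rfl fun i hi => ?_
  have hi' : i ≤ N := by simpa [Nat.lt_succ_iff] using hi
  rw [baileyKernel, baileyKernel, show r + i - r = i by omega, show r + N - r = N by omega,
    rGamma_eq_rising_mul (1 + a + (r + i : ℕ) + r) (N - i), Nat.cast_choose ℂ hi', rising_add ρ₁,
    rising_add ρ₂]
  have f1 : (i.factorial : ℂ) ≠ 0 := by exact_mod_cast i.factorial_ne_zero
  have f2 : ((N - i).factorial : ℂ) ≠ 0 := by exact_mod_cast (N - i).factorial_ne_zero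
  have f3 : (N.factorial : ℂ) ≠ 0 := by exact_mod_cast N.factorial_ne_zero
  have e : 1 + a + ((r + i : ℕ) : ℂ) + r + ((N - i : ℕ) : ℂ) = 1 + a + ((r + N : ℕ) : ℂ) + r := by
    push_cast [hi']; ring
  have e' : 1 + a + ((r + i : ℕ) : ℂ) + r = 1 + a + r + r + i := by push_cast; ring
  rw [e, e']
  field_simp

/-- Chu–Vandermonde with parameters `ρ + r` and `1 + a + 2r`. -/
lemma sum_neg_one_pow_mul_baileyKernel (a ρ : ℂ) (r N : ℕ) :
    ∑ i ∈ Finset.range (N + 1), (-1) ^ (r + i) * rising ρ (r + i) / (N - i).factorial *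
      baileyKernel a (r + i) r =
    (-1) ^ r * rising ρ r * rising (1 + a - ρ + r) N * baileyKernel a (r + N) r := by
  have h := sum_choose_mul_rising_vandermonde N (ρ + r) (1 + a + r + r)
  rw [show 1 + a + r + r - (ρ + r) = 1 + a - ρ + r by ring] at h
  rw [← h, Finset.mul_sum, Finset.sum_mul]
  refine Finset.sum_congr rfl fun i hi => ?_
  have hi' : i ≤ N := by simpa [Nat.lt_succ_iff] using hi
  rw [baileyKernel, baileyKernel, show r + i - r = i by omega, show r + N - r = N by omega,
    rGamma_eq_rising_mul (1 + a + (r + i : ℕ) + r) (N - i), Nat.cast_choose ℂ hi', rising_add ρ]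
  have f1 : (i.factorial : ℂ) ≠ 0 := by exact_mod_cast i.factorial_ne_zero
  have f2 : ((N - i).factorial : ℂ) ≠ 0 := by exact_mod_cast (N - i).factorial_ne_zero
  have f3 : (N.factorial : ℂ) ≠ 0 := by exact_mod_cast N.factorial_ne_zero
  have e : 1 + a + ((r + i : ℕ) : ℂ) + r + ((N - i : ℕ) : ℂ) = 1 + a + ((r + N : ℕ) : ℂ) + r := by
    push_cast [hi']; ring
  have e' : 1 + a + ((r + i : ℕ) : ℂ) + r = 1 + a + r + r + i := by push_cast; ring
  rw [e, e']
  field_simp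
  ring

/-- **Bailey's lemma** for `q → 1`. -/
theorem IsBaileyPair.bailey_lemma {a ρ₁ ρ₂ : ℂ} {α β : ℕ → ℂ} (h : IsBaileyPair a α β)
    (h₁ : ∀ m : ℕ, 1 + a - ρ₁ ≠ -(m : ℂ)) (h₂ : ∀ m : ℕ, 1 + a - ρ₂ ≠ -(m : ℂ)) :
    IsBaileyPair a
      (fun r => rising ρ₁ r * rising ρ₂ r / (rising (1 + a - ρ₁) r * rising (1 + a - ρ₂) r) * α r)
      (fun n => (∑ p ∈ Finset.HasAntidiagonal.antidiagonal n, rising ρ₁ p.1 * rising ρ₂ p.1 * β p.1 *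
        (rising (1 + a - ρ₁ - ρ₂) p.2 / p.2.factorial)) /
        (rising (1 + a - ρ₁) n * rising (1 + a - ρ₂) n)) := by
  intro n
  have e : ∑ p ∈ Finset.HasAntidiagonal.antidiagonal n, rising ρ₁ p.1 * rising ρ₂ p.1 * β p.1 *
        (rising (1 + a - ρ₁ - ρ₂) p.2 / p.2.factorial) =
      ∑ j ∈ Finset.range (n + 1), (rising ρ₁ j * rising ρ₂ j *
        (rising (1 + a - ρ₁ - ρ₂) (n - j) / (n - j).factorial)) * β j := by
    rw [Finset.Nat.sum_antidiagonal_eq_sum_range_succ_mk]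
    exact Finset.sum_congr rfl fun j _ => by ring
  simp only []
  rw [e, h.sum_mul, Finset.sum_div]
  refine Finset.sum_congr rfl fun r hr => ?_
  have hr' : r ≤ n := by simpa [Nat.lt_succ_iff] using hr
  obtain ⟨N, rfl⟩ := Nat.exists_eq_add_of_le hr'
  have e2 : ∑ i ∈ Finset.range (r + N - r + 1), rising ρ₁ (r + i) * rising ρ₂ (r + i) *
      (rising (1 + a - ρ₁ - ρ₂) (r + N - (r + i)) / (r + N - (r + i)).factorial) *
        baileyKernel a (r + i) r =
      rising ρ₁ r * rising ρ₂ r * (rising (1 + a - ρ₁ + r) N * rising (1 + a - ρ₂ + r) N) *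
      baileyKernel a (r + N) r := by
    rw [← sum_rising_mul_baileyKernel a ρ₁ ρ₂ r N, show r + N - r = N by omega]
    exact Finset.sum_congr rfl fun i _ => by rw [Nat.add_sub_add_left]
  rw [e2, rising_add (1 + a - ρ₁), rising_add (1 + a - ρ₂)]
  have k1 := rising_ne_zero h₁ (r + N)
  have k2 := rising_ne_zero h₂ (r + N)
  rw [rising_add] at k1 k2
  have k3 := left_ne_zero_of_mul k1
  have k4 := right_ne_zero_of_mul k1
  have k5 := left_ne_zero_of_mul k2
  have k6 := right_ne_zero_of_mul k2
  field_simp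

/-- The limiting case `ρ₂ → ∞` of Bailey's lemma. -/
theorem IsBaileyPair.bailey_lemma_limit {a ρ : ℂ} {α β : ℕ → ℂ} (h : IsBaileyPair a α β)
    (h₁ : ∀ m : ℕ, 1 + a - ρ ≠ -(m : ℂ)) :
    IsBaileyPair a (fun r => (-1) ^ r * rising ρ r / rising (1 + a - ρ) r * α r)
      (fun n => (∑ j ∈ Finset.range (n + 1), (-1) ^ j * rising ρ j / (n - j).factorial * β j) /
        rising (1 + a - ρ) n) := by
  intro n
  simp only []
  rw [h.sum_mul, Finset.sum_div]
  refine Finset.sum_congr rfl fun r hr => ?_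
  have hr' : r ≤ n := by simpa [Nat.lt_succ_iff] using hr
  obtain ⟨N, rfl⟩ := Nat.exists_eq_add_of_le hr'
  have e2 : ∑ i ∈ Finset.range (r + N - r + 1), (-1) ^ (r + i) * rising ρ (r + i) /
      (r + N - (r + i)).factorial * baileyKernel a (r + i) r =
      (-1) ^ r * rising ρ r * rising (1 + a - ρ + r) N * baileyKernel a (r + N) r := by
    rw [← sum_neg_one_pow_mul_baileyKernel a ρ r N, show r + N - r = N by omega]
    exact Finset.sum_congr rfl fun i _ => by rw [Nat.add_sub_add_left]
  rw [e2, rising_add (1 + a - ρ)]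
  have k1 := rising_ne_zero h₁ (r + N)
  rw [rising_add] at k1
  have k3 := left_ne_zero_of_mul k1
  have k4 := right_ne_zero_of_mul k1
  field_simp

/-! ### The unit Bailey pair and the initial pair of the odd case. -/

/-- The very-well-poised factor `(a)_r (a/2 + 1)_r / (r! (a/2)_r)`. -/
noncomputable def wellPoised (a : ℂ) (r : ℕ) : ℂ :=
  rising a r * (a + 2 * r) / (a * r.factorial)

lemma wellPoised_succ {a : ℂ} (ha : a ≠ 0) (r : ℕ) :
    wellPoised a (r + 1) = rising (1 + a) r * (a + 2 * (r + 1)) / (r + 1).factorial := by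
  rw [wellPoised, rising_succ_left, add_comm a 1]
  push_cast
  field_simp

/-- The alternating very-well-poised sum is summable in closed form at every upper limit `m`, which
permits induction on `m`. The factor `n - m` makes the complete sum vanish. -/
lemma sum_wellPoised_mul_baileyKernel {a : ℂ} (ha : a ≠ 0) (n m : ℕ) (hm : m ≤ n) (hn : n ≠ 0) :
    ∑ r ∈ Finset.range (m + 1), (-1) ^ r * wellPoised a r * baileyKernel a n r =
      (-1) ^ m * rising (1 + a) m * (n - m) / (m.factorial * n) * baileyKernel a n m := by
  have hn' : (n : ℂ) ≠ 0 := by exact_mod_cast hn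
  induction m with
  | zero => simp [wellPoised, ha, hn']
  | succ m ih =>
    rw [Finset.sum_range_succ, ih (by omega), wellPoised_succ ha]
    obtain ⟨q, rfl⟩ := Nat.exists_eq_add_of_le hm
    rw [baileyKernel, baileyKernel, show m + 1 + q - m = q + 1 by omega,
      show m + 1 + q - (m + 1) = q by omega, rGamma_eq_mul (1 + a + (m + 1 + q : ℕ) + m),
      rising_succ, Nat.factorial_succ, Nat.factorial_succ]
    have f1 : (m.factorial : ℂ) ≠ 0 := by exact_mod_cast m.factorial_ne_zero
    have f2 : (q.factorial : ℂ) ≠ 0 := by exact_mod_cast q.factorial_ne_zero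
    have f3 := Nat.cast_add_one_ne_zero (R := ℂ) m
    have f4 := Nat.cast_add_one_ne_zero (R := ℂ) q
    rw [show 1 + a + ((m + 1 + q : ℕ) : ℂ) + ((m + 1 : ℕ) : ℂ) = 1 + a + ((m + 1 + q : ℕ) : ℂ) + m + 1 by
      push_cast; ring]
    generalize rGamma (1 + a + ((m + 1 + q : ℕ) : ℂ) + m + 1) = G
    push_cast at hn' ⊢
    field_simp
    ring

/-- The unit Bailey pair. -/
theorem isBaileyPair_unit {a : ℂ} (ha : a ≠ 0) :
    IsBaileyPair a (fun r => (-1) ^ r * wellPoised a r)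
      (fun n => if n = 0 then rGamma (1 + a) else 0) := by
  intro n
  rcases eq_or_ne n 0 with rfl | hn
  · simp [wellPoised, baileyKernel, ha]
  · simp only [hn, if_false]
    rw [sum_wellPoised_mul_baileyKernel ha n n le_rfl hn]
    simp

/-- One limiting step of Bailey's lemma applied to the unit pair: only the term `j = 0` survives in
`β`, and the two signs in `α` cancel. -/
theorem isBaileyPair_wellPoised {a c : ℂ} (ha : a ≠ 0) (hc : ∀ m : ℕ, 1 + a - c ≠ -(m : ℂ)) :
    IsBaileyPair a (fun r => rising c r / rising (1 + a - c) r * wellPoised a r)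
      (fun n => rGamma (1 + a) / (n.factorial * rising (1 + a - c) n)) := by
  have h := (isBaileyPair_unit ha).bailey_lemma_limit hc
  intro n
  have hn := h n
  simp only [] at hn ⊢
  rw [Finset.sum_eq_single 0 (by intro j _ hj; simp [hj]) (by simp)] at hn
  simp only [pow_zero, rising_zero, if_true, one_mul, Nat.sub_zero] at hn
  rw [show rGamma (1 + a) / (n.factorial * rising (1 + a - c) n) =
    1 / (n.factorial : ℂ) * rGamma (1 + a) / rising (1 + a - c) n by
      rw [mul_comm (1 / _), mul_one_div, div_div], hn]
  refine Finset.sum_congr rfl fun r _ => ?_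
  have : ((-1 : ℂ) ^ r) * (-1) ^ r = 1 := by rw [← mul_pow]; simp
  linear_combination (rising c r / rising (1 + a - c) r * wellPoised a r * baileyKernel a n r) * this

/-! ### Discrete beta sums, estimated by Gauss's theorem. -/

lemma exists_nonneg_gaussTerm_ofReal {b c d : ℝ} (hb : 0 < b) (hc : 0 < c) (hd : 0 < d) (n : ℕ) :
    ∃ x : ℝ, 0 ≤ x ∧ gaussTerm b c d n = x := by
  refine ⟨(∏ j ∈ Finset.range n, (b + j)) * (∏ j ∈ Finset.range n, (c + j)) / n.factorial *
    (Real.Gamma (d + n))⁻¹, ?_, ?_⟩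
  · have h1 : 0 ≤ ∏ j ∈ Finset.range n, (b + j) := Finset.prod_nonneg fun j _ => by positivity
    have h2 : 0 ≤ ∏ j ∈ Finset.range n, (c + j) := Finset.prod_nonneg fun j _ => by positivity
    have h3 : 0 < Real.Gamma (d + n) := Real.Gamma_pos_of_pos (by positivity)
    positivity
  · rw [gaussTerm, rising_eq_prod, rising_eq_prod, rGamma,
      show (d : ℂ) + n = ((d + n : ℝ) : ℂ) by push_cast; rfl, Complex.Gamma_ofReal]
    push_cast
    rfl

/-- Gauss's theorem for the norms of the terms, when the parameters are real and positive. -/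
lemma hasSum_norm_gaussTerm {b c d : ℝ} (hb : 0 < b) (hc : 0 < c) (hd : 0 < d) (h : b + c < d) :
    HasSum (fun n => ‖gaussTerm b c d n‖)
      ‖Complex.Gamma ((d - b - c : ℝ) : ℂ) * rGamma ((d - b : ℝ) : ℂ) * rGamma ((d - c : ℝ) : ℂ)‖ := by
  have h' : 0 < ((d : ℂ) - b - c).re := by
    simp only [Complex.sub_re, Complex.ofReal_re]; linarith
  have hs := summable_gaussTerm h'
  choose g hg0 hg using exists_nonneg_gaussTerm_ofReal hb hc hd
  have e := tsum_gaussTerm h'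
  push_cast
  rw [← e]
  have hn : (fun n => ‖gaussTerm b c d n‖) = g := funext fun n => by
    rw [hg, Complex.norm_real, Real.norm_of_nonneg (hg0 n)]
  have hg' : gaussTerm b c d = fun n => (g n : ℂ) := funext hg
  rw [hg'] at hs ⊢
  have hs' : Summable g := by exact_mod_cast hs
  rw [← Complex.ofReal_tsum, Complex.norm_real, Real.norm_of_nonneg (tsum_nonneg hg0)]
  have hn' : (fun n => ‖(g n : ℂ)‖) = g := funext fun n => by
    rw [Complex.norm_real, Real.norm_of_nonneg (hg0 n)]
  rw [hn']
  exact hs'.hasSum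

/-- A lower bound for `(p)_m` results from the upper bound for `1 / Γ(p + m)`, since the product of
the two is the constant `1 / Γ(p)`. -/
lemma exists_rpow_le_norm_rising {p : ℝ} (hp : 0 < p) : ∃ C : ℝ, 0 < C ∧ ∀ m : ℕ,
    ((m : ℝ) + 1) ^ (p - 1) ≤ C * (‖rising p m‖ / m.factorial) := by
  obtain ⟨C, hC, h⟩ := exists_norm_rGamma_add_le ‖(p : ℂ)‖
  have hG : 0 < ‖rGamma p‖ :=
    norm_pos_iff.2 (rGamma_ne_zero (ne_neg_nat_of_re_pos (by simpa using hp)))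
  refine ⟨C / ‖rGamma p‖, by positivity, fun m => ?_⟩
  have hm : (0 : ℝ) < (m : ℝ) + 1 := by positivity
  have h1 := h p le_rfl m
  have h2 : ‖rGamma p‖ = ‖rising p m‖ * ‖rGamma (p + m)‖ := by rw [← norm_mul, ← rGamma_eq_rising_mul]
  have h3 : ((m : ℝ) + 1) ^ (p - 1) * ((m : ℝ) + 1) ^ (1 - p) = 1 := by
    rw [← Real.rpow_add hm]; simp
  rw [Complex.ofReal_re] at h1
  have h4 : ‖rGamma p‖ ≤ ‖rising p m‖ * (C * (((m : ℝ) + 1) ^ (1 - p) / m.factorial)) := by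
    rw [h2]; gcongr
  rw [div_mul_eq_mul_div, le_div_iff₀ hG]
  calc _ ≤ ((m : ℝ) + 1) ^ (p - 1) *
        (‖rising p m‖ * (C * (((m : ℝ) + 1) ^ (1 - p) / m.factorial))) := by gcongr
    _ = C * (‖rising p m‖ / m.factorial) * (((m : ℝ) + 1) ^ (p - 1) * ((m : ℝ) + 1) ^ (1 - p)) := by
        ring
    _ = _ := by rw [h3, mul_one]

lemma exists_rpow_neg_le_norm_rGamma {l : ℝ} (hl : 0 < l) : ∃ C : ℝ, 0 < C ∧ ∀ m : ℕ,
    ((m : ℝ) + 1) ^ (-l) ≤ C * (m.factorial * ‖rGamma ((1 + l : ℝ) + m)‖) := by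
  obtain ⟨C, hC, h⟩ := exists_norm_rising_le ‖((1 + l : ℝ) : ℂ)‖
  have hG : 0 < ‖rGamma ((1 + l : ℝ))‖ :=
    norm_pos_iff.2 (rGamma_ne_zero (ne_neg_nat_of_re_pos (by simp; linarith)))
  refine ⟨C / ‖rGamma ((1 + l : ℝ))‖, by positivity, fun m => ?_⟩
  have hm : (0 : ℝ) < (m : ℝ) + 1 := by positivity
  have h1 := h (1 + l : ℝ) le_rfl m
  have h2 : ‖rGamma (1 + l : ℝ)‖ = ‖rising (1 + l : ℝ) m‖ * ‖rGamma ((1 + l : ℝ) + m)‖ := by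
    rw [← norm_mul, ← rGamma_eq_rising_mul]
  have h3 : ((m : ℝ) + 1) ^ (-l) * ((m : ℝ) + 1) ^ l = 1 := by
    rw [← Real.rpow_add hm]; simp
  rw [Complex.ofReal_re, add_sub_cancel_left] at h1
  rw [div_mul_eq_mul_div, le_div_iff₀ hG, h2]
  calc _ ≤ ((m : ℝ) + 1) ^ (-l) *
        ((C * (m.factorial * ((m : ℝ) + 1) ^ l)) * ‖rGamma ((1 + l : ℝ) + m)‖) := by gcongr
    _ = C * (m.factorial * ‖rGamma ((1 + l : ℝ) + m)‖) *
        (((m : ℝ) + 1) ^ (-l) * ((m : ℝ) + 1) ^ l) := by ring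
    _ = _ := by rw [h3, mul_one]

lemma factorial_add_eq_mul_rising (k m : ℕ) :
    ((k + m).factorial : ℂ) = k.factorial * rising (k + 1) m := by
  rw [← rising_one_eq_factorial, rising_add, rising_one_eq_factorial, add_comm (1 : ℂ)]

/-- Up to constants and a factor `k!`, the sum is dominated by a Gauss series with positive
parameters `p`, `k + 1`, `1 + p + q + k`. Its value is `Γ(q) / (Γ(p + q) Γ(1 + q + k))`, and `k! /
Γ(1 + q + k)` is `O((k + 1) ^ (-q))`. -/
lemma exists_tsum_rpow_mul_rpow_le_of_pos {p q : ℝ} (hp : 0 < p) (hq : 0 < q) :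
    ∃ C : ℝ, 0 < C ∧ ∀ k : ℕ,
      Summable (fun m : ℕ => ((m : ℝ) + 1) ^ (p - 1) * (((k + m : ℕ) : ℝ) + 1) ^ (-(p + q))) ∧
      ∑' m : ℕ, ((m : ℝ) + 1) ^ (p - 1) * (((k + m : ℕ) : ℝ) + 1) ^ (-(p + q)) ≤
        C * ((k : ℝ) + 1) ^ (-q) := by
  obtain ⟨C₁, hC₁, h1⟩ := exists_rpow_le_norm_rising hp
  obtain ⟨C₂, hC₂, h2⟩ := exists_rpow_neg_le_norm_rGamma (add_pos hp hq)
  obtain ⟨C₃, hC₃, h3⟩ := exists_norm_rGamma_add_le ‖((1 + q : ℝ) : ℂ)‖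
  have key : ∀ k m : ℕ, ((m : ℝ) + 1) ^ (p - 1) * (((k + m : ℕ) : ℝ) + 1) ^ (-(p + q)) ≤
      C₁ * C₂ * k.factorial * ‖gaussTerm p (k + 1 : ℝ) (1 + (p + q) + k : ℝ) m‖ := by
    intro k m
    refine (mul_le_mul (h1 m) (h2 (k + m)) (by positivity) (by positivity)).trans (le_of_eq ?_)
    have e : ((k + m).factorial : ℝ) = k.factorial * ‖rising ((k + 1 : ℝ) : ℂ) m‖ := by
      have := congrArg norm (factorial_add_eq_mul_rising k m)
      rw [norm_mul, Complex.norm_natCast, Complex.norm_natCast] at this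
      rw [this]; push_cast; rfl
    rw [gaussTerm, norm_mul, norm_div, norm_mul, Complex.norm_natCast, e,
      show (((1 + (p + q) + k : ℝ)) : ℂ) + m = ((1 + (p + q) : ℝ) : ℂ) + (k + m : ℕ) by push_cast; ring]
    ring
  refine ⟨C₁ * C₂ * (‖Complex.Gamma q‖ * ‖rGamma (p + q : ℝ)‖ * C₃) + 1, by positivity, fun k => ?_⟩
  have hk : (0 : ℝ) < (k : ℝ) + 1 := by positivity
  have hs := hasSum_norm_gaussTerm (b := p) (c := k + 1) (d := 1 + (p + q) + k) hp (by positivity)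
    (by positivity) (by linarith)
  have hs' := hs.mul_left (C₁ * C₂ * k.factorial)
  have hsum := Summable.of_nonneg_of_le (fun m => by positivity) (key k) hs'.summable
  refine ⟨hsum, (hsum.tsum_le_tsum (key k) hs'.summable).trans ?_⟩
  rw [hs'.tsum_eq, norm_mul, norm_mul]
  have h4 := h3 (1 + q : ℝ) le_rfl k
  rw [Complex.ofReal_re, show (1 : ℝ) - (1 + q) = -q by ring] at h4
  rw [show 1 + (p + q) + (k : ℝ) - p - (k + 1) = q by ring,
    show 1 + (p + q) + (k : ℝ) - (k + 1) = p + q by ring,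
    show (((1 + (p + q) + (k : ℝ) - p) : ℝ) : ℂ) = ((1 + q : ℝ) : ℂ) + k by push_cast; ring]
  calc _ ≤ C₁ * C₂ * k.factorial * (‖Complex.Gamma q‖ * (C₃ * (((k : ℝ) + 1) ^ (-q) / k.factorial)) *
        ‖rGamma (p + q : ℝ)‖) := by gcongr
    _ = C₁ * C₂ * (‖Complex.Gamma q‖ * ‖rGamma (p + q : ℝ)‖ * C₃) * ((k : ℝ) + 1) ^ (-q) := by
        field_simp
    _ ≤ _ := by gcongr; linarith

/-- A discrete beta integral: `∑ₘ (m + 1) ^ (u - 1) (k + m + 1) ^ (-l) = O((k + 1) ^ (p - l))` for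
`u < l`, as soon as `p` is positive and at least `u`. -/
lemma exists_tsum_rpow_mul_rpow_le {u l p : ℝ} (hul : u < l) (hp : 0 < p) (hup : u ≤ p) :
    ∃ C : ℝ, 0 < C ∧ ∀ k : ℕ,
      Summable (fun m : ℕ => ((m : ℝ) + 1) ^ (u - 1) * (((k + m : ℕ) : ℝ) + 1) ^ (-l)) ∧
      ∑' m : ℕ, ((m : ℝ) + 1) ^ (u - 1) * (((k + m : ℕ) : ℝ) + 1) ^ (-l) ≤
        C * ((k : ℝ) + 1) ^ (p - l) := by
  -- For `p < l` raise the exponent `u` to `p`. For `p ≥ l` the bound may grow with `k`, and `(k + m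
  -- + 1) ^ (-l) ≤ (m + 1) ^ (-l) (k + 1) ^ (p - l)` separates the variables.
  rcases lt_or_ge p l with hpl | hpl
  · obtain ⟨C, hC, h⟩ := exists_tsum_rpow_mul_rpow_le_of_pos hp (sub_pos.2 hpl)
    refine ⟨C, hC, fun k => ?_⟩
    obtain ⟨hs, hle⟩ := h k
    rw [add_sub_cancel, neg_sub] at hle
    rw [add_sub_cancel] at hs
    have key : ∀ m : ℕ, ((m : ℝ) + 1) ^ (u - 1) * (((k + m : ℕ) : ℝ) + 1) ^ (-l) ≤
        ((m : ℝ) + 1) ^ (p - 1) * (((k + m : ℕ) : ℝ) + 1) ^ (-l) := fun m => by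
      gcongr
      linarith [(Nat.cast_nonneg m : (0 : ℝ) ≤ m)]
    have hs' := Summable.of_nonneg_of_le (fun m => by positivity) key hs
    exact ⟨hs', (hs'.tsum_le_tsum key hs).trans hle⟩
  · have hsum := summable_nat_add_one_rpow (x := u - 1 - l) (by linarith)
    refine ⟨∑' m : ℕ, ((m : ℝ) + 1) ^ (u - 1 - l), ?_, fun k => ?_⟩
    · exact hsum.tsum_pos (fun m => by positivity) 0 (by positivity)
    have hk : (1 : ℝ) ≤ (k : ℝ) + 1 := by linarith [(Nat.cast_nonneg k : (0 : ℝ) ≤ k)]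
    have key : ∀ m : ℕ, ((m : ℝ) + 1) ^ (u - 1) * (((k + m : ℕ) : ℝ) + 1) ^ (-l) ≤
        ((m : ℝ) + 1) ^ (u - 1 - l) * ((k : ℝ) + 1) ^ (p - l) := by
      intro m
      have hm0 : (0 : ℝ) ≤ m := by positivity
      have hk0 : (0 : ℝ) ≤ k := by positivity
      have hm : (0 : ℝ) < (m : ℝ) + 1 := by positivity
      rw [sub_eq_add_neg (u - 1) l, Real.rpow_add hm, mul_assoc]
      gcongr
      push_cast
      rcases le_or_gt 0 l with hl | hl
      · calc ((k : ℝ) + m + 1) ^ (-l) ≤ ((m : ℝ) + 1) ^ (-l) :=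
              Real.rpow_le_rpow_of_nonpos hm (by linarith) (by linarith)
          _ = ((m : ℝ) + 1) ^ (-l) * 1 := (mul_one _).symm
          _ ≤ _ := by
              gcongr
              exact Real.one_le_rpow hk (by linarith)
      · calc ((k : ℝ) + m + 1) ^ (-l) ≤ (((m : ℝ) + 1) * ((k : ℝ) + 1)) ^ (-l) :=
              Real.rpow_le_rpow (by positivity) (by nlinarith) (by linarith)
          _ = ((m : ℝ) + 1) ^ (-l) * ((k : ℝ) + 1) ^ (-l) := Real.mul_rpow hm.le (by linarith)
          _ ≤ _ := by
              gcongr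
              linarith
    have hs := Summable.of_nonneg_of_le (fun m => by positivity) key (hsum.mul_right _)
    refine ⟨hs, (hs.tsum_le_tsum key (hsum.mul_right _)).trans (le_of_eq ?_)⟩
    rw [tsum_mul_right]

/-! ### Symbols and fractional summation. -/

/-- `f k = O((k + 1) ^ (-l))`. -/
def HasDecay (l : ℝ) (f : ℕ → ℂ) : Prop :=
  ∃ C : ℝ, 0 < C ∧ ∀ k : ℕ, ‖f k‖ ≤ C * ((k : ℝ) + 1) ^ (-l)

/-- The first `N` differences of `f` decay as those of `k ↦ (k + 1) ^ (-l)`. -/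
def IsSymbolUpTo : ℕ → ℝ → (ℕ → ℂ) → Prop
  | 0, l, f => HasDecay l f
  | N + 1, l, f => HasDecay l f ∧ IsSymbolUpTo N (l + 1) (fun k => f (k + 1) - f k)

/-- All differences of `f` decay as those of `k ↦ (k + 1) ^ (-l)`. -/
def IsSymbol (l : ℝ) (f : ℕ → ℂ) : Prop := ∀ N, IsSymbolUpTo N l f

lemma HasDecay.add {l : ℝ} {f g : ℕ → ℂ} (hf : HasDecay l f) (hg : HasDecay l g) :
    HasDecay l (fun k => f k + g k) := by
  obtain ⟨C, hC, h⟩ := hf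
  obtain ⟨D, hD, h'⟩ := hg
  refine ⟨C + D, by positivity, fun k => (norm_add_le _ _).trans ?_⟩
  rw [add_mul]
  exact add_le_add (h k) (h' k)

lemma HasDecay.mul {l l' : ℝ} {f g : ℕ → ℂ} (hf : HasDecay l f) (hg : HasDecay l' g) :
    HasDecay (l + l') (fun k => f k * g k) := by
  obtain ⟨C, hC, h⟩ := hf
  obtain ⟨D, hD, h'⟩ := hg
  refine ⟨C * D, by positivity, fun k => ?_⟩
  have hk : (0 : ℝ) < (k : ℝ) + 1 := by positivity
  rw [norm_mul, neg_add, Real.rpow_add hk]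
  refine (mul_le_mul (h k) (h' k) (norm_nonneg _) (by positivity)).trans (le_of_eq (by ring))

lemma HasDecay.shift {l : ℝ} {f : ℕ → ℂ} (hf : HasDecay l f) :
    HasDecay l (fun k => f (k + 1)) := by
  obtain ⟨C, hC, h⟩ := hf
  refine ⟨C * 2 ^ |l|, by positivity, fun k => (h (k + 1)).trans ?_⟩
  rw [mul_assoc]
  gcongr
  have hk : (0 : ℝ) < (k : ℝ) + 1 := by positivity
  have hk0 : (0 : ℝ) ≤ (k : ℝ) := by positivity
  push_cast
  rcases le_or_gt 0 l with hl | hl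
  · calc ((k : ℝ) + 1 + 1) ^ (-l) ≤ ((k : ℝ) + 1) ^ (-l) :=
        Real.rpow_le_rpow_of_nonpos hk (by linarith) (by linarith)
      _ ≤ _ := le_mul_of_one_le_left (by positivity) (Real.one_le_rpow (by norm_num) (abs_nonneg _))
  · rw [abs_of_neg hl, ← Real.mul_rpow (by norm_num) hk.le]
    exact Real.rpow_le_rpow (by positivity) (by linarith) (by linarith)

lemma IsSymbolUpTo.hasDecay {N : ℕ} {l : ℝ} {f : ℕ → ℂ} (h : IsSymbolUpTo N l f) :
    HasDecay l f := by
  cases N with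
  | zero => exact h
  | succ N => exact h.1

lemma IsSymbolUpTo.of_succ {N : ℕ} {l : ℝ} {f : ℕ → ℂ} (h : IsSymbolUpTo (N + 1) l f) :
    IsSymbolUpTo N l f := by
  induction N generalizing l f with
  | zero => exact h.1
  | succ N ih => exact ⟨h.1, ih h.2⟩

lemma IsSymbolUpTo.add {N : ℕ} {l : ℝ} {f g : ℕ → ℂ} (hf : IsSymbolUpTo N l f)
    (hg : IsSymbolUpTo N l g) : IsSymbolUpTo N l (fun k => f k + g k) := by
  induction N generalizing l f g with
  | zero => exact HasDecay.add hf hg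
  | succ N ih =>
    refine ⟨hf.1.add hg.1, ?_⟩
    have h := ih hf.2 hg.2
    refine Eq.mp ?_ h
    congr 1; funext k; ring

lemma IsSymbolUpTo.shift {N : ℕ} {l : ℝ} {f : ℕ → ℂ} (hf : IsSymbolUpTo N l f) :
    IsSymbolUpTo N l (fun k => f (k + 1)) := by
  induction N generalizing l f with
  | zero => exact HasDecay.shift hf
  | succ N ih => exact ⟨hf.1.shift, ih hf.2⟩

lemma IsSymbolUpTo.mul {N : ℕ} {l l' : ℝ} {f g : ℕ → ℂ} (hf : IsSymbolUpTo N l f)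
    (hg : IsSymbolUpTo N l' g) : IsSymbolUpTo N (l + l') (fun k => f k * g k) := by
  induction N generalizing l l' f g with
  | zero => exact HasDecay.mul hf hg
  | succ N ih =>
    refine ⟨hf.1.mul hg.1, ?_⟩
    have h1 := ih hf.2 hg.of_succ
    have h2 := ih hf.of_succ.shift hg.2
    rw [show l + 1 + l' = l + l' + 1 by ring] at h1
    rw [← add_assoc] at h2
    refine Eq.mp ?_ (h1.add h2)
    congr 1; funext k; ring

lemma IsSymbol.mul {l l' : ℝ} {f g : ℕ → ℂ} (hf : IsSymbol l f) (hg : IsSymbol l' g) :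
    IsSymbol (l + l') (fun k => f k * g k) := fun N => (hf N).mul (hg N)

lemma IsSymbol.hasDecay {l : ℝ} {f : ℕ → ℂ} (hf : IsSymbol l f) : HasDecay l f := hf 0

lemma IsSymbol.diff {l : ℝ} {f : ℕ → ℂ} (hf : IsSymbol l f) :
    IsSymbol (l + 1) (fun k => f (k + 1) - f k) := fun N => (hf (N + 1)).2

lemma isSymbolUpTo_zero (N : ℕ) (l : ℝ) : IsSymbolUpTo N l (fun _ => 0) := by
  have h : ∀ l : ℝ, HasDecay l (fun _ => 0) := fun l =>
    ⟨1, one_pos, fun k => by rw [norm_zero]; positivity⟩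
  induction N generalizing l with
  | zero => exact h l
  | succ N ih => exact ⟨h l, by simpa using ih (l + 1)⟩

lemma isSymbol_const (c : ℂ) : IsSymbol 0 (fun _ => c) := by
  have h : HasDecay 0 (fun _ => c) := ⟨‖c‖ + 1, by positivity, fun k => by simp⟩
  intro N
  cases N with
  | zero => exact h
  | succ N => exact ⟨h, by simpa using isSymbolUpTo_zero N 1⟩

lemma hasDecay_rising_div_rising (b : ℂ) {d : ℂ} (hd : ∀ m : ℕ, d ≠ -(m : ℂ)) :
    HasDecay (d - b).re (fun k => rising b k / rising d k) := by
  obtain ⟨C, hC, h⟩ := exists_norm_rising_div_rising_le b hd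
  refine ⟨C, hC, fun k => (h k).trans (le_of_eq ?_)⟩
  congr 2
  simp

/-- The difference of `(b)_k / (d)_k` is `((b - d) / d) (b)_k / (d + 1)_k`, again of the same form,
with exponent larger by one. -/
lemma isSymbol_rising_div_rising (b : ℂ) {d : ℂ} (hd : ∀ m : ℕ, d ≠ -(m : ℂ)) :
    IsSymbol (d - b).re (fun k => rising b k / rising d k) := by
  intro N
  induction N generalizing d with
  | zero => exact hasDecay_rising_div_rising b hd
  | succ N ih =>
    refine ⟨hasDecay_rising_div_rising b hd, ?_⟩
    have hd' : ∀ m : ℕ, d + 1 ≠ -(m : ℂ) := fun m h => hd (m + 1) (by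
      push_cast; linear_combination h)
    have h := (isSymbol_const ((b - d) / d) N).mul (ih hd')
    have e : 0 + (d + 1 - b).re = (d - b).re + 1 := by
      simp only [Complex.sub_re, Complex.add_re, Complex.one_re]; ring
    rw [e] at h
    refine Eq.mp ?_ h
    congr 1
    funext k
    have h0 : d ≠ 0 := by simpa using hd 0
    have h1 := rising_ne_zero hd k
    have h2 := rising_ne_zero hd' k
    have h3 : d + k ≠ 0 := fun h => hd k (eq_neg_of_add_eq_zero_left h)
    have e1 := rising_mul_add d k
    simp only []
    rw [rising_succ, rising_succ, e1]
    have e2 : rising d k = d * rising (d + 1) k / (d + k) := by rw [eq_div_iff h3, e1]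
    rw [e2]
    field_simp
    ring

/-- The fractional sum `∑ₘ (u)_m / m! f(k + m)`. -/
noncomputable def fracSum (u : ℂ) (f : ℕ → ℂ) (k : ℕ) : ℂ :=
  ∑' m : ℕ, rising u m / m.factorial * f (k + m)

lemma HasDecay.exists_norm_fracSum_term_le {l : ℝ} {f : ℕ → ℂ} (hf : HasDecay l f) (u : ℂ) :
    ∃ C : ℝ, 0 < C ∧ ∀ k m : ℕ, ‖rising u m / m.factorial * f (k + m)‖ ≤
      C * (((m : ℝ) + 1) ^ (u.re - 1) * (((k + m : ℕ) : ℝ) + 1) ^ (-l)) := by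
  obtain ⟨C, hC, h⟩ := hf
  obtain ⟨D, hD, h'⟩ := exists_norm_rising_div_factorial_le u
  refine ⟨D * C, by positivity, fun k m => ?_⟩
  rw [norm_mul]
  refine (mul_le_mul (h' m) (h (k + m)) (norm_nonneg _) (by positivity)).trans (le_of_eq (by ring))

lemma HasDecay.summable_fracSum {l : ℝ} {f : ℕ → ℂ} (hf : HasDecay l f) {u : ℂ} (hu : u.re < l)
    (k : ℕ) : Summable fun m : ℕ => rising u m / m.factorial * f (k + m) := by
  obtain ⟨C, -, h⟩ := hf.exists_norm_fracSum_term_le u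
  obtain ⟨D, -, h'⟩ := exists_tsum_rpow_mul_rpow_le hu (p := max u.re 1) (by positivity)
    (le_max_left _ _)
  exact Summable.of_norm_bounded ((h' k).1.mul_left C) (h k)

lemma HasDecay.fracSum_of_re_pos {l : ℝ} {f : ℕ → ℂ} (hf : HasDecay l f) {u : ℂ} (hu : u.re < l)
    (hu0 : 0 < u.re) : HasDecay (l - u.re) (fracSum u f) := by
  obtain ⟨C, hC, h⟩ := hf.exists_norm_fracSum_term_le u
  obtain ⟨D, hD, h'⟩ := exists_tsum_rpow_mul_rpow_le hu hu0 le_rfl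
  refine ⟨C * D, by positivity, fun k => ?_⟩
  rw [neg_sub, mul_assoc]
  have hs := (h' k).1.mul_left C
  refine (tsum_of_norm_bounded hs.hasSum (h k)).trans ?_
  rw [tsum_mul_left]
  exact mul_le_mul_of_nonneg_left (h' k).2 hC.le

/-- Abel summation: `(u + 1)_M / M!` is the sum of `(u)_m / m!` over `m ≤ M`. -/
lemma sum_fracSum_by_parts (u : ℂ) (f : ℕ → ℂ) (M : ℕ) :
    ∑ m ∈ Finset.range (M + 1), rising u m / m.factorial * f m +
      ∑ m ∈ Finset.range (M + 1), rising (u + 1) m / m.factorial * (f (m + 1) - f m) =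
    rising (u + 1) M / M.factorial * f (M + 1) := by
  induction M with
  | zero => simp
  | succ M ih =>
    rw [Finset.sum_range_succ, Finset.sum_range_succ _ (M + 1)]
    have h : rising u (M + 1) / (M + 1).factorial + rising (u + 1) M / M.factorial =
        rising (u + 1) (M + 1) / (M + 1).factorial := by
      have f1 : (M.factorial : ℂ) ≠ 0 := by exact_mod_cast M.factorial_ne_zero
      have f3 := Nat.cast_add_one_ne_zero (R := ℂ) M
      rw [rising_succ_left, rising_succ, Nat.factorial_succ]
      push_cast
      field_simp
      ring
    linear_combination ih + f (M + 1) * h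

/-- Raises the order `u` by one at the price of a difference of `f`. The boundary term is `O((M + 1)
^ (Re u - l))` for fixed `k`, hence vanishes in the limit. -/
lemma HasDecay.fracSum_eq_neg {l : ℝ} {f : ℕ → ℂ} (hf : HasDecay l f)
    (hf' : HasDecay (l + 1) fun k => f (k + 1) - f k) {u : ℂ} (hu : u.re < l) (k : ℕ) :
    fracSum u f k = -fracSum (u + 1) (fun k => f (k + 1) - f k) k := by
  have h1 := (hf.summable_fracSum hu k).hasSum.tendsto_sum_nat.comp (tendsto_add_atTop_nat 1)
  have h2 := (hf'.summable_fracSum (u := u + 1)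
    (by rw [Complex.add_re, Complex.one_re]; linarith) k).hasSum.tendsto_sum_nat.comp
    (tendsto_add_atTop_nat 1)
  have h3 := h1.add h2
  have hlim : Tendsto (fun M : ℕ => rising (u + 1) M / M.factorial * f (k + (M + 1))) atTop (𝓝 0) := by
    obtain ⟨C, hC, h⟩ := hf.shift.exists_norm_fracSum_term_le (u + 1)
    refine squeeze_zero_norm (a := fun M : ℕ => C * ((k : ℝ) + 1) ^ |l| * ((M : ℝ) + 1) ^ (u.re - l))
      (fun M => (h k M).trans ?_) ?_
    · have hM : (0 : ℝ) < (M : ℝ) + 1 := by positivity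
      have hk : (0 : ℝ) < (k : ℝ) + 1 := by positivity
      have hM0 : (0 : ℝ) ≤ (M : ℝ) := by positivity
      have hk0 : (0 : ℝ) ≤ (k : ℝ) := by positivity
      have h5 : (((k + M : ℕ) : ℝ) + 1) ^ (-l) ≤ ((k : ℝ) + 1) ^ |l| * ((M : ℝ) + 1) ^ (-l) := by
        push_cast
        rcases le_or_gt 0 l with hl | hl
        · calc ((k : ℝ) + M + 1) ^ (-l) ≤ ((M : ℝ) + 1) ^ (-l) :=
              Real.rpow_le_rpow_of_nonpos hM (by linarith) (by linarith)
            _ ≤ _ := le_mul_of_one_le_left (by positivity)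
              (Real.one_le_rpow (by linarith) (abs_nonneg _))
        · rw [abs_of_neg hl, ← Real.mul_rpow hk.le hM.le]
          exact Real.rpow_le_rpow (by positivity) (by nlinarith) (by linarith)
      rw [mul_assoc]
      refine mul_le_mul_of_nonneg_left ?_ hC.le
      rw [Complex.add_re, Complex.one_re, add_sub_cancel_right, sub_eq_add_neg, Real.rpow_add hM]
      calc _ ≤ ((M : ℝ) + 1) ^ u.re * (((k : ℝ) + 1) ^ |l| * ((M : ℝ) + 1) ^ (-l)) := by gcongr
        _ = _ := by ring
    · simpa using (tendsto_nat_add_one_rpow_neg (x := u.re - l) (by linarith)).const_mul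
        (C * ((k : ℝ) + 1) ^ |l|)
  have h6 : ∀ M : ℕ, ∑ m ∈ Finset.range (M + 1), rising u m / m.factorial * f (k + m) +
      ∑ m ∈ Finset.range (M + 1), rising (u + 1) m / m.factorial * (f (k + m + 1) - f (k + m)) =
      rising (u + 1) M / M.factorial * f (k + (M + 1)) :=
    fun M => sum_fracSum_by_parts u (fun m => f (k + m)) M
  have h7 := tendsto_nhds_unique (h3.congr h6) hlim
  exact eq_neg_of_add_eq_zero_left h7

/-- Taking norms gives the right exponent only for `Re u > 0`. Otherwise sum by parts until the
order has positive real part; each time `u` and the exponent of `f` both increase by one, so `l - Re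
u` is unchanged. -/
lemma IsSymbol.hasDecay_fracSum {l : ℝ} {f : ℕ → ℂ} (hf : IsSymbol l f) {u : ℂ} (hu : u.re < l) :
    HasDecay (l - u.re) (fracSum u f) := by
  obtain ⟨n, hn⟩ := exists_nat_gt (-u.re)
  induction n generalizing l f u with
  | zero => exact hf.hasDecay.fracSum_of_re_pos hu (by simpa using hn)
  | succ n ih =>
    obtain ⟨C, hC, h⟩ := ih (u := u + 1) hf.diff (by rw [Complex.add_re, Complex.one_re]; linarith)
      (by push_cast at hn; rw [Complex.add_re, Complex.one_re]; linarith)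
    refine ⟨C, hC, fun k => ?_⟩
    rw [hf.hasDecay.fracSum_eq_neg hf.diff.hasDecay hu, norm_neg]
    rw [Complex.add_re, Complex.one_re, add_sub_add_right_eq_sub] at h
    exact h k

/-- Fractional summation of order `u` maps symbols of order `l` to symbols of order `l - Re u`. -/
theorem IsSymbol.fracSum {l : ℝ} {f : ℕ → ℂ} (hf : IsSymbol l f) {u : ℂ} (hu : u.re < l) :
    IsSymbol (l - u.re) (fracSum u f) := by
  intro N
  induction N generalizing l f with
  | zero => exact hf.hasDecay_fracSum hu
  | succ N ih =>
    refine ⟨hf.hasDecay_fracSum hu, ?_⟩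
    -- Fractional summation commutes with taking differences.
    have h := ih hf.diff (by linarith)
    rw [show l + 1 - u.re = l - u.re + 1 by ring] at h
    refine Eq.mp ?_ h
    congr 1
    funext k
    rw [_root_.fracSum, _root_.fracSum, _root_.fracSum,
      ← (hf.hasDecay.summable_fracSum hu (k + 1)).tsum_sub (hf.hasDecay.summable_fracSum hu k)]
    refine tsum_congr fun m => ?_
    rw [show k + 1 + m = k + m + 1 by ring]
    ring

/-! ### The multiple sums: absolute convergence and sharp decay. -/

lemma multisumFactor_eq (a : ℂ) (b c : ℕ → ℂ) (j k K : ℕ) :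
    multisumFactor a b c j k K = rising (1 + a - b j - c j) k / k.factorial *
      (rising (b (j + 1)) K / rising (1 + a - b j) K * (rising (c (j + 1)) K / rising (1 + a - c j) K)) := by
  simp only [multisumFactor, rising]
  rw [div_mul_div_comm, div_mul_div_comm]
  ring_nf

/-- The part of the summand of the multiple sums that belongs to the indices `j₀ + 1, …, j₀ + n`,
when the preceding summation indices add up to `K`. -/
noncomputable def chainTerm (a : ℂ) (b c : ℕ → ℂ) (n j₀ K : ℕ) (k : Fin n → ℕ) : ℂ :=
  ∏ j : Fin n, multisumFactor a b c (j₀ + j.val + 1) (k j) (K + ∑ i ∈ Finset.Iic j, k i)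

lemma sum_Iic_succ_cons {n : ℕ} (m : ℕ) (k : Fin n → ℕ) (j : Fin n) :
    ∑ i ∈ Finset.Iic j.succ, (Fin.cons m k : Fin (n + 1) → ℕ) i = m + ∑ i ∈ Finset.Iic j, k i := by
  have h1 : ∀ {N : ℕ} (j : Fin N) (f : Fin N → ℕ),
      ∑ i ∈ Finset.Iic j, f i = ∑ i, if i ≤ j then f i else 0 := by
    intro N j f
    rw [← Finset.sum_filter]
    congr 1
    ext i; simp
  rw [h1, h1, Fin.sum_univ_succ]
  simp

lemma sum_Iic_zero_cons {n : ℕ} (m : ℕ) (k : Fin n → ℕ) :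
    ∑ i ∈ Finset.Iic (0 : Fin (n + 1)), (Fin.cons m k : Fin (n + 1) → ℕ) i = m := by
  have : Finset.Iic (0 : Fin (n + 1)) = {0} := by
    ext i; simp
  rw [this]; simp

lemma chainTerm_cons (a : ℂ) (b c : ℕ → ℂ) (n j₀ K m : ℕ) (k : Fin n → ℕ) :
    chainTerm a b c (n + 1) j₀ K (Fin.cons m k) =
      multisumFactor a b c (j₀ + 1) m (K + m) * chainTerm a b c n (j₀ + 1) (K + m) k := by
  rw [chainTerm, Fin.prod_univ_succ, sum_Iic_zero_cons, chainTerm]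
  congr 1
  refine Finset.prod_congr rfl fun j _ => ?_
  rw [sum_Iic_succ_cons, Fin.cons_succ, add_assoc K, Fin.val_succ]
  congr 1
  ring

/-- The exponents that govern the absolute convergence of the multiple sums. -/
def decayExp (U p : ℕ → ℝ) : ℕ → ℕ → ℝ
  | 0, j => U (j + 1)
  | n + 1, j => decayExp U p n (j + 1) + 2 * U (j + 1) - p (j + 1)

/-- The exponents that govern the size of the multiple sums. -/
def sumExp (U : ℕ → ℝ) : ℕ → ℕ → ℝ
  | 0, j => U (j + 1)
  | n + 1, j => sumExp U n (j + 1) + U (j + 1)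

lemma decayExp_le_sumExp {U p : ℕ → ℝ} (h : ∀ j, U j ≤ p j) (n j : ℕ) :
    decayExp U p n j ≤ sumExp U n j := by
  induction n generalizing j with
  | zero => exact le_rfl
  | succ n ih =>
    rw [decayExp, sumExp]
    linarith [ih (j + 1), h (j + 1)]

lemma isSymbol_multisumFactor_quotient {a : ℂ} {b c : ℕ → ℂ} {j : ℕ}
    (hb : ∀ m : ℕ, 1 + a - b j ≠ -(m : ℂ)) (hc : ∀ m : ℕ, 1 + a - c j ≠ -(m : ℂ)) :
    IsSymbol ((1 + a - b j - c j).re + (1 + a - b (j + 1) - c (j + 1)).re)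
      (fun K => rising (b (j + 1)) K / rising (1 + a - b j) K *
        (rising (c (j + 1)) K / rising (1 + a - c j) K)) := by
  have h := (isSymbol_rising_div_rising (b (j + 1)) hb).mul (isSymbol_rising_div_rising (c (j + 1)) hc)
  refine Eq.mp ?_ h
  congr 1
  simp only [Complex.sub_re, Complex.add_re, Complex.one_re]
  ring

lemma summable_consEquiv_iff {n : ℕ} {E : Type*} [NormedAddCommGroup E] {f : (Fin (n + 1) → ℕ) → E} :
    Summable f ↔ Summable fun x : ℕ × (Fin n → ℕ) => f (Fin.cons x.1 x.2) :=
  (Fin.consEquiv (fun _ : Fin (n + 1) => ℕ)).summable_iff.symm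

lemma tsum_consEquiv {n : ℕ} {E : Type*} [NormedAddCommGroup E] (f : (Fin (n + 1) → ℕ) → E) :
    ∑' k, f k = ∑' x : ℕ × (Fin n → ℕ), f (Fin.cons x.1 x.2) :=
  ((Fin.consEquiv (fun _ : Fin (n + 1) => ℕ)).tsum_eq f).symm

/-- Sum the norms with the first index outermost. If the sum over the later indices has exponent `e
= decayExp U p n (j₀ + 1)`, the first one is a discrete beta sum with `u = U (j₀ + 1)` and `l = u +
e`. It converges for `e > 0`, and `p (j₀ + 1)` replaces `u` in the outcome because `u` need not be
positive. -/
theorem exists_tsum_norm_chainTerm_le {a : ℂ} {b c : ℕ → ℂ} {U p : ℕ → ℝ}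
    (hU : ∀ j, U j = (1 + a - b j - c j).re) (hp : ∀ j, 0 < p j) (hUp : ∀ j, U j ≤ p j) (n j₀ : ℕ)
    (hbc : ∀ j ∈ Finset.Icc (j₀ + 1) (j₀ + n), ∀ m : ℕ,
      1 + a - b j ≠ -(m : ℂ) ∧ 1 + a - c j ≠ -(m : ℂ))
    (hE : ∀ i j, i < n → i + j = j₀ + n → 0 < decayExp U p i j) :
    ∃ C : ℝ, 0 < C ∧ ∀ K : ℕ, (Summable fun k => ‖chainTerm a b c n j₀ K k‖) ∧
      ∑' k, ‖chainTerm a b c n j₀ K k‖ ≤ C * ((K : ℝ) + 1) ^ (-(decayExp U p n j₀ - U (j₀ + 1))) := by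
  induction n generalizing j₀ with
  | zero =>
    refine ⟨1, one_pos, fun K => ⟨(hasSum_fintype _).summable, ?_⟩⟩
    simp [decayExp, chainTerm]
  | succ n ih =>
    obtain ⟨C, hC, h⟩ := ih (j₀ + 1) (fun j hj => hbc j (by simp only [Finset.mem_Icc] at hj ⊢; omega))
      (fun i j hi hij => hE i j (by omega) (by omega))
    have hj := hbc (j₀ + 1) (by simp only [Finset.mem_Icc]; omega)
    obtain ⟨D, hD, h'⟩ := (isSymbol_multisumFactor_quotient (fun m => (hj m).1) (fun m => (hj m).2)).hasDecay
    obtain ⟨B, hB, h''⟩ := exists_norm_rising_div_factorial_le (1 + a - b (j₀ + 1) - c (j₀ + 1))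
    rw [← hU] at h''
    rw [← hU, ← hU] at h'
    have hpos : 0 < decayExp U p n (j₀ + 1) := hE n (j₀ + 1) (by omega) (by omega)
    set e := decayExp U p n (j₀ + 1)
    obtain ⟨M, hM, hsum⟩ := exists_tsum_rpow_mul_rpow_le (u := U (j₀ + 1)) (l := U (j₀ + 1) + e)
      (p := p (j₀ + 1)) (by linarith) (hp _) (hUp _)
    have key : ∀ K m : ℕ, ∑' k, ‖chainTerm a b c (n + 1) j₀ K (Fin.cons m k)‖ ≤
        B * D * C * (((m : ℝ) + 1) ^ (U (j₀ + 1) - 1) * (((K + m : ℕ) : ℝ) + 1) ^ (-(U (j₀ + 1) + e))) := by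
      intro K m
      have hK : (0 : ℝ) < ((K + m : ℕ) : ℝ) + 1 := by positivity
      simp only [chainTerm_cons, norm_mul]
      rw [tsum_mul_left, multisumFactor_eq, norm_mul]
      calc _ ≤ (B * ((m : ℝ) + 1) ^ (U (j₀ + 1) - 1) *
            (D * (((K + m : ℕ) : ℝ) + 1) ^ (-(U (j₀ + 1) + U (j₀ + 1 + 1))))) *
            (C * (((K + m : ℕ) : ℝ) + 1) ^ (-(e - U (j₀ + 1 + 1)))) :=
            mul_le_mul (mul_le_mul (h'' m) (h' (K + m)) (norm_nonneg _) (by positivity))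
              (h (K + m)).2 (tsum_nonneg fun _ => norm_nonneg _) (by positivity)
        _ = B * D * C * (((m : ℝ) + 1) ^ (U (j₀ + 1) - 1) *
            ((((K + m : ℕ) : ℝ) + 1) ^ (-(U (j₀ + 1) + U (j₀ + 1 + 1))) *
              (((K + m : ℕ) : ℝ) + 1) ^ (-(e - U (j₀ + 1 + 1))))) := by ring
        _ = _ := by
            rw [← Real.rpow_add hK]
            congr 3
            ring
    refine ⟨B * D * C * M, by positivity, fun K => ?_⟩
    have hs1 : Summable fun m => ∑' k, ‖chainTerm a b c (n + 1) j₀ K (Fin.cons m k)‖ :=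
      Summable.of_nonneg_of_le (fun m => tsum_nonneg fun _ => norm_nonneg _) (key K)
        ((hsum K).1.mul_left _)
    have hs2 : Summable fun x : ℕ × (Fin n → ℕ) => ‖chainTerm a b c (n + 1) j₀ K (Fin.cons x.1 x.2)‖ := by
      rw [summable_prod_of_nonneg (fun _ => norm_nonneg _)]
      refine ⟨fun m => ?_, hs1⟩
      simp only [chainTerm_cons, norm_mul]
      exact (h (K + m)).1.mul_left _
    refine ⟨summable_consEquiv_iff.2 hs2, ?_⟩
    rw [tsum_consEquiv, hs2.tsum_prod]
    refine (hs1.tsum_le_tsum (key K) ((hsum K).1.mul_left _)).trans ?_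
    rw [tsum_mul_left, mul_assoc (B * D * C)]
    refine mul_le_mul_of_nonneg_left ((hsum K).2.trans (le_of_eq ?_)) (by positivity)
    rw [decayExp]
    congr 2
    ring

/-- The sum over the indices `j₀ + 1, …, j₀ + n`. -/
noncomputable def chainSum (a : ℂ) (b c : ℕ → ℂ) (n j₀ K : ℕ) : ℂ :=
  ∑' k, chainTerm a b c n j₀ K k

/-- Without norms the sum over the first index is a fractional sum of order `1 + a - b (j₀ + 1) - c
(j₀ + 1)`, so the exponent changes by exactly its real part and `p` drops out of the result.
Absolute summability serves only to iterate the sum. -/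
theorem isSymbol_chainSum {a : ℂ} {b c : ℕ → ℂ} {U p : ℕ → ℝ}
    (hU : ∀ j, U j = (1 + a - b j - c j).re) (hp : ∀ j, 0 < p j) (hUp : ∀ j, U j ≤ p j) (n j₀ : ℕ)
    (hbc : ∀ j ∈ Finset.Icc (j₀ + 1) (j₀ + n), ∀ m : ℕ,
      1 + a - b j ≠ -(m : ℂ) ∧ 1 + a - c j ≠ -(m : ℂ))
    (hE : ∀ i j, i < n → i + j = j₀ + n → 0 < decayExp U p i j) :
    IsSymbol (sumExp U n j₀ - U (j₀ + 1)) (chainSum a b c n j₀) := by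
  induction n generalizing j₀ with
  | zero =>
    have e : chainSum a b c 0 j₀ = fun _ => 1 := by
      funext K
      simp [chainSum, chainTerm]
    rw [e, sumExp, sub_self]
    exact isSymbol_const 1
  | succ n ih =>
    have hs := ih (j₀ + 1) (fun j hj => hbc j (by simp only [Finset.mem_Icc] at hj ⊢; omega))
      (fun i j hi hij => hE i j (by omega) (by omega))
    have hj := hbc (j₀ + 1) (by simp only [Finset.mem_Icc]; omega)
    have hq := isSymbol_multisumFactor_quotient (fun m => (hj m).1) (fun m => (hj m).2)
    have hpos : 0 < sumExp U n (j₀ + 1) :=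
      (hE n (j₀ + 1) (by omega) (by omega)).trans_le (decayExp_le_sumExp hUp _ _)
    have hf := (hq.mul hs).fracSum (u := 1 + a - b (j₀ + 1) - c (j₀ + 1))
      (by rw [← hU, ← hU]; linarith)
    obtain ⟨_, -, habs⟩ := exists_tsum_norm_chainTerm_le hU hp hUp (n + 1) j₀ hbc hE
    have e : chainSum a b c (n + 1) j₀ = fracSum (1 + a - b (j₀ + 1) - c (j₀ + 1)) (fun K =>
        rising (b (j₀ + 1 + 1)) K / rising (1 + a - b (j₀ + 1)) K *
        (rising (c (j₀ + 1 + 1)) K / rising (1 + a - c (j₀ + 1)) K) * chainSum a b c n (j₀ + 1) K) := by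
      funext K
      rw [chainSum, fracSum, tsum_consEquiv,
        (summable_consEquiv_iff.1 (habs K).1.of_norm).tsum_prod]
      refine tsum_congr fun m => ?_
      simp only [chainTerm_cons]
      rw [tsum_mul_left, multisumFactor_eq, chainSum]
      ring
    rw [e]
    refine Eq.mp ?_ hf
    congr 1
    rw [← hU, ← hU, sumExp]
    ring

/-! ### Iteration of Bailey's lemma. -/

/-- Regrouping the first two of a family of summation indices by their sum. -/
def antidiagonalConsEquiv (n : ℕ) :
    (Σ x : ℕ × (Fin n → ℕ), Finset.HasAntidiagonal.antidiagonal x.1) ≃ ℕ × (Fin (n + 1) → ℕ) where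
  toFun x := (x.2.1.1, Fin.cons x.2.1.2 x.1.2)
  invFun y := ⟨(y.1 + y.2 0, Fin.tail y.2), ⟨(y.1, y.2 0), by simp⟩⟩
  left_inv := by
    rintro ⟨⟨N, k⟩, ⟨⟨i, j⟩, h⟩⟩
    have h' : i + j = N := by simpa using h
    subst h'
    rfl
  right_inv := by
    rintro ⟨K, k⟩
    simp

lemma hasSum_antidiagonal_cons {n : ℕ} {F : ℕ × (Fin (n + 1) → ℕ) → ℂ} (hF : Summable F) :
    HasSum (fun x : ℕ × (Fin n → ℕ) =>
      ∑ p ∈ Finset.HasAntidiagonal.antidiagonal x.1, F (p.1, Fin.cons p.2 x.2)) (∑' y, F y) := by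
  have h1 := (antidiagonalConsEquiv n).hasSum_iff.2 hF.hasSum
  have h2 := h1.sigma (g := fun x : ℕ × (Fin n → ℕ) =>
      ∑ p ∈ Finset.HasAntidiagonal.antidiagonal x.1, F (p.1, Fin.cons p.2 x.2)) (fun x => by
    have h3 := hasSum_fintype (fun p : Finset.HasAntidiagonal.antidiagonal x.1 =>
      F (p.1.1, Fin.cons p.1.2 x.2))
    rw [Finset.sum_coe_sort (Finset.HasAntidiagonal.antidiagonal x.1)
      (fun p => F (p.1, Fin.cons p.2 x.2))] at h3
    exact h3)
  exact h2

/-- The quotient `(b)_r (c)_r / ((1 + a - b)_r (1 + a - c)_r)`. -/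
noncomputable def baileyFactor (a b c : ℂ) (r : ℕ) : ℂ :=
  rising b r * rising c r / (rising (1 + a - b) r * rising (1 + a - c) r)

/-- Iterating Bailey's lemma: the multiple sum collapses to a single sum over the second member of
a Bailey pair. -/
theorem IsBaileyPair.exists_hasSum_chain {a : ℂ} {b c : ℕ → ℂ} {n : ℕ} {j₀ : ℕ} {α β : ℕ → ℂ}
    (h : IsBaileyPair a α β)
    (hbc : ∀ j ∈ Finset.Icc (j₀ + 1) (j₀ + n), ∀ m : ℕ,
      1 + a - b j ≠ -(m : ℂ) ∧ 1 + a - c j ≠ -(m : ℂ))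
    (hs : Summable fun x : ℕ × (Fin n → ℕ) =>
      rising (b (j₀ + 1)) x.1 * rising (c (j₀ + 1)) x.1 * β x.1 * chainTerm a b c n j₀ x.1 x.2) :
    ∃ β' : ℕ → ℂ,
      IsBaileyPair a (fun r => (∏ j ∈ Finset.Icc (j₀ + 1) (j₀ + n), baileyFactor a (b j) (c j) r) * α r)
        β' ∧
      HasSum (fun N => rising (b (j₀ + n + 1)) N * rising (c (j₀ + n + 1)) N * β' N)
        (∑' x : ℕ × (Fin n → ℕ),
          rising (b (j₀ + 1)) x.1 * rising (c (j₀ + 1)) x.1 * β x.1 * chainTerm a b c n j₀ x.1 x.2) := by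
  induction n generalizing j₀ α β with
  | zero =>
    refine ⟨β, by simpa using h, ?_⟩
    have h1 := (Equiv.prodUnique ℕ (Fin 0 → ℕ)).symm.hasSum_iff.2 hs.hasSum
    simpa [Function.comp_def, chainTerm] using h1
  | succ n ih =>
    have hj := hbc (j₀ + 1) (by simp only [Finset.mem_Icc]; omega)
    have hB := h.bailey_lemma (fun m => (hj m).1) (fun m => (hj m).2)
    have h1 := hasSum_antidiagonal_cons hs
    -- Once the index of `β` and the first chain index are grouped by their sum, the inner sum is
    -- the convolution in Bailey's lemma. What remains has the same form, with a shorter chain and a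
    -- new pair.
    have e : ∀ x : ℕ × (Fin n → ℕ), ∑ p ∈ Finset.HasAntidiagonal.antidiagonal x.1,
        rising (b (j₀ + 1)) p.1 * rising (c (j₀ + 1)) p.1 * β p.1 *
          chainTerm a b c (n + 1) j₀ p.1 (Fin.cons p.2 x.2) =
        rising (b (j₀ + 1 + 1)) x.1 * rising (c (j₀ + 1 + 1)) x.1 *
        ((∑ p ∈ Finset.HasAntidiagonal.antidiagonal x.1,
          rising (b (j₀ + 1)) p.1 * rising (c (j₀ + 1)) p.1 * β p.1 *
          (rising (1 + a - b (j₀ + 1) - c (j₀ + 1)) p.2 / p.2.factorial)) /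
          (rising (1 + a - b (j₀ + 1)) x.1 * rising (1 + a - c (j₀ + 1)) x.1)) *
        chainTerm a b c n (j₀ + 1) x.1 x.2 := by
      intro x
      rw [Finset.sum_div, Finset.mul_sum, Finset.sum_mul]
      refine Finset.sum_congr rfl fun p hp => ?_
      have hp' : p.1 + p.2 = x.1 := by simpa using hp
      rw [chainTerm_cons, multisumFactor_eq, hp', div_mul_div_comm]
      ring
    simp only [e] at h1
    obtain ⟨β', hβ, hsum⟩ := ih (j₀ := j₀ + 1) hB
      (fun j hj => hbc j (by simp only [Finset.mem_Icc] at hj ⊢; omega)) h1.summable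
    refine ⟨β', ?_, ?_⟩
    · refine Eq.mp ?_ hβ
      congr 1
      funext r
      rw [← Finset.mul_prod_Ioc_eq_prod_Icc (a := j₀ + 1) (b := j₀ + (n + 1)) (by omega),
        show j₀ + 1 + n = j₀ + (n + 1) by ring]
      have : Finset.Icc (j₀ + 1 + 1) (j₀ + (n + 1)) = Finset.Ioc (j₀ + 1) (j₀ + (n + 1)) := by
        ext i; simp only [Finset.mem_Icc, Finset.mem_Ioc]; omega
      rw [this, baileyFactor]
      ring
    · rw [h1.tsum_eq] at hsum
      rw [show j₀ + (n + 1) + 1 = j₀ + 1 + n + 1 by ring]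
      exact hsum

/-! ### The limit `n → ∞` of Bailey's lemma. -/

lemma rpow_le_two_rpow_mul_rpow {x y : ℝ} (hx : 0 < x) (hxy : x ≤ y) (hyx : y ≤ 2 * x) (l : ℝ) :
    y ^ l ≤ 2 ^ |l| * x ^ l ∧ x ^ l ≤ 2 ^ |l| * y ^ l := by
  have hy : 0 < y := hx.trans_le hxy
  have h1 : (1 : ℝ) ≤ 2 ^ |l| := Real.one_le_rpow (by norm_num) (abs_nonneg _)
  rcases le_or_gt 0 l with hl | hl
  · refine ⟨?_, ?_⟩
    · rw [abs_of_nonneg hl, ← Real.mul_rpow (by norm_num) hx.le]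
      exact Real.rpow_le_rpow hy.le hyx hl
    · exact (Real.rpow_le_rpow hx.le hxy hl).trans (le_mul_of_one_le_left (by positivity) h1)
  · refine ⟨?_, ?_⟩
    · exact (Real.rpow_le_rpow_of_nonpos hx hxy hl.le).trans
        (le_mul_of_one_le_left (by positivity) h1)
    · rw [abs_of_neg hl]
      have h2 : (2 * x) ^ l ≤ y ^ l := Real.rpow_le_rpow_of_nonpos hy hyx hl.le
      rw [Real.mul_rpow (by norm_num) hx.le] at h2
      have h3 : (2 : ℝ) ^ (-l) * 2 ^ l = 1 := by rw [← Real.rpow_add (by norm_num)]; simp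
      calc x ^ l = 2 ^ (-l) * (2 ^ l * x ^ l) := by rw [← mul_assoc, h3, one_mul]
        _ ≤ _ := by gcongr

lemma rising_mul_baileyKernel_eq (a ρ₁ ρ₂ : ℂ) (r i : ℕ) :
    rising ρ₁ (r + i) * rising ρ₂ (r + i) * baileyKernel a (r + i) r =
      rising ρ₁ r * rising ρ₂ r * gaussTerm (ρ₁ + r) (ρ₂ + r) (1 + a + r + r) i := by
  rw [rising_add, rising_add, baileyKernel, gaussTerm, Nat.add_sub_cancel_left,
    show 1 + a + ((r + i : ℕ) : ℂ) + r = 1 + a + r + r + i by push_cast; ring]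
  ring

/-- With `U = Re (1 + a - ρ₁ - ρ₂)`, the norms are dominated by `r!²` times the Gauss terms with
real parameters `r + 1`, `r + 1`, `2 + U + 2r`. Their sum `Γ(U) / Γ(1 + U + r)²` shows the power
`-2U`, uniformly in `r`. -/
lemma exists_tsum_norm_rising_mul_baileyKernel_le {a ρ₁ ρ₂ : ℂ} (hu : 0 < (1 + a - ρ₁ - ρ₂).re) :
    ∃ C : ℝ, 0 < C ∧ ∀ r : ℕ,
      ∑' i, ‖rising ρ₁ (r + i) * rising ρ₂ (r + i) * baileyKernel a (r + i) r‖ ≤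
        C * ((r : ℝ) + 1) ^ (-(2 * (1 + a - ρ₁ - ρ₂).re)) := by
  set U := (1 + a - ρ₁ - ρ₂).re with hU
  obtain ⟨C₁, hC₁, h1⟩ := exists_norm_rising_le ‖ρ₁‖
  obtain ⟨C₂, hC₂, h2⟩ := exists_norm_rising_le ‖ρ₂‖
  obtain ⟨C₃, hC₃, h3⟩ := exists_norm_rGamma_add_le ‖1 + a‖
  obtain ⟨C₄, hC₄, h4⟩ := exists_rpow_neg_le_norm_rGamma (l := 1 + U) (by linarith)
  obtain ⟨C₅, hC₅, h5⟩ := exists_norm_rGamma_add_le ‖((1 + U : ℝ) : ℂ)‖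
  set D := C₁ * C₂ * C₃ * 2 ^ |-a.re| * 2 ^ |-(1 + U)| * C₄ with hD
  have hDpos : 0 < D := by positivity
  have key : ∀ r i : ℕ, ‖rising ρ₁ (r + i) * rising ρ₂ (r + i) * baileyKernel a (r + i) r‖ ≤
      D * r.factorial ^ 2 *
        ‖gaussTerm ((r + 1 : ℝ) : ℂ) ((r + 1 : ℝ) : ℂ) ((2 + U + r + r : ℝ) : ℂ) i‖ := by
    intro r i
    have hx : (0 : ℝ) < ((r + i : ℕ) : ℝ) + 1 := by positivity
    have hr0 : (0 : ℝ) ≤ (r : ℝ) := by positivity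
    have hi0 : (0 : ℝ) ≤ (i : ℝ) := by positivity
    have hxy : ((r + i : ℕ) : ℝ) + 1 ≤ ((r + i + r : ℕ) : ℝ) + 1 := by push_cast; linarith
    have hyx : ((r + i + r : ℕ) : ℝ) + 1 ≤ 2 * (((r + i : ℕ) : ℝ) + 1) := by push_cast; linarith
    have b1 := h1 ρ₁ le_rfl (r + i)
    have b2 := h2 ρ₂ le_rfl (r + i)
    have b3 := h3 (1 + a) le_rfl (r + i + r)
    have b4 := h4 (r + i + r)
    have r1 := (rpow_le_two_rpow_mul_rpow hx hxy hyx (-a.re)).1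
    have r2 := (rpow_le_two_rpow_mul_rpow hx hxy hyx (-(1 + U))).2
    have e1 : (1 : ℝ) - (1 + a).re = -a.re := by simp
    rw [e1] at b3
    set X : ℝ := ((r + i : ℕ) : ℝ) + 1
    set Y : ℝ := ((r + i + r : ℕ) : ℝ) + 1
    have hY : 0 < Y := hx.trans_le hxy
    have hpow : X ^ (ρ₁.re - 1) * X ^ (ρ₂.re - 1) * X ^ (-a.re) = X ^ (-(1 + U)) := by
      rw [← Real.rpow_add hx, ← Real.rpow_add hx, hU]
      congr 1
      simp only [Complex.sub_re, Complex.add_re, Complex.one_re]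
      ring
    have e2 : ((r + i).factorial : ℝ) = r.factorial * ‖rising ((r + 1 : ℝ) : ℂ) i‖ := by
      have := congrArg norm (factorial_add_eq_mul_rising r i)
      rw [norm_mul, Complex.norm_natCast, Complex.norm_natCast] at this
      rw [this]; push_cast; rfl
    rw [gaussTerm, norm_mul, norm_mul, baileyKernel, norm_div, norm_mul, norm_div, norm_mul,
      Complex.norm_natCast, Complex.norm_natCast, Nat.add_sub_cancel_left,
      show 1 + a + ((r + i : ℕ) : ℂ) + r = 1 + a + (r + i + r : ℕ) by push_cast; ring,
      show ((2 + U + r + r : ℝ) : ℂ) + i = ((1 + (1 + U) : ℝ) : ℂ) + (r + i + r : ℕ) by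
        push_cast; ring]
    set f : ℝ := ((r + i).factorial : ℝ)
    have hf0 : 0 ≤ f := by positivity
    set g : ℝ := ((r + i + r).factorial : ℝ) with hg
    have hg0 : 0 < g := by positivity
    set G := ‖rGamma (((1 + (1 + U) : ℝ) : ℂ) + (r + i + r : ℕ))‖
    calc _ ≤ C₁ * (f * X ^ (ρ₁.re - 1)) * (C₂ * (f * X ^ (ρ₂.re - 1))) *
          (C₃ * (2 ^ |-a.re| * X ^ (-a.re) / g) / i.factorial) := by
          gcongr
          refine b3.trans ?_
          gcongr
      _ = C₁ * C₂ * C₃ * 2 ^ |-a.re| * f ^ 2 / (g * i.factorial) *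
          (X ^ (ρ₁.re - 1) * X ^ (ρ₂.re - 1) * X ^ (-a.re)) := by field_simp
      _ ≤ C₁ * C₂ * C₃ * 2 ^ |-a.re| * f ^ 2 / (g * i.factorial) *
          (2 ^ |-(1 + U)| * (C₄ * (g * G))) := by
          rw [hpow]
          gcongr
          exact r2.trans (by gcongr)
      _ = _ := by
          rw [e2, hD]
          field_simp
  refine ⟨D * (‖Complex.Gamma U‖ * C₅ ^ 2), ?_, fun r => ?_⟩
  · have : 0 < ‖Complex.Gamma U‖ :=
      norm_pos_iff.2 (Complex.Gamma_ne_zero_of_re_pos (by simpa using hu))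
    positivity
  have hr : (0 : ℝ) < (r : ℝ) + 1 := by positivity
  have hs := (hasSum_norm_gaussTerm (b := r + 1) (c := r + 1) (d := 2 + U + r + r) hr hr
    (by positivity) (by linarith)).mul_left (D * r.factorial ^ 2)
  refine ((Summable.of_nonneg_of_le (fun _ => norm_nonneg _) (key r) hs.summable).tsum_le_tsum
    (key r) hs.summable).trans ?_
  rw [hs.tsum_eq]
  have b5 := h5 (1 + U : ℝ) le_rfl r
  rw [Complex.ofReal_re, show (1 : ℝ) - (1 + U) = -U by ring] at b5
  rw [show 2 + U + (r : ℝ) + r - (r + 1) - (r + 1) = U by ring,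
    show ((2 + U + (r : ℝ) + r - (r + 1) : ℝ) : ℂ) = ((1 + U : ℝ) : ℂ) + r by push_cast; ring,
    norm_mul, norm_mul]
  have hf : (0 : ℝ) < r.factorial := by positivity
  calc _ ≤ D * r.factorial ^ 2 * (‖Complex.Gamma U‖ * (C₅ * (((r : ℝ) + 1) ^ (-U) / r.factorial)) *
        (C₅ * (((r : ℝ) + 1) ^ (-U) / r.factorial))) := by gcongr
    _ = D * (‖Complex.Gamma U‖ * C₅ ^ 2) * (((r : ℝ) + 1) ^ (-U) * ((r : ℝ) + 1) ^ (-U)) := by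
        field_simp
    _ = _ := by
        rw [← Real.rpow_add hr]
        ring_nf

/-- The limiting case `n → ∞` of Bailey's lemma. -/
theorem IsBaileyPair.tsum_eq {a ρ₁ ρ₂ : ℂ} {α β : ℕ → ℂ} (h : IsBaileyPair a α β)
    (h₁ : ∀ m : ℕ, 1 + a - ρ₁ ≠ -(m : ℂ)) (h₂ : ∀ m : ℕ, 1 + a - ρ₂ ≠ -(m : ℂ))
    (hu : 0 < (1 + a - ρ₁ - ρ₂).re) {l : ℝ} (hα : HasDecay l α)
    (hl : 1 < l + 2 * (1 + a - ρ₁ - ρ₂).re) :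
    HasSum (fun n => rising ρ₁ n * rising ρ₂ n * β n)
      (Complex.Gamma (1 + a - ρ₁ - ρ₂) * rGamma (1 + a - ρ₁) * rGamma (1 + a - ρ₂) *
        ∑' r, baileyFactor a ρ₁ ρ₂ r * α r) := by
  obtain ⟨C, hC, hα⟩ := hα
  obtain ⟨D, hD, hK⟩ := exists_tsum_norm_rising_mul_baileyKernel_le hu
  have hre : ∀ r : ℕ, 0 < (1 + a + r + r - (ρ₁ + r) - (ρ₂ + r)).re := fun r => by
    rw [show 1 + a + r + r - (ρ₁ + r) - (ρ₂ + r) = 1 + a - ρ₁ - ρ₂ by ring]; exact hu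
  have hs : ∀ r : ℕ, Summable fun i =>
      rising ρ₁ (r + i) * rising ρ₂ (r + i) * baileyKernel a (r + i) r := fun r => by
    simp only [rising_mul_baileyKernel_eq]
    exact (summable_gaussTerm (hre r)).mul_left _
  -- The double family over `(r, i)` with `n = r + i` is absolutely summable. Summing over `i` first
  -- gives Gauss's theorem, grouping by `n` gives `β`.
  have hsum : Summable fun x : ℕ × ℕ =>
      α x.1 * (rising ρ₁ (x.1 + x.2) * rising ρ₂ (x.1 + x.2) * baileyKernel a (x.1 + x.2) x.1) := by
    refine Summable.of_norm ?_
    rw [summable_prod_of_nonneg (fun _ => norm_nonneg _)]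
    simp only [norm_mul (α _)]
    refine ⟨fun r => (hs r).norm.mul_left _, ?_⟩
    simp only [tsum_mul_left]
    refine Summable.of_nonneg_of_le
      (fun r => mul_nonneg (norm_nonneg _) (tsum_nonneg fun _ => norm_nonneg _)) (fun r => ?_)
      ((summable_nat_add_one_rpow (x := -l + -(2 * (1 + a - ρ₁ - ρ₂).re)) (by linarith)).mul_left
        (C * D))
    have hr : (0 : ℝ) < (r : ℝ) + 1 := by positivity
    rw [Real.rpow_add hr]
    refine (mul_le_mul (hα r) (hK r) (tsum_nonneg fun _ => norm_nonneg _) (by positivity)).trans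
      (le_of_eq (by ring))
  have hval : ∑' x : ℕ × ℕ,
      α x.1 * (rising ρ₁ (x.1 + x.2) * rising ρ₂ (x.1 + x.2) * baileyKernel a (x.1 + x.2) x.1) =
      Complex.Gamma (1 + a - ρ₁ - ρ₂) * rGamma (1 + a - ρ₁) * rGamma (1 + a - ρ₂) *
        ∑' r, baileyFactor a ρ₁ ρ₂ r * α r := by
    rw [hsum.tsum_prod, ← tsum_mul_left]
    refine tsum_congr fun r => ?_
    simp only [rising_mul_baileyKernel_eq]
    rw [tsum_mul_left, tsum_mul_left, tsum_gaussTerm (hre r),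
      show 1 + a + r + r - (ρ₁ + r) - (ρ₂ + r) = 1 + a - ρ₁ - ρ₂ by ring,
      show 1 + a + r + r - (ρ₁ + r) = 1 + a - ρ₁ + r by ring,
      show 1 + a + r + r - (ρ₂ + r) = 1 + a - ρ₂ + r by ring,
      rGamma_eq_rising_mul (1 + a - ρ₁) r, rGamma_eq_rising_mul (1 + a - ρ₂) r, baileyFactor]
    have k1 := rising_ne_zero h₁ r
    have k2 := rising_ne_zero h₂ r
    field_simp
  rw [← hval]
  have h1 := Finset.HasAntidiagonal.sigmaAntidiagonalEquivProd.hasSum_iff.2 hsum.hasSum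
  refine h1.sigma fun n => ?_
  have h3 := hasSum_fintype (fun p : Finset.HasAntidiagonal.antidiagonal n =>
    α p.1.1 * (rising ρ₁ (p.1.1 + p.1.2) * rising ρ₂ (p.1.1 + p.1.2) *
      baileyKernel a (p.1.1 + p.1.2) p.1.1))
  rw [Finset.sum_coe_sort (Finset.HasAntidiagonal.antidiagonal n)
      (fun p => α p.1 * (rising ρ₁ (p.1 + p.2) * rising ρ₂ (p.1 + p.2) *
        baileyKernel a (p.1 + p.2) p.1)),
    Finset.Nat.sum_antidiagonal_eq_sum_range_succ_mk] at h3
  have e : ∑ k ∈ Finset.range n.succ, α k * (rising ρ₁ (k + (n - k)) * rising ρ₂ (k + (n - k)) *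
        baileyKernel a (k + (n - k)) k) = rising ρ₁ n * rising ρ₂ n * β n := by
    rw [h n, Finset.mul_sum]
    refine Finset.sum_congr rfl fun k hk => ?_
    have hk' : k ≤ n := by simpa [Nat.lt_succ_iff] using hk
    rw [Nat.add_sub_of_le hk']
    ring
  simp only [] at h3
  rw [e] at h3
  exact h3

/-! ### Decay of the well-poised terms, and the transformation of the multiple sum. -/

lemma HasDecay.summable {l : ℝ} {f : ℕ → ℂ} (hf : HasDecay l f) (hl : 1 < l) : Summable f := by
  obtain ⟨C, -, h⟩ := hf
  exact Summable.of_norm_bounded ((summable_nat_add_one_rpow (by linarith)).mul_left C) h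

lemma hasDecay_wellPoised (a : ℂ) : HasDecay (-a.re) (wellPoised a) := by
  obtain ⟨C, hC, h⟩ := exists_norm_rising_div_factorial_le a
  -- For `a = 0` the division by zero gives `0`; the summand `1` keeps the constant positive in that
  -- case.
  refine ⟨C * ((‖a‖ + 2) / ‖a‖ + 1), by positivity, fun k => ?_⟩
  have hk : (0 : ℝ) < (k : ℝ) + 1 := by positivity
  have hk0 : (0 : ℝ) ≤ (k : ℝ) := by positivity
  have e : wellPoised a k = rising a k / k.factorial * ((a + 2 * k) / a) := by
    rw [wellPoised, div_mul_div_comm, mul_comm (k.factorial : ℂ)]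
  have h1 : ‖(a + 2 * k) / a‖ ≤ ((‖a‖ + 2) / ‖a‖ + 1) * ((k : ℝ) + 1) := by
    rw [norm_div]
    have h2 : ‖a + 2 * k‖ ≤ (‖a‖ + 2) * ((k : ℝ) + 1) := by
      refine (norm_add_le _ _).trans ?_
      rw [norm_mul, Complex.norm_natCast, Complex.norm_ofNat]
      nlinarith [norm_nonneg a]
    calc ‖a + 2 * k‖ / ‖a‖ ≤ (‖a‖ + 2) * ((k : ℝ) + 1) / ‖a‖ := by gcongr
      _ = (‖a‖ + 2) / ‖a‖ * ((k : ℝ) + 1) := by ring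
      _ ≤ _ := by gcongr; linarith
  rw [e, norm_mul, neg_neg]
  calc _ ≤ C * ((k : ℝ) + 1) ^ (a.re - 1) * (((‖a‖ + 2) / ‖a‖ + 1) * ((k : ℝ) + 1)) := by
        gcongr; exact h k
    _ = C * ((‖a‖ + 2) / ‖a‖ + 1) * (((k : ℝ) + 1) ^ (a.re - 1) * ((k : ℝ) + 1) ^ (1 : ℝ)) := by
        rw [Real.rpow_one]; ring
    _ = _ := by rw [← Real.rpow_add hk]; ring_nf

lemma hasDecay_neg_one_pow : HasDecay 0 (fun r => (-1) ^ r) :=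
  ⟨1, one_pos, fun k => by simp⟩

lemma hasDecay_baileyFactor {a b c : ℂ} (hb : ∀ m : ℕ, 1 + a - b ≠ -(m : ℂ))
    (hc : ∀ m : ℕ, 1 + a - c ≠ -(m : ℂ)) :
    HasDecay (2 * (1 + a - b - c).re) (baileyFactor a b c) := by
  have h := (hasDecay_rising_div_rising b hb).mul (hasDecay_rising_div_rising c hc)
  have e : (1 + a - b - b).re + (1 + a - c - c).re = 2 * (1 + a - b - c).re := by
    simp only [Complex.sub_re, Complex.add_re, Complex.one_re]; ring
  rw [e] at h
  refine Eq.mp ?_ h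
  congr 1
  funext k
  rw [baileyFactor, div_mul_div_comm]

lemma hasDecay_prod_baileyFactor {a : ℂ} {b c : ℕ → ℂ} (s : Finset ℕ)
    (h : ∀ j ∈ s, ∀ m : ℕ, 1 + a - b j ≠ -(m : ℂ) ∧ 1 + a - c j ≠ -(m : ℂ)) :
    HasDecay (2 * ∑ j ∈ s, (1 + a - b j - c j).re) (fun r => ∏ j ∈ s, baileyFactor a (b j) (c j) r) := by
  induction s using Finset.induction_on with
  | empty => simpa using (isSymbol_const 1).hasDecay
  | insert i s hi ih =>
    simp only [Finset.prod_insert hi, Finset.sum_insert hi, mul_add]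
    exact (hasDecay_baileyFactor (fun m => (h i (Finset.mem_insert_self _ _) m).1)
      (fun m => (h i (Finset.mem_insert_self _ _) m).2)).mul
      (ih fun j hj => h j (Finset.mem_insert_of_mem hj))

/-- The multiple sum attached to a Bailey pair `(α, β)` in terms of `α`. -/
theorem IsBaileyPair.tsum_chain_eq {a : ℂ} {b c : ℕ → ℂ} {n : ℕ} {α β : ℕ → ℂ}
    (h : IsBaileyPair a α β)
    (hbc : ∀ j ∈ Finset.Icc 1 (n + 1), ∀ m : ℕ, 1 + a - b j ≠ -(m : ℂ) ∧ 1 + a - c j ≠ -(m : ℂ))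
    (hs : Summable fun x : ℕ × (Fin n → ℕ) =>
      rising (b 1) x.1 * rising (c 1) x.1 * β x.1 * chainTerm a b c n 0 x.1 x.2)
    (hu : 0 < (1 + a - b (n + 1) - c (n + 1)).re) {l : ℝ} (hα : HasDecay l α)
    (hl : 1 < l + 2 * ∑ j ∈ Finset.Icc 1 (n + 1), (1 + a - b j - c j).re) :
    ∑' x : ℕ × (Fin n → ℕ),
      rising (b 1) x.1 * rising (c 1) x.1 * β x.1 * chainTerm a b c n 0 x.1 x.2 =
      Complex.Gamma (1 + a - b (n + 1) - c (n + 1)) * rGamma (1 + a - b (n + 1)) *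
        rGamma (1 + a - c (n + 1)) *
        ∑' r, (∏ j ∈ Finset.Icc 1 (n + 1), baileyFactor a (b j) (c j) r) * α r := by
  have hbc' : ∀ j ∈ Finset.Icc 1 n, ∀ m : ℕ, 1 + a - b j ≠ -(m : ℂ) ∧ 1 + a - c j ≠ -(m : ℂ) :=
    fun j hj => hbc j (by simp only [Finset.mem_Icc] at hj ⊢; omega)
  have hlast := hbc (n + 1) (by simp)
  -- The first `n` parameter pairs are absorbed by the chain, the last one by the limit `n → ∞`.
  obtain ⟨β', hβ', hsum⟩ := h.exists_hasSum_chain (j₀ := 0) (by simpa using hbc') hs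
  simp only [zero_add] at hβ' hsum
  have hsplit : ∀ f : ℕ → ℝ, ∑ j ∈ Finset.Icc 1 (n + 1), f j = ∑ j ∈ Finset.Icc 1 n, f j + f (n + 1) :=
    fun f => Finset.sum_Icc_succ_top (by omega) f
  rw [hsplit] at hl
  have h1 := hβ'.tsum_eq (fun m => (hlast m).1) (fun m => (hlast m).2) hu
    ((hasDecay_prod_baileyFactor _ hbc').mul hα) (by linarith)
  rw [hsum.unique h1]
  congr 1
  refine tsum_congr fun r => ?_
  rw [Finset.prod_Icc_succ_top (by omega)]
  ring

/-! ### Hypergeometric terms as products of Bailey factors. -/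

lemma rising_half_add_one_div {a : ℂ} (ha : ∀ m : ℕ, a / 2 ≠ -(m : ℂ)) (k : ℕ) :
    rising (a / 2 + 1) k / rising (a / 2) k = (a + 2 * k) / a := by
  have h1 := rising_mul_add (a / 2) k
  have h2 := rising_ne_zero ha k
  have h3 : a ≠ 0 := by rintro rfl; exact ha 0 (by simp)
  rw [div_eq_div_iff h2 h3]
  linear_combination -2 * h1

lemma prod_map_flatMap_range (f : ℂ → ℂ) (b c : ℕ → ℂ) (n : ℕ) :
    (((List.range n).flatMap fun j => [b (j + 1), c (j + 1)]).map f).prod =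
      ∏ j ∈ Finset.Icc 1 n, (f (b j) * f (c j)) := by
  induction n with
  | zero => simp
  | succ n ih =>
    rw [List.range_succ, List.flatMap_append, List.map_append, List.prod_append, ih,
      Finset.prod_Icc_succ_top (by omega)]
    simp

lemma hypergeometricTerm_even {s : ℕ} {a : ℂ} {b c : ℕ → ℂ} (ha : ∀ m : ℕ, a / 2 ≠ -(m : ℂ)) (k : ℕ) :
    hypergeometricTerm (upperEven s a b c) (lowerEven s a b c) (-1) k =
      (∏ j ∈ Finset.Icc 1 (s + 1), baileyFactor a (b j) (c j) k) * ((-1) ^ k * wellPoised a k) := by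
  have h1 := rising_half_add_one_div ha k
  simp only [hypergeometricTerm, upperEven, lowerEven, List.map_cons, List.prod_cons, baileyFactor]
  rw [prod_map_flatMap_range, prod_map_flatMap_range (b := fun j => 1 + a - b j)
    (c := fun j => 1 + a - c j)]
  simp only [Finset.prod_div_distrib, ← show ∀ x, rising x k = (ascPochhammer ℂ k).eval x from
    fun _ => rfl]
  rw [wellPoised, show rising a k * (a + 2 * k) / (a * k.factorial) =
    rising a k / k.factorial * ((a + 2 * k) / a) by rw [div_mul_div_comm, mul_comm a], ← h1]
  rw [div_mul_div_comm]
  ring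

lemma hypergeometricTerm_odd {s : ℕ} {a : ℂ} {b c : ℕ → ℂ} (ha : ∀ m : ℕ, a / 2 ≠ -(m : ℂ)) (k : ℕ) :
    hypergeometricTerm (upperOdd s a b c) (lowerOdd s a b c) 1 k =
      (∏ j ∈ Finset.Icc 1 s, baileyFactor a (b j) (c j) k) *
        (rising (c 0) k / rising (1 + a - c 0) k * wellPoised a k) := by
  have h1 := rising_half_add_one_div ha k
  simp only [hypergeometricTerm, upperOdd, lowerOdd, List.map_cons, List.prod_cons, baileyFactor]
  rw [prod_map_flatMap_range, prod_map_flatMap_range (b := fun j => 1 + a - b j)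
    (c := fun j => 1 + a - c j)]
  simp only [Finset.prod_div_distrib, ← show ∀ x, rising x k = (ascPochhammer ℂ k).eval x from
    fun _ => rfl]
  rw [wellPoised, show rising a k * (a + 2 * k) / (a * k.factorial) =
    rising a k / k.factorial * ((a + 2 * k) / a) by rw [div_mul_div_comm, mul_comm a], ← h1]
  rw [div_mul_div_comm, one_pow]
  ring

lemma gammaQuotient_eq (a b c : ℂ) : gammaQuotient a b c =
    Complex.Gamma (1 + a - b) * Complex.Gamma (1 + a - c) * (rGamma (1 + a) * rGamma (1 + a - b - c)) := by
  rw [gammaQuotient, rGamma, rGamma, div_eq_mul_inv, mul_inv]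

/-! ### From the hypotheses on real parts to positive exponents. -/

/-- Lower bound for the exponents when `p j = max (U j) ε`. -/
lemma le_decayExp {U : ℕ → ℝ} {ε : ℝ} (hε : 0 < ε) (i j : ℕ) :
    U (i + j + 1) + ∑ l ∈ Finset.Icc (j + 1) (i + j), (if 0 ≤ U l then 1 else 2 : ℕ) * U l - i * ε ≤
      decayExp U (fun l => max (U l) ε) i j := by
  induction i generalizing j with
  | zero => simp [decayExp]
  | succ i ih =>
    have h := ih (j + 1)
    rw [decayExp, ← Finset.add_sum_Ioc_eq_sum_Icc (a := j + 1) (b := i + 1 + j) (by omega)]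
    have e : Finset.Ioc (j + 1) (i + 1 + j) = Finset.Icc (j + 1 + 1) (i + (j + 1)) := by
      ext l; simp only [Finset.mem_Icc, Finset.mem_Ioc]; omega
    rw [e, show i + 1 + j + 1 = i + (j + 1) + 1 by ring]
    -- Here the coefficients `1` and `2` originate: `2U - max U ε` is at least `U - ε` for `U ≥ 0`
    -- and equals `2U - ε` for `U < 0`. This choice also minimizes `A U` over `A ∈ {1, 2}`.
    have h2 : ((if 0 ≤ U (j + 1) then 1 else 2 : ℕ) : ℝ) * U (j + 1) - ε ≤
        2 * U (j + 1) - max (U (j + 1)) ε := by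
      split_ifs with hU
      · rcases le_total (U (j + 1)) ε with h3 | h3
        · rw [max_eq_right h3]; push_cast; linarith
        · rw [max_eq_left h3]; push_cast; linarith
      · rw [max_eq_right (by linarith)]; push_cast; linarith
    push_cast at h2 h ⊢
    linarith

/-- There are finitely many strict inequalities, so a small `ε` does not destroy them. The extra
bound `w` leaves room for one further condition on `ε`. -/
lemma exists_pos_forall_decayExp_pos {U : ℕ → ℝ} {N : ℕ}
    (H : ∀ r ∈ Finset.Icc 2 N, ∀ A : ℕ → ℕ, (∀ j, A j = 1 ∨ A j = 2) →
      0 < U N + ∑ j ∈ Finset.Icc r (N - 1), A j * U j) {w : ℝ} (hw : 0 < w) :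
    ∃ ε : ℝ, 0 < ε ∧ N * ε < w ∧
      ∀ i j, i + j + 1 = N → 1 ≤ j → 0 < decayExp U (fun l => max (U l) ε) i j := by
  set V : ℕ → ℝ := fun r =>
    U N + ∑ j ∈ Finset.Icc r (N - 1), ((if 0 ≤ U j then 1 else 2 : ℕ) : ℝ) * U j with hV
  have hVpos : ∀ r ∈ Finset.Icc 2 N, 0 < V r := fun r hr =>
    H r hr _ fun j => by split_ifs <;> simp
  obtain ⟨δ, hδ, hδV⟩ : ∃ δ : ℝ, 0 < δ ∧ ∀ r ∈ Finset.Icc 2 N, δ ≤ V r := by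
    rcases (Finset.Icc 2 N).eq_empty_or_nonempty with h | h
    · exact ⟨1, one_pos, by simp [h]⟩
    · obtain ⟨r, hr, hmin⟩ := Finset.exists_min_image _ V h
      exact ⟨V r, hVpos r hr, hmin⟩
  have hN : (0 : ℝ) < (N : ℝ) + 1 := by positivity
  set ε : ℝ := min δ w / (N + 1) with hεdef
  have hm : 0 < min δ w := lt_min hδ hw
  have hε : 0 < ε := by positivity
  have hNε : N * ε < min δ w := by
    have : ((N : ℝ) + 1) * ε = min δ w := by rw [hεdef]; field_simp
    linarith
  refine ⟨ε, hε, hNε.trans_le (min_le_right _ _), fun i j hij hj => ?_⟩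
  refine lt_of_lt_of_le ?_ (le_decayExp hε i j)
  have h1 := hδV (j + 1) (by simp only [Finset.mem_Icc]; omega)
  simp only [hV] at h1
  rw [show N - 1 = i + j by omega, ← hij] at h1
  have h2 : (i : ℝ) * ε ≤ N * ε := by
    gcongr; omega
  have h3 := min_le_left δ w
  linarith

lemma multisumTermEven_eq (s : ℕ) (a : ℂ) (b c : ℕ → ℂ) :
    multisumTermEven s a b c = chainTerm a b c s 0 0 := by
  funext k
  simp [multisumTermEven, chainTerm]

lemma multisumTermOdd_eq (s : ℕ) (a : ℂ) (b c : ℕ → ℂ) (k₁ : ℕ) (k : Fin (s - 1) → ℕ) :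
    multisumTermOdd s a b c k₁ k = rising (b 1) k₁ * rising (c 1) k₁ /
      (k₁.factorial * rising (1 + a - c 0) k₁) * chainTerm a b c (s - 1) 0 k₁ k := by
  simp [multisumTermOdd, chainTerm, rising]

lemma re_sum_natCast_mul (s : Finset ℕ) (A : ℕ → ℕ) (f : ℕ → ℂ) :
    (∑ j ∈ s, (A j : ℂ) * f j).re = ∑ j ∈ s, (A j : ℝ) * (f j).re := by
  rw [Complex.re_sum]
  exact Finset.sum_congr rfl fun j _ => by simp

lemma sum_re_eq (a : ℂ) (b c : ℕ → ℂ) (n : ℕ) :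
    2 * ∑ j ∈ Finset.Icc 1 n, (1 + a - b j - c j).re =
      (2 * (n : ℂ) * (a + 1) - 2 * ∑ j ∈ Finset.Icc 1 n, (b j + c j)).re := by
  induction n with
  | zero => simp
  | succ n ih =>
    rw [Finset.sum_Icc_succ_top (by omega), Finset.sum_Icc_succ_top (by omega), mul_add, ih]
    rw [show (2 * ((n + 1 : ℕ) : ℂ) * (a + 1) - 2 * (∑ j ∈ Finset.Icc 1 n, (b j + c j) +
        (b (n + 1) + c (n + 1)))) = (2 * (n : ℂ) * (a + 1) - 2 * ∑ j ∈ Finset.Icc 1 n, (b j + c j)) +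
        2 * (1 + a - b (n + 1) - c (n + 1)) by push_cast; ring, Complex.add_re]
    simp

/-! ### The series of argument `-1`. -/

/-- The identity between the very-well-poised series of argument `-1` and the multiple sum. -/
theorem hypergeometric_even_eq_multisum (s : ℕ) (a : ℂ) (b c : ℕ → ℂ) (hs : 1 ≤ s)
    (ha : ∀ m : ℕ, a / 2 ≠ -(m : ℂ))
    (hbc : ∀ j ∈ Finset.Icc 1 (s + 1), ∀ m : ℕ,
      1 + a - b j ≠ -(m : ℂ) ∧ 1 + a - c j ≠ -(m : ℂ))
    (h₁ : 0 < ((2 * (s : ℂ) + 1) * (a + 1) - 2 * ∑ j ∈ Finset.Icc 1 (s + 1), (b j + c j)).re)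
    (h₂ : ∀ r ∈ Finset.Icc 2 (s + 1), ∀ A : ℕ → ℕ, (∀ j, A j = 1 ∨ A j = 2) →
      0 < ((1 + a - b (s + 1) - c (s + 1)) +
        ∑ j ∈ Finset.Icc r s, (A j : ℂ) * (1 + a - b j - c j)).re) :
    Summable (hypergeometricTerm (upperEven s a b c) (lowerEven s a b c) (-1)) ∧
    Summable (multisumTermEven s a b c) ∧
    hypergeometricSum (upperEven s a b c) (lowerEven s a b c) (-1) =
      gammaQuotient a (b (s + 1)) (c (s + 1)) * ∑' k : Fin s → ℕ, multisumTermEven s a b c k := by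
  have ha0 : a ≠ 0 := by rintro rfl; exact ha 0 (by simp)
  set U : ℕ → ℝ := fun j => (1 + a - b j - c j).re with hU
  have hlast := hbc (s + 1) (by simp)
  have hα : HasDecay (-a.re) (fun r => (-1) ^ r * wellPoised a r) := by
    simpa using hasDecay_neg_one_pow.mul (hasDecay_wellPoised a)
  have hl : 1 < -a.re + 2 * ∑ j ∈ Finset.Icc 1 (s + 1), (1 + a - b j - c j).re := by
    rw [sum_re_eq]
    rw [show (2 * (s : ℂ) + 1) * (a + 1) - 2 * ∑ j ∈ Finset.Icc 1 (s + 1), (b j + c j) =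
      (2 * ((s + 1 : ℕ) : ℂ) * (a + 1) - 2 * ∑ j ∈ Finset.Icc 1 (s + 1), (b j + c j)) - (a + 1) by
        push_cast; ring, Complex.sub_re, Complex.add_re, Complex.one_re] at h₁
    linarith
  have hterm : hypergeometricTerm (upperEven s a b c) (lowerEven s a b c) (-1) =
      fun r => (∏ j ∈ Finset.Icc 1 (s + 1), baileyFactor a (b j) (c j) r) *
        ((-1) ^ r * wellPoised a r) := funext fun r => hypergeometricTerm_even ha r
  obtain ⟨ε, hε, -, hE⟩ := exists_pos_forall_decayExp_pos (U := U) (N := s + 1) (fun r hr A hA => by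
    have h := h₂ r hr A hA
    rw [Complex.add_re, re_sum_natCast_mul] at h
    rw [Nat.add_sub_cancel]
    exact h) one_pos
  have hchain : ∀ K, Summable (chainTerm a b c s 0 K) := by
    obtain ⟨C, -, h⟩ := exists_tsum_norm_chainTerm_le (a := a) (b := b) (c := c) (U := U)
      (p := fun l => max (U l) ε) (fun j => rfl) (fun j => lt_max_of_lt_right hε)
      (fun j => le_max_left _ _) s 0
      (fun j hj => hbc j (by simp only [Finset.mem_Icc] at hj ⊢; omega))
      (fun i j hi hij => hE i j (by omega) (by omega))
    exact fun K => (h K).1.of_norm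
  -- For `r = s + 1` the sum in the hypothesis is empty.
  have hu : 0 < (1 + a - b (s + 1) - c (s + 1)).re := by
    have h := h₂ (s + 1) (by simp only [Finset.mem_Icc]; omega) (fun _ => 1) (fun _ => Or.inl rfl)
    simpa using h
  refine ⟨?_, ?_, ?_⟩
  · rw [hterm]
    exact ((hasDecay_prod_baileyFactor _ hbc).mul hα).summable (by linarith)
  · rw [multisumTermEven_eq]; exact hchain 0
  -- The unit pair forces the initial index to be `0`, so the chain of `s` steps is the `s`-fold sum
  -- itself.
  set F : ℕ × (Fin s → ℕ) → ℂ := fun x => rising (b 1) x.1 * rising (c 1) x.1 *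
    (if x.1 = 0 then rGamma (1 + a) else 0) * chainTerm a b c s 0 x.1 x.2 with hF
  have hsupp : Function.support F ⊆ Set.range (fun k : Fin s → ℕ => ((0 : ℕ), k)) := by
    rintro ⟨K, k⟩ hx
    rcases eq_or_ne K 0 with rfl | hK
    · exact ⟨k, rfl⟩
    · exact absurd (by simp [hF, hK]) hx
  have hinj : Function.Injective (fun k : Fin s → ℕ => ((0 : ℕ), k)) := fun _ _ h => by simpa using h
  have hF0 : ∀ k : Fin s → ℕ, F (0, k) = rGamma (1 + a) * chainTerm a b c s 0 0 k := fun k => by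
    simp [hF]
  have hFs : HasSum F (rGamma (1 + a) * ∑' k, chainTerm a b c s 0 0 k) := by
    rw [← hinj.hasSum_iff (fun x hx => by_contra fun h => hx (hsupp h))]
    refine ((hchain 0).hasSum.mul_left (rGamma (1 + a))).congr_fun ?_
    exact fun k => hF0 k
  have hmain := (isBaileyPair_unit ha0).tsum_chain_eq hbc hFs.summable hu hα hl
  rw [hypergeometricSum, hterm, gammaQuotient_eq, multisumTermEven_eq]
  have hmain' := hFs.tsum_eq.symm.trans hmain
  have k1 := rGamma_ne_zero (fun m => (hlast m).1)
  have k2 := rGamma_ne_zero (fun m => (hlast m).2)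
  have k3 := rGamma_ne_zero (ne_neg_nat_of_re_pos hu)
  have i1 : Complex.Gamma (1 + a - b (s + 1)) = (rGamma (1 + a - b (s + 1)))⁻¹ := by simp [rGamma]
  have i2 : Complex.Gamma (1 + a - c (s + 1)) = (rGamma (1 + a - c (s + 1)))⁻¹ := by simp [rGamma]
  have i3 : Complex.Gamma (1 + a - b (s + 1) - c (s + 1)) =
    (rGamma (1 + a - b (s + 1) - c (s + 1)))⁻¹ := by simp [rGamma]
  rw [i3] at hmain'
  rw [i1, i2]
  field_simp at hmain' ⊢
  linear_combination -hmain'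

/-! ### Analytic continuation in the parameter `c₀`. -/

/-- A series of entire functions whose terms are `O((k + 1) ^ (-1 - t (σ - Re z)))`, uniformly on
bounded sets, defines a holomorphic function on the half-plane `Re z < σ`. -/
lemma differentiableOn_tsum_of_halfPlane_bound {F : ℕ → ℂ → ℂ} {σ t : ℝ} (ht : 0 < t)
    (hF : ∀ k, Differentiable ℂ (F k))
    (hb : ∀ ρ : ℝ, ∃ C : ℝ, 0 < C ∧ ∀ z : ℂ, ‖z‖ ≤ ρ → ∀ k : ℕ,
      ‖F k z‖ ≤ C * ((k : ℝ) + 1) ^ (-1 - t * (σ - z.re))) :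
    DifferentiableOn ℂ (fun z => ∑' k, F k z) {z | z.re < σ} := by
  intro z₀ hz₀
  have hz₀' : z₀.re < σ := hz₀
  set δ := (σ - z₀.re) / 2 with hδ
  have hδpos : 0 < δ := by rw [hδ]; linarith
  obtain ⟨C, hC, h⟩ := hb (‖z₀‖ + δ)
  have hd : DifferentiableOn ℂ (fun z => ∑' k, F k z) (Metric.ball z₀ δ) := by
    refine Complex.differentiableOn_tsum_of_summable_norm
      (u := fun k : ℕ => C * ((k : ℝ) + 1) ^ (-1 - t * δ))
      ((summable_nat_add_one_rpow (by nlinarith)).mul_left C)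
      (fun k => (hF k).differentiableOn) Metric.isOpen_ball (fun k z hz => ?_)
    rw [Metric.mem_ball, dist_eq_norm] at hz
    have h1 : ‖z‖ ≤ ‖z₀‖ + δ := by
      have := norm_add_le z₀ (z - z₀)
      rw [add_sub_cancel] at this
      linarith
    have h2 : δ ≤ σ - z.re := by
      have := (Complex.re_le_norm (z - z₀))
      rw [Complex.sub_re] at this
      rw [hδ] at hz ⊢
      linarith
    refine (h z h1 k).trans ?_
    gcongr
    linarith [(Nat.cast_nonneg k : (0 : ℝ) ≤ k)]
  exact (hd.differentiableAt (Metric.isOpen_ball.mem_nhds (Metric.mem_ball_self hδpos))).differentiableWithinAt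

/-- The identity theorem: agreement on some smaller left half-plane suffices. -/
lemma eqOn_halfPlane {f g : ℂ → ℂ} {σ σ' : ℝ} (hf : DifferentiableOn ℂ f {z | z.re < σ})
    (hg : DifferentiableOn ℂ g {z | z.re < σ}) (h : ∀ z : ℂ, z.re < σ → z.re < σ' → f z = g z)
    {z : ℂ} (hz : z.re < σ) : f z = g z := by
  have hopen : ∀ τ : ℝ, IsOpen {z : ℂ | z.re < τ} := fun τ =>
    isOpen_lt Complex.continuous_re continuous_const
  set z₁ : ℂ := ((min σ σ' - 1 : ℝ) : ℂ) with hz₁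
  have h1 : z₁.re < min σ σ' := by rw [hz₁, Complex.ofReal_re]; linarith
  refine (hf.analyticOnNhd (hopen σ)).eqOn_of_preconnected_of_eventuallyEq (hg.analyticOnNhd (hopen σ))
    (convex_halfSpace_re_lt σ).isPreconnected (z₀ := z₁) (h1.trans_le (min_le_left _ _)) ?_ hz
  filter_upwards [(hopen (min σ σ')).mem_nhds h1] with w hw
  have hw' : w.re < min σ σ' := hw
  exact h w (hw'.trans_le (min_le_left _ _)) (hw'.trans_le (min_le_right _ _))

lemma rGamma_add_eq_div {x : ℂ} (hx : ∀ m : ℕ, x ≠ -(m : ℂ)) (k : ℕ) :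
    rGamma (x + k) = rGamma x / rising x k := by
  rw [eq_div_iff (rising_ne_zero hx k), rGamma_eq_rising_mul x k, mul_comm]

lemma differentiable_rising (k : ℕ) : Differentiable ℂ fun z => rising z k :=
  (ascPochhammer ℂ k).differentiable

/-- The very-well-poised series as a holomorphic function of the parameter `c₀`, after division
by `Γ(1 + a - c₀)`. -/
noncomputable def wellPoisedSeries (a : ℂ) (b c : ℕ → ℂ) (s : ℕ) (z : ℂ) : ℂ :=
  ∑' r, (∏ j ∈ Finset.Icc 1 s, baileyFactor a (b j) (c j) r) * wellPoised a r *
    (rising z r * rGamma (1 + a - z + r))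

/-- The iterated multiple sum as a holomorphic function of the parameter `c₀`, after division by
`Γ(1 + a - c₀)`. -/
noncomputable def multisumSeries (a : ℂ) (b c : ℕ → ℂ) (s : ℕ) (z : ℂ) : ℂ :=
  ∑' k, rising (b 1) k * rising (c 1) k / k.factorial * chainSum a b c (s - 1) 0 k *
    rGamma (1 + a - z + k)

lemma exists_norm_rGamma_sub_add_le (w : ℂ) (ρ : ℝ) : ∃ C : ℝ, 0 < C ∧ ∀ z : ℂ, ‖z‖ ≤ ρ → ∀ k : ℕ,
    ‖rGamma (1 + w - z + k)‖ ≤ C * (((k : ℝ) + 1) ^ (z.re - w.re) / k.factorial) := by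
  obtain ⟨C, hC, h⟩ := exists_norm_rGamma_add_le (‖1 + w‖ + ρ)
  refine ⟨C, hC, fun z hz k => (h (1 + w - z) ((norm_sub_le _ _).trans (by linarith)) k).trans
    (le_of_eq ?_)⟩
  congr 3
  simp only [Complex.sub_re, Complex.add_re, Complex.one_re]
  ring

/-- Both this series and the iterated sum reach exponent `-1` at the same abscissa, with slopes `2`
and `1`; hence both are holomorphic on the same half-plane. -/
lemma exists_norm_wellPoisedSeries_term_le {a : ℂ} {b c : ℕ → ℂ} {s : ℕ}
    (hbc : ∀ j ∈ Finset.Icc 1 s, ∀ m : ℕ, 1 + a - b j ≠ -(m : ℂ) ∧ 1 + a - c j ≠ -(m : ℂ)) (ρ : ℝ) :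
    ∃ C : ℝ, 0 < C ∧ ∀ z : ℂ, ‖z‖ ≤ ρ → ∀ k : ℕ,
      ‖(∏ j ∈ Finset.Icc 1 s, baileyFactor a (b j) (c j) k) * wellPoised a k *
        (rising z k * rGamma (1 + a - z + k))‖ ≤
      C * ((k : ℝ) + 1) ^ (-1 - 2 * (∑ j ∈ Finset.Icc 1 s, (1 + a - b j - c j).re - z.re)) := by
  obtain ⟨C₁, hC₁, h1⟩ := (hasDecay_prod_baileyFactor _ hbc).mul (hasDecay_wellPoised a)
  obtain ⟨C₂, hC₂, h2⟩ := exists_norm_rising_le ρ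
  obtain ⟨C₃, hC₃, h3⟩ := exists_norm_rGamma_sub_add_le a ρ
  refine ⟨C₁ * (C₂ * C₃), by positivity, fun z hz k => ?_⟩
  have hk : (0 : ℝ) < (k : ℝ) + 1 := by positivity
  set S := ∑ j ∈ Finset.Icc 1 s, (1 + a - b j - c j).re
  rw [norm_mul, norm_mul (rising z k)]
  calc _ ≤ C₁ * ((k : ℝ) + 1) ^ (-(2 * S + -a.re)) * (C₂ * (k.factorial * ((k : ℝ) + 1) ^ (z.re - 1)) *
        (C₃ * (((k : ℝ) + 1) ^ (z.re - a.re) / k.factorial))) := by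
        gcongr
        exacts [h1 k, h2 z hz k, h3 z hz k]
    _ = C₁ * (C₂ * C₃) * (((k : ℝ) + 1) ^ (-(2 * S + -a.re)) * ((k : ℝ) + 1) ^ (z.re - 1) *
        ((k : ℝ) + 1) ^ (z.re - a.re)) := by field_simp
    _ = _ := by
        rw [← Real.rpow_add hk, ← Real.rpow_add hk]
        ring_nf

lemma differentiableOn_wellPoisedSeries {a : ℂ} {b c : ℕ → ℂ} {s : ℕ}
    (hbc : ∀ j ∈ Finset.Icc 1 s, ∀ m : ℕ, 1 + a - b j ≠ -(m : ℂ) ∧ 1 + a - c j ≠ -(m : ℂ)) :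
    DifferentiableOn ℂ (wellPoisedSeries a b c s)
      {z | z.re < ∑ j ∈ Finset.Icc 1 s, (1 + a - b j - c j).re} := by
  refine differentiableOn_tsum_of_halfPlane_bound two_pos (fun k => ?_)
    (exists_norm_wellPoisedSeries_term_le hbc)
  refine Differentiable.const_mul ((differentiable_rising k).mul ?_) _
  exact differentiable_rGamma.comp (by fun_prop)

lemma sumExp_eq_sum (U : ℕ → ℝ) (n j : ℕ) : sumExp U n j = ∑ l ∈ Finset.Icc (j + 1) (j + n + 1), U l := by
  induction n generalizing j with
  | zero => simp [sumExp]
  | succ n ih =>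
    rw [sumExp, ih, ← Finset.add_sum_Ioc_eq_sum_Icc (a := j + 1) (b := j + (n + 1) + 1) (by omega),
      add_comm]
    congr 2
    ext l; simp only [Finset.mem_Icc, Finset.mem_Ioc]; omega

/-! ### The identity of argument `1` on a half-plane of `c₀`. -/

section Odd

variable {a : ℂ} {b c : ℕ → ℂ} {s : ℕ} {ε : ℝ}

/-- The hypotheses on the parameters other than `c₀` that are used for the iterated sum. -/
structure OddAdmissible (a : ℂ) (b c : ℕ → ℂ) (s : ℕ) (ε : ℝ) : Prop where
  one_le : 1 ≤ s
  ne : ∀ m : ℕ, a / 2 ≠ -(m : ℂ)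
  ne' : ∀ j ∈ Finset.Icc 1 s, ∀ m : ℕ, 1 + a - b j ≠ -(m : ℂ) ∧ 1 + a - c j ≠ -(m : ℂ)
  pos : 0 < ε
  exp_pos : ∀ i j, i + j + 1 = s → 1 ≤ j →
    0 < decayExp (fun j => (1 + a - b j - c j).re) (fun l => max (1 + a - b l - c l).re ε) i j

lemma OddAdmissible.ne_zero (h : OddAdmissible a b c s ε) : a ≠ 0 := by
  rintro rfl; exact h.ne 0 (by simp)

lemma OddAdmissible.exists_tsum_norm_le (h : OddAdmissible a b c s ε) :
    ∃ C : ℝ, 0 < C ∧ ∀ K : ℕ, (Summable fun k => ‖chainTerm a b c (s - 1) 0 K k‖) ∧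
      ∑' k, ‖chainTerm a b c (s - 1) 0 K k‖ ≤ C * ((K : ℝ) + 1) ^
        (-(decayExp (fun j => (1 + a - b j - c j).re) (fun l => max (1 + a - b l - c l).re ε) (s - 1) 0 -
          (1 + a - b 1 - c 1).re)) :=
  exists_tsum_norm_chainTerm_le (U := fun j => (1 + a - b j - c j).re) (fun _ => rfl)
    (fun _ => lt_max_of_lt_right h.pos) (fun _ => le_max_left _ _) (s - 1) 0
    (fun j hj => h.ne' j (by simp only [Finset.mem_Icc] at hj ⊢; omega))
    (fun i j hi hij => h.exp_pos i j (by omega) (by omega))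

/-- The sharp rate, from `isSymbol_chainSum`. The estimate by norms would in general give
convergence of the outer sum on a smaller half-plane only. -/
lemma OddAdmissible.hasDecay_chainSum (h : OddAdmissible a b c s ε) :
    HasDecay (∑ j ∈ Finset.Icc 1 s, (1 + a - b j - c j).re - (1 + a - b 1 - c 1).re)
      (chainSum a b c (s - 1) 0) := by
  have hs := h.one_le
  have h1 := (isSymbol_chainSum (a := a) (b := b) (c := c) (U := fun j => (1 + a - b j - c j).re)
    (p := fun l => max (1 + a - b l - c l).re ε) (fun _ => rfl)
    (fun _ => lt_max_of_lt_right h.pos) (fun _ => le_max_left _ _) (s - 1) 0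
    (fun j hj => h.ne' j (by simp only [Finset.mem_Icc] at hj ⊢; omega))
    (fun i j hi hij => h.exp_pos i j (by omega) (by omega))).hasDecay
  rw [sumExp_eq_sum, show 0 + (s - 1) + 1 = s by omega] at h1
  exact h1

lemma OddAdmissible.exists_norm_multisumSeries_term_le (h : OddAdmissible a b c s ε) (ρ : ℝ) :
    ∃ C : ℝ, 0 < C ∧ ∀ z : ℂ, ‖z‖ ≤ ρ → ∀ k : ℕ,
      ‖rising (b 1) k * rising (c 1) k / k.factorial * chainSum a b c (s - 1) 0 k *
        rGamma (1 + a - z + k)‖ ≤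
      C * ((k : ℝ) + 1) ^ (-1 - 1 * (∑ j ∈ Finset.Icc 1 s, (1 + a - b j - c j).re - z.re)) := by
  obtain ⟨C₁, hC₁, h1⟩ := h.hasDecay_chainSum
  obtain ⟨C₂, hC₂, h2⟩ := exists_norm_rising_le ‖b 1‖
  obtain ⟨C₃, hC₃, h3⟩ := exists_norm_rising_le ‖c 1‖
  obtain ⟨C₄, hC₄, h4⟩ := exists_norm_rGamma_sub_add_le a ρ
  refine ⟨C₁ * C₂ * C₃ * C₄, by positivity, fun z hz k => ?_⟩
  have hk : (0 : ℝ) < (k : ℝ) + 1 := by positivity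
  set S := ∑ j ∈ Finset.Icc 1 s, (1 + a - b j - c j).re
  rw [norm_mul, norm_mul, norm_div, norm_mul, Complex.norm_natCast]
  calc _ ≤ C₂ * (k.factorial * ((k : ℝ) + 1) ^ ((b 1).re - 1)) *
        (C₃ * (k.factorial * ((k : ℝ) + 1) ^ ((c 1).re - 1))) / k.factorial *
        (C₁ * ((k : ℝ) + 1) ^ (-(S - (1 + a - b 1 - c 1).re))) *
        (C₄ * (((k : ℝ) + 1) ^ (z.re - a.re) / k.factorial)) := by
        gcongr
        exacts [h2 _ le_rfl k, h3 _ le_rfl k, h1 k, h4 z hz k]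
    _ = C₁ * C₂ * C₃ * C₄ * (((k : ℝ) + 1) ^ ((b 1).re - 1) * ((k : ℝ) + 1) ^ ((c 1).re - 1) *
        ((k : ℝ) + 1) ^ (-(S - (1 + a - b 1 - c 1).re)) * ((k : ℝ) + 1) ^ (z.re - a.re)) := by
        field_simp
    _ = _ := by
        rw [← Real.rpow_add hk, ← Real.rpow_add hk, ← Real.rpow_add hk]
        simp only [Complex.sub_re, Complex.add_re, Complex.one_re]
        ring_nf

lemma OddAdmissible.differentiableOn_multisumSeries (h : OddAdmissible a b c s ε) :
    DifferentiableOn ℂ (multisumSeries a b c s)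
      {z | z.re < ∑ j ∈ Finset.Icc 1 s, (1 + a - b j - c j).re} := by
  refine differentiableOn_tsum_of_halfPlane_bound one_pos (fun k => ?_)
    h.exists_norm_multisumSeries_term_le
  refine Differentiable.const_mul ?_ _
  exact differentiable_rGamma.comp (by fun_prop)

/-- Absolute summability of the multiple sum. -/
lemma OddAdmissible.summable_multisum (h : OddAdmissible a b c s ε) {z : ℂ}
    (hz : ∀ m : ℕ, 1 + a - z ≠ -(m : ℂ))
    (hpos : 0 < (1 + a - z - b 1 - c 1).re +
      (decayExp (fun j => (1 + a - b j - c j).re) (fun l => max (1 + a - b l - c l).re ε) (s - 1) 0 -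
          (1 + a - b 1 - c 1).re)) :
    Summable fun x : ℕ × (Fin (s - 1) → ℕ) =>
      rising (b 1) x.1 * rising (c 1) x.1 / (x.1.factorial * rising (1 + a - z) x.1) *
        chainTerm a b c (s - 1) 0 x.1 x.2 := by
  obtain ⟨C, hC, hs⟩ := h.exists_tsum_norm_le
  obtain ⟨D, hD, h1⟩ := exists_norm_rising_div_factorial_le (b 1)
  obtain ⟨E, hE, h2⟩ := exists_norm_rising_div_rising_le (c 1) hz
  set e := decayExp (fun j => (1 + a - b j - c j).re) (fun l => max (1 + a - b l - c l).re ε) (s - 1) 0 -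
          (1 + a - b 1 - c 1).re
  refine Summable.of_norm ?_
  rw [summable_prod_of_nonneg (fun _ => norm_nonneg _)]
  simp only [norm_mul _ (chainTerm _ _ _ _ _ _ _)]
  refine ⟨fun K => (hs K).1.mul_left _, ?_⟩
  simp only [tsum_mul_left]
  refine Summable.of_nonneg_of_le
    (fun r => mul_nonneg (norm_nonneg _) (tsum_nonneg fun _ => norm_nonneg _)) (fun K => ?_)
    ((summable_nat_add_one_rpow (x := -1 - ((1 + a - z - b 1 - c 1).re + e)) (by linarith)).mul_left
      (D * E * C))
  have hk : (0 : ℝ) < (K : ℝ) + 1 := by positivity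
  rw [← div_mul_div_comm, norm_mul]
  calc _ ≤ D * ((K : ℝ) + 1) ^ ((b 1).re - 1) * (E * ((K : ℝ) + 1) ^ (c 1 - (1 + a - z)).re) *
        (C * ((K : ℝ) + 1) ^ (-e)) := by
        gcongr
        exacts [h1 K, h2 K, (hs K).2]
    _ = D * E * C * (((K : ℝ) + 1) ^ ((b 1).re - 1) * ((K : ℝ) + 1) ^ (c 1 - (1 + a - z)).re *
        ((K : ℝ) + 1) ^ (-e)) := by ring
    _ = _ := by
        rw [← Real.rpow_add hk, ← Real.rpow_add hk]
        simp only [Complex.sub_re, Complex.add_re, Complex.one_re]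
        ring_nf

lemma wellPoisedSeries_eq {z : ℂ} (hz : ∀ m : ℕ, 1 + a - z ≠ -(m : ℂ)) :
    wellPoisedSeries a b c s z = rGamma (1 + a - z) *
      ∑' r, (∏ j ∈ Finset.Icc 1 s, baileyFactor a (b j) (c j) r) *
        (rising z r / rising (1 + a - z) r * wellPoised a r) := by
  rw [wellPoisedSeries, ← tsum_mul_left]
  refine tsum_congr fun r => ?_
  rw [rGamma_add_eq_div hz]
  ring

lemma multisumSeries_eq {z : ℂ} (hz : ∀ m : ℕ, 1 + a - z ≠ -(m : ℂ)) :
    multisumSeries a b c s z = rGamma (1 + a - z) *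
      ∑' K, rising (b 1) K * rising (c 1) K / (K.factorial * rising (1 + a - z) K) *
        chainSum a b c (s - 1) 0 K := by
  rw [multisumSeries, ← tsum_mul_left]
  refine tsum_congr fun K => ?_
  rw [rGamma_add_eq_div hz, ← div_div]
  ring

lemma hasDecay_wellPoised_mul {z : ℂ} (hz : ∀ m : ℕ, 1 + a - z ≠ -(m : ℂ)) :
    HasDecay (1 - 2 * z.re) (fun r => rising z r / rising (1 + a - z) r * wellPoised a r) := by
  have h := (hasDecay_rising_div_rising z hz).mul (hasDecay_wellPoised a)
  refine Eq.mp ?_ h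
  congr 1
  simp only [Complex.sub_re, Complex.add_re, Complex.one_re]
  ring

/-- The identity in the domain of absolute convergence. -/
lemma OddAdmissible.series_eq_of_summable (h : OddAdmissible a b c s ε)
    (hu : 0 < (1 + a - b s - c s).re) {z : ℂ} (hz : ∀ m : ℕ, 1 + a - z ≠ -(m : ℂ))
    (hσ : z.re < ∑ j ∈ Finset.Icc 1 s, (1 + a - b j - c j).re)
    (hs : Summable fun x : ℕ × (Fin (s - 1) → ℕ) =>
      rising (b 1) x.1 * rising (c 1) x.1 / (x.1.factorial * rising (1 + a - z) x.1) *
        chainTerm a b c (s - 1) 0 x.1 x.2) :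
    wellPoisedSeries a b c s z = gammaQuotient a (b s) (c s) * multisumSeries a b c s z := by
  obtain ⟨n, rfl⟩ : ∃ n, s = n + 1 := ⟨s - 1, by have := h.one_le; omega⟩
  rw [Nat.add_sub_cancel] at hs
  have hlast := h.ne' (n + 1) (by simp)
  have e : ∀ x : ℕ × (Fin n → ℕ), rising (b 1) x.1 * rising (c 1) x.1 *
      (rGamma (1 + a) / (x.1.factorial * rising (1 + a - z) x.1)) * chainTerm a b c n 0 x.1 x.2 =
      rGamma (1 + a) * (rising (b 1) x.1 * rising (c 1) x.1 /
        (x.1.factorial * rising (1 + a - z) x.1) * chainTerm a b c n 0 x.1 x.2) := fun x => by ring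
  have hmain := (isBaileyPair_wellPoised h.ne_zero hz).tsum_chain_eq h.ne'
    ((hs.mul_left (rGamma (1 + a))).congr fun x => (e x).symm) hu (hasDecay_wellPoised_mul hz)
    (by linarith)
  simp only [e] at hmain
  rw [tsum_mul_left, hs.tsum_prod] at hmain
  rw [wellPoisedSeries_eq hz, multisumSeries_eq hz, gammaQuotient_eq, Nat.add_sub_cancel]
  have e2 : ∑' K, rising (b 1) K * rising (c 1) K / (K.factorial * rising (1 + a - z) K) *
        chainSum a b c n 0 K = ∑' (K : ℕ) (k : Fin n → ℕ), rising (b 1) K * rising (c 1) K /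
        (K.factorial * rising (1 + a - z) K) * chainTerm a b c n 0 K k :=
    tsum_congr fun K => by rw [tsum_mul_left, chainSum]
  rw [e2]
  have k1 := rGamma_ne_zero (fun m => (hlast m).1)
  have k2 := rGamma_ne_zero (fun m => (hlast m).2)
  have k3 := rGamma_ne_zero (ne_neg_nat_of_re_pos hu)
  have i1 : Complex.Gamma (1 + a - b (n + 1)) = (rGamma (1 + a - b (n + 1)))⁻¹ := by simp [rGamma]
  have i2 : Complex.Gamma (1 + a - c (n + 1)) = (rGamma (1 + a - c (n + 1)))⁻¹ := by simp [rGamma]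
  have i3 : Complex.Gamma (1 + a - b (n + 1) - c (n + 1)) =
    (rGamma (1 + a - b (n + 1) - c (n + 1)))⁻¹ := by simp [rGamma]
  rw [i3] at hmain
  rw [i1, i2]
  field_simp at hmain ⊢
  linear_combination -rGamma (1 + a - z) * hmain

/-- The identity for `s = 1`, when `Re z` is sufficiently small. -/
lemma wellPoisedSeries_one_eq (ha : a ≠ 0)
    (hb : ∀ m : ℕ, 1 + a - b 1 ≠ -(m : ℂ)) (hc : ∀ m : ℕ, 1 + a - c 1 ≠ -(m : ℂ)) {z : ℂ}
    (hz : ∀ m : ℕ, 1 + a - z ≠ -(m : ℂ)) (hzb : 0 < (1 + a - z - b 1).re)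
    (hσ : 0 < (1 + a - z - b 1 - c 1).re) :
    wellPoisedSeries a b c 1 z = gammaQuotient a (b 1) (c 1) * multisumSeries a b c 1 z := by
  have hd1 : 0 < (1 + a - c 1 - z - b 1).re := by
    rwa [show 1 + a - c 1 - z - b 1 = 1 + a - z - b 1 - c 1 by ring]
  -- For `s = 1` the sign of `Re (1 + a - b 1 - c 1)` is not known, so `z` and `c 1` exchange roles:
  -- the initial pair carries `c 1` and the limit step uses `z` and `b 1`. Both resulting single
  -- sums are Gauss series.
  have hB := (isBaileyPair_wellPoised ha hc).tsum_eq hz hb hzb (hasDecay_wellPoised_mul hc)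
    (by simp only [Complex.sub_re, Complex.add_re, Complex.one_re] at hσ ⊢; linarith)
  have hk3 := rGamma_ne_zero hc
  have h1 : ∑' n, gaussTerm z (b 1) (1 + a - c 1) n = rGamma (1 + a - c 1) *
      ∑' n : ℕ, rising z n * rising (b 1) n / (n.factorial * rising (1 + a - c 1) n) := by
    rw [← tsum_mul_left]
    refine tsum_congr fun n => ?_
    rw [gaussTerm, rGamma_add_eq_div hc, ← div_div]
    ring
  have h2 : ∑' n : ℕ, rising z n * rising (b 1) n *
      (rGamma (1 + a) / (n.factorial * rising (1 + a - c 1) n)) = rGamma (1 + a) *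
      ∑' n : ℕ, rising z n * rising (b 1) n / (n.factorial * rising (1 + a - c 1) n) := by
    rw [← tsum_mul_left]
    exact tsum_congr fun n => by ring
  have h3 := hB.tsum_eq
  rw [h2] at h3
  rw [tsum_gaussTerm hd1] at h1
  have h4 : multisumSeries a b c 1 z = ∑' n, gaussTerm (b 1) (c 1) (1 + a - z) n := by
    refine tsum_congr fun n => ?_
    simp [chainSum, chainTerm, gaussTerm]
  rw [h4, tsum_gaussTerm hσ, wellPoisedSeries_eq hz, gammaQuotient_eq]
  have h5 : ∑' r, (∏ j ∈ Finset.Icc 1 1, baileyFactor a (b j) (c j) r) *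
      (rising z r / rising (1 + a - z) r * wellPoised a r) =
      ∑' r, baileyFactor a z (b 1) r * (rising (c 1) r / rising (1 + a - c 1) r * wellPoised a r) := by
    refine tsum_congr fun r => ?_
    simp only [Finset.Icc_self, Finset.prod_singleton, baileyFactor, ← div_mul_div_comm]
    ring
  rw [h5]
  have k1 := rGamma_ne_zero hb
  have k2 := rGamma_ne_zero (ne_neg_nat_of_re_pos hzb)
  have i1 : Complex.Gamma (1 + a - b 1) = (rGamma (1 + a - b 1))⁻¹ := by simp [rGamma]
  have i2 : Complex.Gamma (1 + a - c 1) = (rGamma (1 + a - c 1))⁻¹ := by simp [rGamma]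
  have i3 : Complex.Gamma (1 + a - z - b 1) = (rGamma (1 + a - z - b 1))⁻¹ := by simp [rGamma]
  rw [i3] at h3
  rw [show 1 + a - c 1 - z - b 1 = 1 + a - z - b 1 - c 1 by ring,
    show 1 + a - c 1 - z = 1 + a - z - c 1 by ring,
    show 1 + a - c 1 - b 1 = 1 + a - b 1 - c 1 by ring] at h1
  rw [i1, i2]
  generalize ∑' n : ℕ, rising z n * rising (b 1) n / (n.factorial * rising (1 + a - c 1) n) = S at *
  generalize ∑' r, baileyFactor a z (b 1) r *
    (rising (c 1) r / rising (1 + a - c 1) r * wellPoised a r) = W at *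
  field_simp at h3 ⊢
  linear_combination -rGamma (1 + a - c 1) * h3 - rGamma (1 + a) * rGamma (1 + a - z - b 1) * h1

/-- The identity on the whole half-plane of convergence. -/
theorem OddAdmissible.series_eq (h : OddAdmissible a b c s ε) {z : ℂ}
    (hσ : z.re < ∑ j ∈ Finset.Icc 1 s, (1 + a - b j - c j).re) :
    wellPoisedSeries a b c s z = gammaQuotient a (b s) (c s) * multisumSeries a b c s z := by
  rcases h.one_le.eq_or_lt with hs | hs
  · subst hs
    -- Left of this abscissa `1 + a - w` and `1 + a - w - b 1` have positive real part.
    refine eqOn_halfPlane (σ' := min (1 + a).re (1 + a - b 1).re)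
      (differentiableOn_wellPoisedSeries h.ne')
      (h.differentiableOn_multisumSeries.const_mul _) (fun w hw hw' => ?_) hσ
    have h1 := h.ne' 1 (by simp)
    rw [lt_min_iff] at hw'
    simp only [Finset.Icc_self, Finset.sum_singleton] at hw
    refine wellPoisedSeries_one_eq h.ne_zero (fun m => (h1 m).1) (fun m => (h1 m).2)
      (ne_neg_nat_of_re_pos (by rw [Complex.sub_re]; linarith)) ?_ ?_
    · simp only [Complex.sub_re, Complex.add_re, Complex.one_re] at hw' ⊢; linarith
    · simp only [Complex.sub_re, Complex.add_re, Complex.one_re] at hw ⊢; linarith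
  · have hu : 0 < (1 + a - b s - c s).re := by
      have h1 := h.exp_pos 0 (s - 1) (by omega) (by omega)
      rw [decayExp, show s - 1 + 1 = s by omega] at h1
      exact h1
    -- Left of this abscissa `1 + a - w` has positive real part and the full multiple sum is
    -- absolutely summable.
    refine eqOn_halfPlane (σ' := min (1 + a).re ((1 + a - b 1 - c 1).re +
        (decayExp (fun j => (1 + a - b j - c j).re) (fun l => max (1 + a - b l - c l).re ε) (s - 1) 0 -
          (1 + a - b 1 - c 1).re)))
      (differentiableOn_wellPoisedSeries h.ne')
      (h.differentiableOn_multisumSeries.const_mul _) (fun w hw hw' => ?_) hσ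
    rw [lt_min_iff] at hw'
    have hz : ∀ m : ℕ, 1 + a - w ≠ -(m : ℂ) :=
      ne_neg_nat_of_re_pos (by rw [Complex.sub_re]; linarith)
    refine h.series_eq_of_summable hu hz hw (h.summable_multisum hz ?_)
    rw [show 1 + a - w - b 1 - c 1 = 1 + a - b 1 - c 1 - w by ring, Complex.sub_re]
    linarith

end Odd

/-! ### The series of argument `1`: iterated sum and absolutely summable multiple sum. -/

lemma exists_oddAdmissible {s : ℕ} {a : ℂ} {b c : ℕ → ℂ} (hs : 1 ≤ s)
    (ha : ∀ m : ℕ, a / 2 ≠ -(m : ℂ))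
    (hbc : ∀ j ∈ Finset.Icc 1 s, ∀ m : ℕ, 1 + a - b j ≠ -(m : ℂ) ∧ 1 + a - c j ≠ -(m : ℂ))
    (h₂ : ∀ r ∈ Finset.Icc 2 s, ∀ A : ℕ → ℕ, (∀ j, A j = 1 ∨ A j = 2) →
      0 < ((1 + a - b s - c s) +
        ∑ j ∈ Finset.Icc r (s - 1), (A j : ℂ) * (1 + a - b j - c j)).re) {w : ℝ} (hw : 0 < w) :
    ∃ ε : ℝ, s * ε < w ∧ OddAdmissible a b c s ε := by
  obtain ⟨ε, hε, hεw, hE⟩ := exists_pos_forall_decayExp_pos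
    (U := fun j => (1 + a - b j - c j).re) (N := s) (fun r hr A hA => by
      have h := h₂ r hr A hA
      rw [Complex.add_re, re_sum_natCast_mul] at h
      exact h) hw
  exact ⟨ε, hεw, hs, ha, hbc, hε, hE⟩

/-- The identity between the very-well-poised series of argument `1` and the iterated multiple
sum. -/
theorem hypergeometric_odd_eq_iterated_multisum (s : ℕ) (a : ℂ) (b c : ℕ → ℂ) (hs : 1 ≤ s)
    (ha : ∀ m : ℕ, a / 2 ≠ -(m : ℂ)) (hc₀ : ∀ m : ℕ, 1 + a - c 0 ≠ -(m : ℂ))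
    (hbc : ∀ j ∈ Finset.Icc 1 s, ∀ m : ℕ, 1 + a - b j ≠ -(m : ℂ) ∧ 1 + a - c j ≠ -(m : ℂ))
    (h₁ : 0 < (2 * (s : ℂ) * (a + 1) - 2 * c 0 - 2 * ∑ j ∈ Finset.Icc 1 s, (b j + c j)).re)
    (h₂ : ∀ r ∈ Finset.Icc 2 s, ∀ A : ℕ → ℕ, (∀ j, A j = 1 ∨ A j = 2) →
      0 < ((1 + a - b s - c s) +
        ∑ j ∈ Finset.Icc r (s - 1), (A j : ℂ) * (1 + a - b j - c j)).re) :
    Summable (hypergeometricTerm (upperOdd s a b c) (lowerOdd s a b c) 1) ∧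
      (∀ k₁ : ℕ, Summable fun k : Fin (s - 1) → ℕ => multisumTermOdd s a b c k₁ k) ∧
      (Summable fun k₁ : ℕ => ∑' k : Fin (s - 1) → ℕ, multisumTermOdd s a b c k₁ k) ∧
      hypergeometricSum (upperOdd s a b c) (lowerOdd s a b c) 1 =
        gammaQuotient a (b s) (c s) *
          ∑' k₁ : ℕ, ∑' k : Fin (s - 1) → ℕ, multisumTermOdd s a b c k₁ k := by
  obtain ⟨ε, -, h⟩ := exists_oddAdmissible hs ha hbc h₂ one_pos
  have hσ : (c 0).re < ∑ j ∈ Finset.Icc 1 s, (1 + a - b j - c j).re := by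
    have e := sum_re_eq a b c s
    rw [sub_right_comm, Complex.sub_re, ← e] at h₁
    simp only [Complex.mul_re, Complex.re_ofNat, Complex.im_ofNat, zero_mul, sub_zero] at h₁
    linarith
  have hterm : hypergeometricTerm (upperOdd s a b c) (lowerOdd s a b c) 1 =
      fun k => (∏ j ∈ Finset.Icc 1 s, baileyFactor a (b j) (c j) k) *
        (rising (c 0) k / rising (1 + a - c 0) k * wellPoised a k) :=
    funext fun k => hypergeometricTerm_odd ha k
  have hinner : ∀ k₁ : ℕ, ∑' k : Fin (s - 1) → ℕ, multisumTermOdd s a b c k₁ k =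
      rising (b 1) k₁ * rising (c 1) k₁ / (k₁.factorial * rising (1 + a - c 0) k₁) *
        chainSum a b c (s - 1) 0 k₁ := fun k₁ => by
    simp only [multisumTermOdd_eq]
    rw [tsum_mul_left, chainSum]
  have hG := rGamma_ne_zero hc₀
  refine ⟨?_, fun k₁ => ?_, ?_, ?_⟩
  · rw [hterm]
    exact ((hasDecay_prod_baileyFactor _ hbc).mul (hasDecay_wellPoised_mul hc₀)).summable (by linarith)
  · simp only [multisumTermOdd_eq]
    obtain ⟨C, -, hC⟩ := h.exists_tsum_norm_le
    exact (hC k₁).1.of_norm.mul_left _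
  · simp only [hinner]
    rw [← summable_mul_left_iff hG]
    obtain ⟨C, -, hC⟩ := h.exists_norm_multisumSeries_term_le ‖c 0‖
    refine (Summable.of_norm_bounded ((summable_nat_add_one_rpow (by linarith)).mul_left C)
      (hC (c 0) le_rfl)).congr fun k => ?_
    rw [rGamma_add_eq_div hc₀, ← div_div]
    ring
  · have hmain := h.series_eq hσ
    rw [wellPoisedSeries_eq hc₀, multisumSeries_eq hc₀] at hmain
    simp only [hinner]
    rw [hypergeometricSum, hterm]
    -- The regularizing factor `1 / Γ(1 + a - c 0)` is non-zero and is removed again.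
    refine mul_left_cancel₀ hG (hmain.trans ?_)
    ring

/-- Absolute summability of the multiple sum in the odd case. -/
theorem summable_multisumTermOdd (s : ℕ) (a : ℂ) (b c : ℕ → ℂ) (hs : 1 ≤ s)
    (ha : ∀ m : ℕ, a / 2 ≠ -(m : ℂ)) (hc₀ : ∀ m : ℕ, 1 + a - c 0 ≠ -(m : ℂ))
    (hbc : ∀ j ∈ Finset.Icc 1 s, ∀ m : ℕ, 1 + a - b j ≠ -(m : ℂ) ∧ 1 + a - c j ≠ -(m : ℂ))
    (h₂ : ∀ r ∈ Finset.Icc 2 s, ∀ A : ℕ → ℕ, (∀ j, A j = 1 ∨ A j = 2) →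
      0 < ((1 + a - b s - c s) +
        ∑ j ∈ Finset.Icc r (s - 1), (A j : ℂ) * (1 + a - b j - c j)).re)
    (h₃ : ∀ A : ℕ → ℕ, (∀ j, A j = 1 ∨ A j = 2) →
      0 < ((1 + a - c 0 - b 1 - c 1) +
        ∑ j ∈ Finset.Icc 2 (s - 1), (A j : ℂ) * (1 + a - b j - c j)).re)
    (h₄ : 2 ≤ s → ∀ A : ℕ → ℕ, (∀ j, A j = 1 ∨ A j = 2) →
      0 < ((1 + a - c 0 - b 1 - c 1) + (1 + a - b 1 - c 1) +
        ∑ j ∈ Finset.Icc 2 (s - 1), (A j : ℂ) * (1 + a - b j - c j) + (1 + a - b s - c s)).re) :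
    Summable fun p : ℕ × (Fin (s - 1) → ℕ) => multisumTermOdd s a b c p.1 p.2 := by
  simp only [multisumTermOdd_eq]
  set U : ℕ → ℝ := fun j => (1 + a - b j - c j).re with hU
  set A : ℕ → ℕ := fun j => if 0 ≤ U j then 1 else 2 with hAdef
  have hA : ∀ j, A j = 1 ∨ A j = 2 := fun j => by simp only [hAdef]; split_ifs <;> simp
  have e₃ := h₃ A hA
  rw [Complex.add_re, re_sum_natCast_mul] at e₃
  rcases hs.eq_or_lt with rfl | hs2
  · obtain ⟨ε, -, h⟩ := exists_oddAdmissible le_rfl ha hbc h₂ one_pos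
    refine h.summable_multisum hc₀ ?_
    simpa [decayExp] using e₃
  · have e₂ := h₂ s (by simp only [Finset.mem_Icc]; omega) A hA
    rw [Finset.Icc_eq_empty (by omega), Finset.sum_empty, add_zero] at e₂
    have e₄ := h₄ hs2 A hA
    rw [Complex.add_re, Complex.add_re, Complex.add_re, re_sum_natCast_mul] at e₄
    set v := (1 + a - c 0 - b 1 - c 1).re
    set S := ∑ j ∈ Finset.Icc 2 (s - 1), (A j : ℝ) * (1 + a - b j - c j).re
    -- The entries of the minimum belong to `U 1 ≥ 0` and `U 1 < 0`, that is to coefficient `1` or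
    -- `2` at `U 1`. The first is positive as the sum of `e₃` and `e₂`, the second is the additional
    -- condition `e₄`.
    obtain ⟨ε, hεw, h⟩ := exists_oddAdmissible hs ha hbc h₂
      (w := min (v + S + U s) (v + U 1 + S + U s)) (lt_min (by linarith) e₄)
    refine h.summable_multisum hc₀ ?_
    have hle := le_decayExp (U := U) h.pos (s - 1) 0
    rw [zero_add, add_zero, ← Finset.add_sum_Ioc_eq_sum_Icc (a := 1) (b := s - 1) (by omega),
      show s - 1 + 1 = s by omega] at hle
    -- On natural numbers `Ioc 1 (s - 1)` and `Icc 2 (s - 1)` unfold to the same range.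
    have eS : ∑ l ∈ Finset.Ioc 1 (s - 1), ((if 0 ≤ U l then 1 else 2 : ℕ) : ℝ) * U l = S := rfl
    rw [eS] at hle
    have h5 : ((s - 1 : ℕ) : ℝ) * ε ≤ s * ε := by
      have := h.pos
      gcongr; omega
    have h6 := min_le_left (v + S + U s) (v + U 1 + S + U s)
    have h7 := min_le_right (v + S + U s) (v + U 1 + S + U s)
    have h8 : U 1 = (1 + a - b 1 - c 1).re := rfl
    split_ifs at hle with hU1
    · push_cast at hle; linarith
    · push_cast at hle; linarith

theorem proposition2 :
    -- (i)
    (∀ (s : ℕ) (a : ℂ) (b c : ℕ → ℂ), 1 ≤ s →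
      (∀ m : ℕ, a / 2 ≠ -(m : ℂ)) →
      (∀ j ∈ Finset.Icc 1 (s + 1), ∀ m : ℕ,
        1 + a - b j ≠ -(m : ℂ) ∧ 1 + a - c j ≠ -(m : ℂ)) →
      0 < ((2 * (s : ℂ) + 1) * (a + 1) - 2 * ∑ j ∈ Finset.Icc 1 (s + 1), (b j + c j)).re →
      (∀ r ∈ Finset.Icc 2 (s + 1), ∀ A : ℕ → ℕ, (∀ j, A j = 1 ∨ A j = 2) →
        0 < ((1 + a - b (s + 1) - c (s + 1)) +
          ∑ j ∈ Finset.Icc r s, (A j : ℂ) * (1 + a - b j - c j)).re) →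
      Summable (hypergeometricTerm (upperEven s a b c) (lowerEven s a b c) (-1)) ∧
      Summable (multisumTermEven s a b c) ∧
      hypergeometricSum (upperEven s a b c) (lowerEven s a b c) (-1) =
        gammaQuotient a (b (s + 1)) (c (s + 1)) *
          ∑' k : Fin s → ℕ, multisumTermEven s a b c k) ∧
    -- (ii)
    (∀ (s : ℕ) (a : ℂ) (b c : ℕ → ℂ), 1 ≤ s →
      (∀ m : ℕ, a / 2 ≠ -(m : ℂ)) →
      (∀ m : ℕ, 1 + a - c 0 ≠ -(m : ℂ)) →
      (∀ j ∈ Finset.Icc 1 s, ∀ m : ℕ,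
        1 + a - b j ≠ -(m : ℂ) ∧ 1 + a - c j ≠ -(m : ℂ)) →
      0 < (2 * (s : ℂ) * (a + 1) - 2 * c 0 - 2 * ∑ j ∈ Finset.Icc 1 s, (b j + c j)).re →
      (∀ r ∈ Finset.Icc 2 s, ∀ A : ℕ → ℕ, (∀ j, A j = 1 ∨ A j = 2) →
        0 < ((1 + a - b s - c s) +
          ∑ j ∈ Finset.Icc r (s - 1), (A j : ℂ) * (1 + a - b j - c j)).re) →
      (∀ A : ℕ → ℕ, (∀ j, A j = 1 ∨ A j = 2) →
        0 < ((1 + a - c 0 - b 1 - c 1) +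
          ∑ j ∈ Finset.Icc 2 (s - 1), (A j : ℂ) * (1 + a - b j - c j)).re) →
      -- the identity; the multiple sum is evaluated with the summation over `k₁` outermost
      (Summable (hypergeometricTerm (upperOdd s a b c) (lowerOdd s a b c) 1) ∧
        (∀ k₁ : ℕ, Summable fun k : Fin (s - 1) → ℕ => multisumTermOdd s a b c k₁ k) ∧
        (Summable fun k₁ : ℕ => ∑' k : Fin (s - 1) → ℕ, multisumTermOdd s a b c k₁ k) ∧
        hypergeometricSum (upperOdd s a b c) (lowerOdd s a b c) 1 =
          gammaQuotient a (b s) (c s) *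
            ∑' k₁ : ℕ, ∑' k : Fin (s - 1) → ℕ, multisumTermOdd s a b c k₁ k) ∧
      -- the order of summation is irrelevant under one more condition, void for `s = 1`
      ((2 ≤ s → ∀ A : ℕ → ℕ, (∀ j, A j = 1 ∨ A j = 2) →
          0 < ((1 + a - c 0 - b 1 - c 1) + (1 + a - b 1 - c 1) +
            ∑ j ∈ Finset.Icc 2 (s - 1), (A j : ℂ) * (1 + a - b j - c j) +
            (1 + a - b s - c s)).re) →
        (Summable fun p : ℕ × (Fin (s - 1) → ℕ) => multisumTermOdd s a b c p.1 p.2) ∧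
        hypergeometricSum (upperOdd s a b c) (lowerOdd s a b c) 1 =
          gammaQuotient a (b s) (c s) *
            ∑' p : ℕ × (Fin (s - 1) → ℕ), multisumTermOdd s a b c p.1 p.2)) := by
  refine ⟨fun s a b c hs ha hbc h₁ h₂ => hypergeometric_even_eq_multisum s a b c hs ha hbc h₁ h₂,
    fun s a b c hs ha hc₀ hbc h₁ h₂ h₃ => ?_⟩
  have h := hypergeometric_odd_eq_iterated_multisum s a b c hs ha hc₀ hbc h₁ h₂
  refine ⟨h, fun h₄ => ?_⟩
  have hsum := summable_multisumTermOdd s a b c hs ha hc₀ hbc h₂ h₃ h₄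
  exact ⟨hsum, by rw [hsum.tsum_prod]; exact h.2.2.2⟩
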